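/- Let $\mathbf T^3=(\mathbf R/\mathbf Z)^3$ with Lebesgue measure (total mass $1$). For $\delta>1$ let $B_\delta$ be the space of real continuous functions $g$ on $\mathbf T^3$ with $$|g|_\delta:=\sum_{k\in\mathbf Z^3}|\mathcal F g(k)|\,\delta^{|k|}<\infty ,$$ where $\mathcal F g(k)$ are the Fourier coefficients of $g$ and $|k|$ is the Euclidean norm; a vector field is in $B_\delta$ when its components are. Let $(M,\mu)$ be a probability space, $\delta_0>\delta_1>1$, $C_0>0$, and let $(\rho_\theta(0))_{\theta\in M}$ and $(\xi_\theta(0))_{\theta\in M}$ be families of functions, respectively of vector fields with values in $\mathbf R^3$, on $\mathbf T^3$, in $B_{\delta_0}$, such that $\theta\mapsto\rho_\theta(0,x)$ and $\theta\mapsto\xi_\theta(0,x)$ are measurable for every $x$, $$\sup_\theta|\rho_\theta(0)|_{\delta_0}\le C_0,\qquad \sup_\theta|\xi_\theta(0)|_{\delta_0}\le C_0$$ (for each component of $\xi_\theta(0)$), and $$\int_M\int_{\mathbf T^3}\rho_\theta(0,x)\,dx\,\mu(d\theta)=1 .$$ **Theorem.** There are a time $T_0>0$, families $(\rho_\theta)_\theta$,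 $(\xi_\theta)_\theta$ in $C([0,T_0],B_{\delta_1})$, measurable in $\theta$ and bounded in $B_{\delta_1}$ uniformly in $\theta\in M$ and $t\in[0,T_0]$, and a potential $\phi(t,x)$, of class $C^2$ in $x$, which solve the multifluid Vlasov–Poisson system in the classical sense on $[0,T_0]\times\mathbf T^3$: $$\partial_t\rho_\theta+\nabla_x\cdot(\xi_\theta\rho_\theta)=0,\qquad \partial_t\xi_\theta+(\xi_\theta\cdot\nabla_x)\xi_\theta=-\nabla_x\phi\qquad(\theta\in M),$$ $$-\Delta\phi=\int_M\rho_\theta\,\mu(d\theta)-1,$$ with initial data $(\rho_\theta(0),\xi_\theta(0))_\theta$. Moreover, if $\rho_\theta(0)\ge0$ for all $\theta$, then $\rho_\theta(t)\ge0$ for all $\theta\in M$, $t\in[0,T_0]$, and $$f(t,dx,d\xi)=\Big(\int_M\rho_\theta(t,x)\,\delta(\xi-\xi_\theta(t,x))\,\mu(d\theta)\Big)dx$$ is a suitable weak solution of the Vlasov–Poisson system on $[0,T_0)$ with initial datum $f^0=f(0)$. Here $f$ is a *weak solution* on $[0,T)$ with initial datum $f^0$ and potential $\phi$ if * $f(0)=f^0$,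 and $f\in C([0,T),\mathcal P_2(\mathbf T^3\times\mathbf R^3))$, where $\mathcal P_2$ is the set of probability measures with $\int|\xi|^2<\infty$, with the weak-$*$ topology (tested against bounded continuous functions); * $\nabla_x\phi\in L^1(0,T;C(\mathbf T^3))$, and for all $\psi\in C_c^\infty([0,T)\times\mathbf T^3\times\mathbf R^3)$, $$\int_0^T\!\!\int(\partial_t\psi+\xi\cdot\nabla_x\psi-\nabla_x\phi\cdot\nabla_\xi\psi)\,f(t,dx,d\xi)\,dt=-\int\psi|_{t=0}\,f^0(dx,d\xi);$$ * for all $t\in[0,T)$, $-\Delta\phi(t)=\rho(t)-1$ in the sense of distributions on $\mathbf T^3$, where $\rho=\int_{\mathbf R^3}f(\cdot,\cdot,d\xi)$; * for all $t\in[0,T)$, the current $j=\int_{\mathbf R^3}\xi f(\cdot,\cdot,d\xi)$ satisfies $\partial_tj+\nabla_x\cdot\int_{\mathbf R^3}\xi\otimes\xi\,f(\cdot,\cdot,d\xi)=-\rho\,\nabla_x\phi$, tested against smooth functions of $x$; and it is *suitable* if moreover $$\|\rho\|_{L^\infty(0,T;L^1\cap L^\infty(\mathbf T^3))}<\infty,\qquad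 \Big\|\int_{\mathbf R^3}|\xi|^4f(t,x,d\xi)\Big\|_{L^\infty(0,T;L^1(\mathbf T^3))}<\infty .$$ -/

import Mathlib

open Set Filter Topology MeasureTheory
open scoped NNReal ENNReal ContDiff

noncomputable section

namespace VlasovPoisson

/-- The three-dimensional flat torus `(ℝ/ℤ)³`. -/
abbrev T3 : Type := UnitAddTorus (Fin 3)

/-- The momentum space `ℝ³` with its Euclidean norm. -/
abbrev R3 : Type := EuclideanSpace ℝ (Fin 3)

/-- Lebesgue measure on the torus, of total mass one. It is the measure that Mathlib's
Fourier coefficients `UnitAddTorus.mFourierCoeff` are computed with. -/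
def torusMeasure : Measure T3 := Measure.pi fun _ => AddCircle.haarAddCircle

/-- The covering map `ℝ³ → (ℝ/ℤ)³`. -/
def torusProj (v : Fin 3 → ℝ) : T3 := fun i => (v i : UnitAddCircle)

/-- `g` is of class `C^n` on the torus: its periodic lift to `ℝ³` is of class `C^n`. -/
def TorusContDiff (n : WithTop ℕ∞) (g : T3 → ℝ) : Prop :=
  ContDiff ℝ n fun v : Fin 3 → ℝ => g (torusProj v)

/-- The partial derivative `∂ᵢ g` of a function on the torus. -/
def torusPartial (i : Fin 3) (g : T3 → ℝ) (x : T3) : ℝ :=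
  deriv (fun s : ℝ => g (x + Pi.single i (s : UnitAddCircle))) 0

/-- The Laplacian `Δ g = ∑ᵢ ∂ᵢ ∂ᵢ g` on the torus. -/
def torusLaplacian (g : T3 → ℝ) (x : T3) : ℝ :=
  ∑ i, torusPartial i (torusPartial i g) x

/-! ### The analytic spaces `B_δ` -/

/-- The Euclidean length `|k|` of a frequency `k ∈ ℤ³`. -/
def freqNorm (k : Fin 3 → ℤ) : ℝ := Real.sqrt (∑ i, (k i : ℝ) ^ 2)

/-- The terms `|𝓕 g (k)| δ^|k|` of the series that defines the norm of `B_δ`. -/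
def bTerm (δ : ℝ) (g : C(T3, ℝ)) (k : Fin 3 → ℤ) : ℝ :=
  ‖UnitAddTorus.mFourierCoeff (fun x : T3 => ((g x : ℝ) : ℂ)) k‖ * δ ^ freqNorm k

/-- Membership in `B_δ` (every element of `B_δ` has a continuous representative). -/
def MemB (δ : ℝ) (g : C(T3, ℝ)) : Prop := Summable (bTerm δ g)

/-- The norm `|g|_δ = ∑ₖ |𝓕 g (k)| δ^|k|` for `g ∈ B_δ`. -/
def bNorm (δ : ℝ) (g : C(T3, ℝ)) : ℝ := ∑' k, bTerm δ g k

/-- `u ∈ C([0,T], B_δ)`, continuity being meant for the norm of `B_δ`. -/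
def ContinuousInB (T δ : ℝ) (u : ℝ → C(T3, ℝ)) : Prop :=
  (∀ t ∈ Icc 0 T, MemB δ (u t)) ∧
    ∀ t₀ ∈ Icc 0 T, Tendsto (fun t => bNorm δ (u t - u t₀)) (𝓝[Icc 0 T] t₀) (𝓝 0)

/-! ### The multifluid system -/

section Multifluid

variable {M : Type*} [MeasurableSpace M]

/-- Classical solutions on `[0,T]` of the multifluid Vlasov–Poisson system
`∂ₜ ρ_θ + ∇·(ξ_θ ρ_θ) = 0`, `∂ₜ ξ_θ + (ξ_θ·∇) ξ_θ = -∇φ`, `-Δφ = ∫ ρ_θ dμ(θ) - 1`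
with initial data `(ρ0_θ, ξ0_θ)`. Here `ξ θ t j` is the `j`-th component of `ξ_θ(t)`. -/
structure IsMultifluidSolution (μ : Measure M) (T : ℝ)
    (ρ0 : M → C(T3, ℝ)) (ξ0 : M → Fin 3 → C(T3, ℝ))
    (ρ : M → ℝ → C(T3, ℝ)) (ξ : M → ℝ → Fin 3 → C(T3, ℝ)) (φ : ℝ → C(T3, ℝ)) : Prop where
  measurable_density : ∀ t ∈ Icc 0 T, ∀ x, Measurable fun θ => ρ θ t x
  measurable_momentum : ∀ t ∈ Icc 0 T, ∀ j x, Measurable fun θ => ξ θ t j x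
  integrable_density : ∀ t ∈ Icc 0 T, ∀ x, Integrable (fun θ => ρ θ t x) μ
  contDiff_density : ∀ θ, ∀ t ∈ Icc 0 T, TorusContDiff 1 (ρ θ t)
  contDiff_momentum : ∀ θ, ∀ t ∈ Icc 0 T, ∀ j, TorusContDiff 1 (ξ θ t j)
  contDiff_potential : ∀ t ∈ Icc 0 T, TorusContDiff 2 (φ t)
  continuity : ∀ θ, ∀ t ∈ Icc 0 T, ∀ x,
    HasDerivWithinAt (fun s => ρ θ s x)
      (-∑ i, torusPartial i (fun y => ξ θ t i y * ρ θ t y) x) (Icc 0 T) t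
  momentum : ∀ θ, ∀ t ∈ Icc 0 T, ∀ j x,
    HasDerivWithinAt (fun s => ξ θ s j x)
      (-(∑ i, ξ θ t i x * torusPartial i (ξ θ t j) x) - torusPartial j (φ t) x) (Icc 0 T) t
  poisson : ∀ t ∈ Icc 0 T, ∀ x, -torusLaplacian (φ t) x = (∫ θ, ρ θ t x ∂μ) - 1
  initial_density : ∀ θ, ρ θ 0 = ρ0 θ
  initial_momentum : ∀ θ, ξ θ 0 = ξ0 θ

/-- The measure `∫_M r_θ(x) δ(ξ - u_θ(x)) μ(dθ) dx` on phase space: the image of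
`r_θ(x) μ(dθ) dx` under `(θ, x) ↦ (x, u_θ(x))`. -/
def multifluidMeasure (μ : Measure M) (r : M → C(T3, ℝ)) (u : M → Fin 3 → C(T3, ℝ)) :
    Measure (T3 × R3) :=
  ((μ.prod torusMeasure).withDensity fun p => ENNReal.ofReal (r p.1 p.2)).map
    fun p => (p.2, WithLp.toLp 2 fun j => u p.1 j p.2)

end Multifluid

/-! ### Measure-valued weak solutions -/

/-- Membership in `𝒫₂`: probability measures on phase space with finite second moment. -/
def IsP2 (m : Measure (T3 × R3)) : Prop :=
  IsProbabilityMeasure m ∧ Integrable (fun z : T3 × R3 => ‖z.2‖ ^ 2) m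

/-- Test functions in `C_c^∞([0,T) × 𝕋³ × ℝ³)`, given as restrictions to `t ≥ 0` of smooth
functions. -/
def IsTestFunction (T : ℝ) (ψ : ℝ → T3 → R3 → ℝ) : Prop :=
  ContDiff ℝ ∞ (fun p : ℝ × (Fin 3 → ℝ) × R3 => ψ p.1 (torusProj p.2.1) p.2.2) ∧
    ∃ T' < T, ∃ R : ℝ, ∀ t, 0 ≤ t → ∀ x ξ, (T' ≤ t ∨ R ≤ ‖ξ‖) → ψ t x ξ = 0

/-- Weak solutions of the Vlasov–Poisson system on `[0,T)` with initial datum `f0`.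
The field `E = -∇φ` is in `L¹(0,T; C(𝕋³))`; the Poisson equation and the conservation law
`∂ₜ j + ∇·⟨f, ξ ⊗ ξ⟩ = -∇φ ρ` for the current hold at every time, tested against smooth functions
of `x`. -/
structure IsWeakSolution (T : ℝ) (f0 : Measure (T3 × R3))
    (f : ℝ → Measure (T3 × R3)) (φ : ℝ → C(T3, ℝ)) : Prop where
  initial_mem : IsP2 f0
  mem : ∀ t ∈ Ico 0 T, IsP2 (f t)
  initial : f 0 = f0
  continuous : ∀ g : BoundedContinuousFunction (T3 × R3) ℝ,
    ContinuousOn (fun t => ∫ z, g z ∂(f t)) (Ico 0 T)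
  contDiff_potential : ∀ t ∈ Ico 0 T, TorusContDiff 1 (φ t)
  vlasov : ∃ E : ℝ → C(T3, R3),
    (∀ t ∈ Ico 0 T, ∀ x j, E t x j = -torusPartial j (φ t) x) ∧
    IntegrableOn E (Ico 0 T) ∧
    ∀ ψ : ℝ → T3 → R3 → ℝ, IsTestFunction T ψ →
      ∫ t in Ico 0 T, ∫ z : T3 × R3,
          (deriv (fun s => ψ s z.1 z.2) t
            + ∑ i, z.2 i * torusPartial i (fun y => ψ t y z.2) z.1
            + fderiv ℝ (ψ t z.1) z.2 (E t z.1)) ∂(f t)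
        = -∫ z, ψ 0 z.1 z.2 ∂f0
  poisson : ∀ t ∈ Ico 0 T, ∀ χ : C(T3, ℝ), TorusContDiff ∞ χ →
    -∫ x, φ t x * torusLaplacian χ x ∂torusMeasure
      = (∫ z, χ z.1 ∂(f t)) - ∫ x, χ x ∂torusMeasure
  current : ∀ t ∈ Ico 0 T, ∀ j, ∀ χ : C(T3, ℝ), TorusContDiff ∞ χ →
    HasDerivWithinAt (fun s => ∫ z, z.2 j * χ z.1 ∂(f s))
      (∫ z, ((∑ i, z.2 i * z.2 j * torusPartial i χ z.1)
        - torusPartial j (φ t) z.1 * χ z.1) ∂(f t)) (Ico 0 T) t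

/-- Suitable weak solutions: the macroscopic density is bounded in `L^∞(0,T; L¹ ∩ L^∞(𝕋³))`, and
the fourth moment `∫ |ξ|⁴ f(t,x,dξ)` is bounded in `L^∞(0,T; L¹(𝕋³))`. -/
structure IsSuitableSolution (T : ℝ) (f0 : Measure (T3 × R3))
    (f : ℝ → Measure (T3 × R3)) (φ : ℝ → C(T3, ℝ)) : Prop where
  weak : IsWeakSolution T f0 f φ
  bounded_density : ∃ C : ℝ≥0, ∀ᵐ t ∂(volume.restrict (Ico 0 T)),
    ∃ r : T3 → ℝ, Measurable r ∧ (∀ x, 0 ≤ r x) ∧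
      (f t).map Prod.fst = torusMeasure.withDensity (fun x => ENNReal.ofReal (r x)) ∧
      eLpNorm r 1 torusMeasure ≤ C ∧ eLpNorm r ∞ torusMeasure ≤ C
  bounded_moment : ∃ C : ℝ≥0, ∀ᵐ t ∂(volume.restrict (Ico 0 T)),
    ∫⁻ z, ‖z.2‖ₑ ^ 4 ∂(f t) ≤ C

end VlasovPoisson

end

open UnitAddTorus

namespace VlasovPoisson

open scoped ComplexConjugate

noncomputable section

/-! ### Fourier coefficients of real functions on the torus -/

/-! The fluids interact only through their average density, and the force it creates is a bounded
operator on each `B_δ`. The system is therefore a Cauchy–Kovalevskaya problem, uniform in the label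
`θ`: a quadratic term that loses one derivative and a linear nonlocal term that loses none.

With `δ = e^r`, the solution is sought as a power series `∑ tⁿ uₙ`, where `(n + 1) uₙ₊₁` is the
coefficient of order `n` of the right-hand side. The weighted norm is submultiplicative
(`wN_mul_le`), a derivative costs `2π/(s - r)` when the radius drops from `s` to `r` (`wN_D_le`),
and averaging and the force are contractions (`wN_avg_le`, `wN_D_pot_le`). By induction, for all `r
< r₀` at once, `uₙ` has norm at most `B Rⁿ Catₙ (r₀ - r)⁻ⁿ` (`coeff_bounds`): the Catalan recursion
absorbs the Cauchy products, and with the intermediate radius `r + (r₀ - r)/(n + 2)` the loss `n +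
2` is paid by the factor `1/(n + 1)` of the time integration. Since `Catₙ ≤ 4ⁿ`, the growth is
geometric, and the series converges with values in `B_δ₁` on a short symmetric time interval
(`exists_localSolution`). The zero Fourier mode of each density is conserved, which keeps the total
mass equal to one in the Poisson equation.

Nonnegativity is a minimum principle for the transport equation (`nonneg_of_transport`). For the
kinetic equation, the chain rule gives, for every `C¹` function `Ψ`, that `∂ₜ(ρ Ψ(t,x,ξ))` equals
`ρ` times the transport operator applied to `Ψ`, minus the `x`-divergence of `ξ ρ Ψ`; the divergence
integrates to zero by translation invariance (`transport_identity`). Test functions `ψ` give the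
Vlasov equation, and `Ψ = vⱼ χ(x)` gives the current. All momenta lie in a fixed ball, which
controls every moment. -/

instance : IsProbabilityMeasure torusMeasure := by
  unfold torusMeasure; infer_instance

/-- The Fourier coefficients of a real continuous function. -/
def hat (g : C(T3, ℝ)) (k : Fin 3 → ℤ) : ℂ := mFourierCoeff (fun x : T3 => ((g x : ℝ) : ℂ)) k

/-- A real continuous function, seen as a complex one. -/
def toComplex (g : C(T3, ℝ)) : C(T3, ℂ) := ⟨fun x => (g x : ℂ), by fun_prop⟩

@[simp] lemma toComplex_apply (g : C(T3, ℝ)) (x : T3) : toComplex g x = (g x : ℂ) := rfl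

lemma mFourierCoeff_eq (f : T3 → ℂ) (k : Fin 3 → ℤ) :
    mFourierCoeff f k = ∫ x, mFourier (-k) x * f x ∂torusMeasure := rfl

lemma integrable_torus {E : Type*} [NormedAddCommGroup E] {f : T3 → E} (hf : Continuous f) :
    Integrable f torusMeasure := hf.integrable_of_hasCompactSupport (HasCompactSupport.of_compactSpace f)

lemma norm_mFourier_apply (k : Fin 3 → ℤ) (x : T3) : ‖mFourier k x‖ = 1 := by
  simp only [mFourier, fourier_apply, ContinuousMap.coe_mk, norm_prod, Circle.norm_coe,
    Finset.prod_const_one]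

/-- Fourier coefficients as continuous linear functionals. -/
def coeffCLM (k : Fin 3 → ℤ) : C(T3, ℂ) →L[ℂ] ℂ :=
  LinearMap.mkContinuous
    { toFun := fun f => mFourierCoeff f k
      map_add' := fun f g => by
        simp only [mFourierCoeff_eq, ContinuousMap.add_apply, mul_add]
        exact integral_add (integrable_torus (by fun_prop)) (integrable_torus (by fun_prop))
      map_smul' := fun c f => by
        simp only [mFourierCoeff_eq, ContinuousMap.smul_apply, smul_eq_mul, RingHom.id_apply]
        rw [← integral_const_mul]
        congr 1; ext x; ring } 1 fun f => by
      simp only [LinearMap.coe_mk, AddHom.coe_mk, mFourierCoeff_eq, one_mul]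
      refine (norm_integral_le_of_norm_le_const (C := ‖f‖) (ae_of_all _ fun x => ?_)).trans (by simp)
      rw [norm_mul, norm_mFourier_apply, one_mul]
      exact f.norm_coe_le_norm x

lemma coeffCLM_apply (k : Fin 3 → ℤ) (f : C(T3, ℂ)) : coeffCLM k f = mFourierCoeff f k := rfl

lemma norm_toComplex (g : C(T3, ℝ)) : ‖toComplex g‖ ≤ ‖g‖ :=
  (ContinuousMap.norm_le _ (norm_nonneg _)).2 fun x => by
    simpa using g.norm_coe_le_norm x

/-- `toComplex` as a continuous linear map. -/
def toComplexCLM : C(T3, ℝ) →L[ℝ] C(T3, ℂ) :=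
  LinearMap.mkContinuous
    { toFun := toComplex
      map_add' := fun f g => by ext x; simp
      map_smul' := fun c f => by ext x; simp } 1 fun g => by
      simpa using norm_toComplex g

/-- Real part as a continuous linear map on functions. -/
def reFun : C(T3, ℂ) →L[ℝ] C(T3, ℝ) :=
  LinearMap.mkContinuous
    { toFun := fun f => ⟨fun x => (f x).re, by fun_prop⟩
      map_add' := fun f g => by ext x; simp
      map_smul' := fun c f => by ext x; simp } 1 fun f => by
      rw [one_mul]
      exact (ContinuousMap.norm_le _ (norm_nonneg _)).2 fun x =>
        (Complex.abs_re_le_norm _).trans (f.norm_coe_le_norm x)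

@[simp] lemma reFun_apply (f : C(T3, ℂ)) (x : T3) : reFun f x = (f x).re := rfl

/-- Fourier coefficients of real functions as continuous linear functionals. -/
def hatCLM (k : Fin 3 → ℤ) : C(T3, ℝ) →L[ℝ] ℂ :=
  ((coeffCLM k).restrictScalars ℝ).comp toComplexCLM

@[simp] lemma hatCLM_apply (k : Fin 3 → ℤ) (g : C(T3, ℝ)) : hatCLM k g = hat g k := rfl

lemma hat_add (f g : C(T3, ℝ)) (k) : hat (f + g) k = hat f k + hat g k := (hatCLM k).map_add f g
lemma hat_sub (f g : C(T3, ℝ)) (k) : hat (f - g) k = hat f k - hat g k := (hatCLM k).map_sub f g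
lemma hat_neg_fun (f : C(T3, ℝ)) (k) : hat (-f) k = -hat f k := (hatCLM k).map_neg f
lemma hat_zero_fun (k) : hat 0 k = 0 := (hatCLM k).map_zero
lemma hat_smul (c : ℝ) (f : C(T3, ℝ)) (k) : hat (c • f) k = (c : ℂ) * hat f k := by
  rw [← hatCLM_apply, ContinuousLinearMap.map_smul, hatCLM_apply, Complex.real_smul]
lemma hat_sum {ι : Type*} (s : Finset ι) (f : ι → C(T3, ℝ)) (k) :
    hat (∑ i ∈ s, f i) k = ∑ i ∈ s, hat (f i) k := map_sum (hatCLM k) f s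

lemma hat_eq_integral (g : C(T3, ℝ)) (k : Fin 3 → ℤ) :
    hat g k = ∫ x, mFourier (-k) x * (g x : ℂ) ∂torusMeasure := rfl

lemma hat_neg (g : C(T3, ℝ)) (k : Fin 3 → ℤ) : hat g (-k) = conj (hat g k) := by
  rw [hat_eq_integral, hat_eq_integral, ← integral_conj]
  congr 1; ext x
  rw [map_mul, Complex.conj_ofReal, ← mFourier_neg]

lemma hat_zero (g : C(T3, ℝ)) : hat g 0 = ((∫ x, g x ∂torusMeasure : ℝ) : ℂ) := by
  rw [hat_eq_integral, ← integral_complex_ofReal]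
  simp [mFourier_zero]

lemma mFourierCoeff_mFourier (k l : Fin 3 → ℤ) :
    mFourierCoeff (mFourier l : C(T3, ℂ)) k = if l = k then 1 else 0 := by
  have h := orthonormal_iff_ite.1 (orthonormal_mFourier (d := Fin 3)) k l
  rw [ContinuousMap.inner_toLp] at h
  rw [mFourierCoeff_eq]
  simp only [← mFourier_neg] at h
  rw [show (if l = k then (1 : ℂ) else 0) = if k = l then 1 else 0 by simp [eq_comm], ← h]
  congr 1; ext x; ring

/-- The real part of the Fourier series with coefficients `c`. -/
def synth (c : (Fin 3 → ℤ) → ℂ) : C(T3, ℝ) := reFun (∑' k, c k • mFourier k)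

lemma summable_fourierSeries {c : (Fin 3 → ℤ) → ℂ} (hc : Summable c) :
    Summable fun k => c k • (mFourier k : C(T3, ℂ)) := by
  refine .of_norm ?_
  simpa only [norm_smul, mFourier_norm, mul_one] using hc.norm

lemma mFourierCoeff_series {c : (Fin 3 → ℤ) → ℂ} (hc : Summable c) (k : Fin 3 → ℤ) :
    mFourierCoeff (∑' l, c l • mFourier l : C(T3, ℂ)) k = c k := by
  rw [← coeffCLM_apply, (coeffCLM k).map_tsum (summable_fourierSeries hc)]
  simp [coeffCLM_apply, mFourierCoeff_mFourier]

/-- Conjugation permutes the terms by `k ↦ -k`. Hence the real part taken in `synth` loses nothing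
for Hermitian coefficients. -/
lemma conj_fourierSeries {c : (Fin 3 → ℤ) → ℂ} (hc : Summable c)
    (hr : ∀ k, c (-k) = conj (c k)) (x : T3) :
    conj ((∑' l, c l • mFourier l : C(T3, ℂ)) x) = (∑' l, c l • mFourier l : C(T3, ℂ)) x := by
  have hs := summable_fourierSeries hc
  have h1 : (∑' l, c l • mFourier l : C(T3, ℂ)) x = ∑' l, c l * mFourier l x := by
    have := (ContinuousMap.evalCLM ℂ x).map_tsum hs
    simpa using this
  rw [h1, Complex.conj_tsum, ← (Equiv.neg (Fin 3 → ℤ)).tsum_eq]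
  refine tsum_congr fun l => ?_
  rw [Equiv.neg_apply, hr, map_mul, Complex.conj_conj, ← mFourier_neg, neg_neg]

lemma toComplex_synth {c : (Fin 3 → ℤ) → ℂ} (hc : Summable c) (hr : ∀ k, c (-k) = conj (c k)) :
    toComplex (synth c) = ∑' l, c l • mFourier l := by
  ext x
  rw [toComplex_apply, synth, reFun_apply]
  exact Complex.conj_eq_iff_re.1 (conj_fourierSeries hc hr x)

lemma hat_synth {c : (Fin 3 → ℤ) → ℂ} (hc : Summable c) (hr : ∀ k, c (-k) = conj (c k))
    (k : Fin 3 → ℤ) : hat (synth c) k = c k := by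
  rw [← mFourierCoeff_series hc k, ← toComplex_synth hc hr]
  rfl

lemma hasSum_hat {g : C(T3, ℝ)} (hg : Summable (hat g)) :
    HasSum (fun k => hat g k • mFourier k) (toComplex g) :=
  hasSum_mFourier_series_of_summable (f := toComplex g) hg

lemma synth_hat {g : C(T3, ℝ)} (hg : Summable (hat g)) : synth (hat g) = g := by
  ext x
  rw [synth, (hasSum_hat hg).tsum_eq]
  simp

/-- Absolutely summable coefficients reconstruct the function. Operator identities below are checked
mode by mode through this. -/
lemma eq_of_hat_eq {f g : C(T3, ℝ)} (hg : Summable (hat g)) (h : ∀ k, hat f k = hat g k) :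
    f = g := by
  have h' : hat f = hat g := funext h
  have hf : Summable (hat f) := h' ▸ hg
  rw [← synth_hat hf, h', synth_hat hg]

/-! ### Weighted norms -/

lemma freqNorm_eq (k : Fin 3 → ℤ) : freqNorm k = ‖WithLp.toLp 2 (fun i => (k i : ℝ))‖ := by
  simp [freqNorm, EuclideanSpace.norm_eq]

lemma freqNorm_nonneg (k) : 0 ≤ freqNorm k := Real.sqrt_nonneg _

lemma freqNorm_add (k l : Fin 3 → ℤ) : freqNorm (k + l) ≤ freqNorm k + freqNorm l := by
  simp only [freqNorm_eq]
  refine le_trans (le_of_eq ?_) (norm_add_le _ _)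
  congr 1; ext i; simp

lemma freqNorm_neg (k : Fin 3 → ℤ) : freqNorm (-k) = freqNorm k := by simp [freqNorm]

lemma abs_le_freqNorm (k : Fin 3 → ℤ) (i : Fin 3) : |(k i : ℝ)| ≤ freqNorm k := by
  rw [freqNorm, ← Real.sqrt_sq_eq_abs]
  exact Real.sqrt_le_sqrt (Finset.single_le_sum (f := fun i => (k i : ℝ) ^ 2)
    (fun _ _ => sq_nonneg _) (Finset.mem_univ i))

/-- The weight `e^{r|k|}`. -/
def wt (r : ℝ) (k : Fin 3 → ℤ) : ℝ≥0∞ := ENNReal.ofReal (Real.exp (r * freqNorm k))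

/-- The norm of `B_δ`, `δ = e^r`, with values in `[0,∞]`. -/
def wN (r : ℝ) (g : C(T3, ℝ)) : ℝ≥0∞ := ∑' k, ‖hat g k‖ₑ * wt r k

lemma one_le_wt {r : ℝ} (hr : 0 ≤ r) (k) : 1 ≤ wt r k := by
  rw [wt, ENNReal.one_le_ofReal]
  exact Real.one_le_exp (mul_nonneg hr (freqNorm_nonneg k))

lemma wt_mono {r s : ℝ} (h : r ≤ s) (k) : wt r k ≤ wt s k :=
  ENNReal.ofReal_le_ofReal (Real.exp_le_exp.2 (mul_le_mul_of_nonneg_right h (freqNorm_nonneg k)))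

lemma wt_add {r : ℝ} (hr : 0 ≤ r) (k l) : wt r (k + l) ≤ wt r k * wt r l := by
  rw [wt, wt, wt, ← ENNReal.ofReal_mul (Real.exp_nonneg _), ← Real.exp_add, ← mul_add]
  exact ENNReal.ofReal_le_ofReal (Real.exp_le_exp.2 (mul_le_mul_of_nonneg_left (freqNorm_add k l) hr))

lemma wN_mono {r s : ℝ} (h : r ≤ s) (g) : wN r g ≤ wN s g :=
  ENNReal.tsum_le_tsum fun k => by gcongr; exact wt_mono h k

lemma tsum_enorm_le_wN {r : ℝ} (hr : 0 ≤ r) (g) : ∑' k, ‖hat g k‖ₑ ≤ wN r g :=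
  ENNReal.tsum_le_tsum fun k => by simpa using mul_le_mul_right (one_le_wt hr k) ‖hat g k‖ₑ

lemma summable_of_tsum_enorm {ι E : Type*} [NormedAddCommGroup E] [CompleteSpace E] {c : ι → E}
    (h : ∑' k, ‖c k‖ₑ ≠ ⊤) : Summable c := by
  refine .of_norm ?_
  have := ENNReal.summable_toReal h
  simpa using this

lemma summable_hat {r : ℝ} (hr : 0 ≤ r) {g} (hg : wN r g ≠ ⊤) : Summable (hat g) :=
  summable_of_tsum_enorm (ne_top_of_le_ne_top hg (tsum_enorm_le_wN hr g))

lemma enorm_synth_le (c : (Fin 3 → ℤ) → ℂ) : ‖synth c‖ₑ ≤ ∑' k, ‖c k‖ₑ := by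
  by_cases h : ∑' k, ‖c k‖ₑ = ⊤
  · simp [h]
  have hs := summable_of_tsum_enorm h
  have hn : Summable fun k => ‖c k‖ := hs.norm
  have h1 : ‖synth c‖ ≤ ∑' k, ‖c k‖ := by
    have h2 : ‖(∑' k, c k • mFourier k : C(T3, ℂ))‖ ≤ ∑' k, ‖c k‖ := by
      have h3 : ∀ k, ‖c k • (mFourier k : C(T3, ℂ))‖ = ‖c k‖ := fun k => by
        rw [norm_smul, mFourier_norm, mul_one]
      simpa only [h3] using norm_tsum_le_tsum_norm (f := fun k => c k • (mFourier k : C(T3, ℂ)))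
        (by simpa only [h3] using hn)
    refine le_trans ((ContinuousMap.norm_le _ (norm_nonneg _)).2 fun x => ?_) h2
    exact (Complex.abs_re_le_norm _).trans (ContinuousMap.norm_coe_le_norm _ x)
  rw [← ofReal_norm]
  refine (ENNReal.ofReal_le_ofReal h1).trans (le_of_eq ?_)
  rw [ENNReal.ofReal_tsum_of_nonneg (fun _ => norm_nonneg _) hn]
  simp [ofReal_norm]

lemma enorm_le_wN {r : ℝ} (hr : 0 ≤ r) (g) : ‖g‖ₑ ≤ wN r g := by
  by_cases h : wN r g = ⊤
  · simp [h]
  rw [← synth_hat (summable_hat hr h)]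
  refine (enorm_synth_le _).trans ?_
  rw [synth_hat (summable_hat hr h)]
  exact tsum_enorm_le_wN hr g

lemma enorm_hat_mul_le {r : ℝ} (hr : 0 ≤ r) {f g : C(T3, ℝ)} (hg : wN r g ≠ ⊤) (k) :
    ‖hat (f * g) k‖ₑ ≤ ∑' l, ‖hat f (k - l)‖ₑ * ‖hat g l‖ₑ := by
  -- Only `g` is expanded in its Fourier series; multiplication by a character shifts the
  -- coefficients of `f`, so no summability of `hat f` is needed.
  have h1 : HasSum (fun l => hat g l • (toComplex f * mFourier l)) (toComplex f * toComplex g) := by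
    have := (hasSum_hat (summable_hat hr hg)).mul_left (toComplex f)
    simpa only [mul_smul_comm] using this
  have h2 := (coeffCLM k).hasSum h1
  have h3 : ∀ l, coeffCLM k (hat g l • (toComplex f * mFourier l)) = hat f (k - l) * hat g l := by
    intro l
    rw [map_smul, smul_eq_mul, mul_comm, coeffCLM_apply, mFourierCoeff_eq, hat_eq_integral]
    congr 2; ext x
    rw [neg_sub, sub_eq_add_neg, add_comm, mFourier_add]
    simp; ring
  have h4 : coeffCLM k (toComplex f * toComplex g) = hat (f * g) k := by
    rw [coeffCLM_apply, hat]; congr 1; ext x; simp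
  simp only [h3, h4] at h2
  rw [← h2.tsum_eq]
  refine (enorm_tsum_le_tsum_enorm).trans (le_of_eq ?_)
  simp [enorm_mul]

/-- The coefficients of a product are a convolution, and the weight is submultiplicative because
`|k| ≤ |k - l| + |l|`. -/
lemma wN_mul_le {r : ℝ} (hr : 0 ≤ r) (f g : C(T3, ℝ)) : wN r (f * g) ≤ wN r f * wN r g := by
  by_cases hg : wN r g = ⊤
  -- As `0 * ⊤ = 0`, the case of infinite `wN r g` needs `f = 0` when `wN r f` vanishes.
  · by_cases hf : wN r f = 0
    · have : f = 0 := by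
        have := enorm_le_wN hr f
        rw [hf] at this
        rw [← ofReal_norm, nonpos_iff_eq_zero, ENNReal.ofReal_eq_zero] at this
        exact norm_le_zero_iff.1 this
      simp [this, wN, hat_zero_fun]
    · rw [hg, ENNReal.mul_top hf]; exact le_top
  calc wN r (f * g) ≤ ∑' k, ∑' l, ‖hat f (k - l)‖ₑ * wt r (k - l) * (‖hat g l‖ₑ * wt r l) := by
        refine ENNReal.tsum_le_tsum fun k => ?_
        refine (mul_le_mul_left (enorm_hat_mul_le hr hg k) _).trans ?_
        rw [← ENNReal.tsum_mul_right]
        refine ENNReal.tsum_le_tsum fun l => ?_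
        have : wt r k ≤ wt r (k - l) * wt r l := by simpa using wt_add hr (k - l) l
        calc _ ≤ ‖hat f (k - l)‖ₑ * ‖hat g l‖ₑ * (wt r (k - l) * wt r l) := by gcongr
          _ = _ := by ring
    _ = ∑' l, (∑' k, ‖hat f (k - l)‖ₑ * wt r (k - l)) * (‖hat g l‖ₑ * wt r l) := by
        rw [ENNReal.tsum_comm]
        simp only [ENNReal.tsum_mul_right]
    _ = ∑' l, wN r f * (‖hat g l‖ₑ * wt r l) := by
        congr 1; ext l; congr 1
        exact (Equiv.subRight l).tsum_eq fun k => ‖hat f k‖ₑ * wt r k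
    _ = wN r f * wN r g := ENNReal.tsum_mul_left

lemma wN_add_le (r : ℝ) (f g : C(T3, ℝ)) : wN r (f + g) ≤ wN r f + wN r g := by
  rw [wN, wN, wN, ← ENNReal.tsum_add]
  refine ENNReal.tsum_le_tsum fun k => ?_
  rw [hat_add, ← add_mul]
  gcongr
  exact enorm_add_le _ _

lemma wN_smul (r c : ℝ) (f : C(T3, ℝ)) : wN r (c • f) = ENNReal.ofReal |c| * wN r f := by
  rw [wN, wN, ← ENNReal.tsum_mul_left]
  congr 1; ext k
  rw [hat_smul, enorm_mul, ← mul_assoc]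
  congr 2
  rw [← ofReal_norm]; simp

lemma wN_neg (r : ℝ) (f : C(T3, ℝ)) : wN r (-f) = wN r f := by simp [wN, hat_neg_fun]

lemma wN_zero (r : ℝ) : wN r 0 = 0 := by simp [wN, hat_zero_fun]

lemma wN_sum_le {ι : Type*} (r : ℝ) (s : Finset ι) (f : ι → C(T3, ℝ)) :
    wN r (∑ i ∈ s, f i) ≤ ∑ i ∈ s, wN r (f i) :=
  Finset.le_sum_of_subadditive (wN r) (wN_zero r).le (wN_add_le r) s f

/-- Uniform convergence suffices: each Fourier coefficient is continuous for the sup norm, and the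
two sums commute in `[0,∞]`. -/
lemma wN_hasSum_le (r : ℝ) {ι : Type*} {f : ι → C(T3, ℝ)} {g : C(T3, ℝ)} (h : HasSum f g) :
    wN r g ≤ ∑' n, wN r (f n) := by
  simp only [wN]
  rw [ENNReal.tsum_comm]
  refine ENNReal.tsum_le_tsum fun k => ?_
  rw [ENNReal.tsum_mul_right]
  gcongr
  have := (hatCLM k).hasSum h
  simp only [hatCLM_apply] at this
  rw [← this.tsum_eq]
  exact enorm_tsum_le_tsum_enorm

/-! ### Fourier multipliers -/

/-- The Fourier multiplier with symbol `m`. -/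
def mult (m : (Fin 3 → ℤ) → ℂ) (g : C(T3, ℝ)) : C(T3, ℝ) := synth fun k => m k * hat g k

/-- Symbols of operators that preserve real functions. -/
def IsRealSymbol (m : (Fin 3 → ℤ) → ℂ) : Prop := ∀ k, m (-k) = conj (m k)

lemma hat_mult {m} (hm : IsRealSymbol m) {g} (h : Summable fun k => m k * hat g k) (k) :
    hat (mult m g) k = m k * hat g k :=
  hat_synth h (fun k => by rw [hm, hat_neg, map_mul]) k

/-- `m` is dominated by `C` with a loss from the weight `s` to the weight `r`. -/
def SymbolBound (m : (Fin 3 → ℤ) → ℂ) (r s C : ℝ) : Prop :=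
  ∀ k, ‖m k‖ * Real.exp (r * freqNorm k) ≤ C * Real.exp (s * freqNorm k)

lemma SymbolBound.enorm_le {m r s C} (h : SymbolBound m r s C) (g : C(T3, ℝ)) (k) :
    ‖m k * hat g k‖ₑ * wt r k ≤ ENNReal.ofReal C * (‖hat g k‖ₑ * wt s k) := by
  have hC : 0 ≤ C := by
    have := (mul_nonneg (norm_nonneg _) (Real.exp_nonneg _)).trans (h k)
    exact nonneg_of_mul_nonneg_left this (Real.exp_pos _)
  have : ‖m k‖ₑ * wt r k ≤ ENNReal.ofReal C * wt s k := by
    rw [wt, wt, ← ofReal_norm, ← ENNReal.ofReal_mul (norm_nonneg _), ← ENNReal.ofReal_mul hC]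
    exact ENNReal.ofReal_le_ofReal (h k)
  calc _ = ‖m k‖ₑ * wt r k * ‖hat g k‖ₑ := by rw [enorm_mul]; ring
    _ ≤ ENNReal.ofReal C * wt s k * ‖hat g k‖ₑ := by gcongr
    _ = _ := by ring

lemma SymbolBound.summable {m r s C} (h : SymbolBound m r s C) (hr : 0 ≤ r) {g} (hg : wN s g ≠ ⊤) :
    Summable fun k => m k * hat g k := by
  refine summable_of_tsum_enorm (ne_top_of_le_ne_top (b := ENNReal.ofReal C * wN s g)
    (ENNReal.mul_ne_top ENNReal.ofReal_ne_top hg) ?_)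
  rw [wN, ← ENNReal.tsum_mul_left]
  refine ENNReal.tsum_le_tsum fun k => le_trans ?_ (h.enorm_le g k)
  simpa using mul_le_mul_right (one_le_wt hr k) ‖m k * hat g k‖ₑ

lemma SymbolBound.wN_le {m r s C} (h : SymbolBound m r s C) (hm : IsRealSymbol m) (hr : 0 ≤ r)
    {g} (hg : wN s g ≠ ⊤) : wN r (mult m g) ≤ ENNReal.ofReal C * wN s g := by
  rw [wN, wN, ← ENNReal.tsum_mul_left]
  refine ENNReal.tsum_le_tsum fun k => ?_
  rw [hat_mult hm (h.summable hr hg)]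
  exact h.enorm_le g k

/-- A multiplier such as `∂ᵢ` is not continuous for the sup norm. The finite sum of the stronger
norms makes the image series converge, and its coefficients then identify the limit. -/
lemma hasSum_mult {m r s C} (h : SymbolBound m r s C) (hm : IsRealSymbol m) (hr : 0 ≤ r)
    {ι : Type*} {f : ι → C(T3, ℝ)} {g : C(T3, ℝ)} (hf : HasSum f g) (hs : ∑' n, wN s (f n) ≠ ⊤) :
    HasSum (fun n => mult m (f n)) (mult m g) := by
  have hfn : ∀ n, wN s (f n) ≠ ⊤ := ENNReal.ne_top_of_tsum_ne_top hs
  have hg : wN s g ≠ ⊤ := ne_top_of_le_ne_top hs (wN_hasSum_le s hf)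
  have hsum : Summable fun n => mult m (f n) := by
    refine summable_of_tsum_enorm (ne_top_of_le_ne_top
      (ENNReal.mul_ne_top ENNReal.ofReal_ne_top hs) (b := ENNReal.ofReal C * ∑' n, wN s (f n)) ?_)
    rw [← ENNReal.tsum_mul_left]
    exact ENNReal.tsum_le_tsum fun n => (enorm_le_wN hr _).trans (h.wN_le hm hr (hfn n))
  convert! hsum.hasSum using 1
  symm
  have hm' := hat_mult hm (h.summable hr hg)
  refine eq_of_hat_eq ?_ fun k => ?_
  · rw [show hat (mult m g) = fun k => m k * hat g k from funext hm']
    exact h.summable hr hg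
  · rw [hm', ← hatCLM_apply, (hatCLM k).map_tsum hsum]
    have := (hatCLM k).hasSum hf
    simp only [hatCLM_apply] at this
    rw [← this.tsum_eq, ← tsum_mul_left]
    exact tsum_congr fun n => hat_mult hm (h.summable hr (hfn n)) k

/-- The symbol of `∂ᵢ`. -/
def dSymbol (i : Fin 3) (k : Fin 3 → ℤ) : ℂ := 2 * Real.pi * Complex.I * (k i : ℂ)

/-- The symbol of `(-Δ)⁻¹` on functions of mean zero. -/
def potSymbol (k : Fin 3 → ℤ) : ℂ := (((4 * Real.pi ^ 2 * freqNorm k ^ 2)⁻¹ : ℝ) : ℂ)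

/-- Partial derivatives on `B_δ`. -/
def D (i : Fin 3) (g : C(T3, ℝ)) : C(T3, ℝ) := mult (dSymbol i) g

/-- The solution of mean zero of `-Δ φ = g - ∫ g`. -/
def pot (g : C(T3, ℝ)) : C(T3, ℝ) := mult potSymbol g

lemma isRealSymbol_d (i) : IsRealSymbol (dSymbol i) := fun k => by
  simp [dSymbol, Complex.conj_ofReal, map_ofNat]

lemma isRealSymbol_pot : IsRealSymbol potSymbol := fun k => by
  rw [potSymbol, potSymbol, freqNorm_neg, Complex.conj_ofReal]

lemma norm_dSymbol_le (i k) : ‖dSymbol i k‖ ≤ 2 * Real.pi * freqNorm k := by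
  simp only [dSymbol, norm_mul, Complex.norm_I, Complex.norm_real, Complex.norm_intCast, mul_one,
    Complex.norm_ofNat, Real.norm_eq_abs, abs_of_pos Real.pi_pos]
  gcongr
  exact abs_le_freqNorm k i

/-- Cauchy estimate: `x ≤ eˣ` with `x = (s - r)|k|` trades the factor `|k|` for width of
analyticity. -/
lemma symbolBound_d (i : Fin 3) {r s : ℝ} (h : r < s) :
    SymbolBound (dSymbol i) r s (2 * Real.pi / (s - r)) := fun k => by
  have hp : 0 < s - r := sub_pos.2 h
  have h1 : (s - r) * freqNorm k ≤ Real.exp ((s - r) * freqNorm k) :=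
    (le_add_of_nonneg_right zero_le_one).trans (Real.add_one_le_exp _)
  have h2 : Real.exp (s * freqNorm k) = Real.exp ((s - r) * freqNorm k) * Real.exp (r * freqNorm k) := by
    rw [← Real.exp_add]; ring_nf
  rw [h2, ← mul_assoc]
  gcongr
  refine (norm_dSymbol_le i k).trans ?_
  rw [div_mul_eq_mul_div, le_div_iff₀ hp]
  have := mul_le_mul_of_nonneg_left h1 Real.two_pi_pos.le
  linarith

lemma one_le_freqNorm {k : Fin 3 → ℤ} (hk : k ≠ 0) : 1 ≤ freqNorm k := by
  obtain ⟨i, hi⟩ := Function.ne_iff.1 hk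
  refine le_trans ?_ (abs_le_freqNorm k i)
  exact_mod_cast Int.one_le_abs hi

lemma freqNorm_zero : freqNorm 0 = 0 := by simp [freqNorm]

lemma symbolBound_pot (r : ℝ) : SymbolBound potSymbol r r 1 := fun k => by
  gcongr
  rw [potSymbol, Complex.norm_real, Real.norm_eq_abs, abs_of_nonneg (by positivity)]
  -- At the zero mode the symbol is the inverse of zero, which is zero: `pot` discards the mean.
  -- Other frequencies have length at least one.
  by_cases hk : k = 0
  · simp [hk, freqNorm_zero]
  · refine inv_le_one_of_one_le₀ ?_
    nlinarith [one_le_freqNorm hk, Real.pi_gt_three, one_le_pow₀ (one_le_freqNorm hk) (n := 2),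
      one_le_pow₀ (Real.pi_gt_three.le.trans' (by norm_num : (1 : ℝ) ≤ 3)) (n := 2)]

/-- The force gains one derivative on the density, so it is bounded at a fixed radius. Taking `pot`
and then `D` through their separate bounds would lose width. -/
lemma symbolBound_d_pot (i : Fin 3) (r : ℝ) :
    SymbolBound (fun k => dSymbol i k * potSymbol k) r r 1 := fun k => by
  gcongr
  rw [norm_mul]
  by_cases hk : k = 0
  · simp [hk, dSymbol]
  have h1 := one_le_freqNorm hk
  rw [potSymbol, Complex.norm_real, Real.norm_eq_abs, abs_of_nonneg (by positivity)]
  refine (mul_le_mul_of_nonneg_right (norm_dSymbol_le i k) (by positivity)).trans ?_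
  rw [← div_eq_mul_inv]
  refine div_le_one_of_le₀ ?_ (by positivity)
  have hp := Real.pi_gt_three
  have : 0 ≤ Real.pi * freqNorm k := by positivity
  nlinarith [mul_le_mul hp.le h1 (by norm_num) Real.pi_pos.le]

lemma isRealSymbol_d_pot (i) : IsRealSymbol (fun k => dSymbol i k * potSymbol k) := fun k => by
  simp only [isRealSymbol_d i k, isRealSymbol_pot k, map_mul]

lemma wN_pot_le {r : ℝ} (hr : 0 ≤ r) {g} (hg : wN r g ≠ ⊤) : wN r (pot g) ≤ wN r g := by
  simpa [pot] using (symbolBound_pot r).wN_le isRealSymbol_pot hr hg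

lemma hat_pot {r : ℝ} (hr : 0 ≤ r) {g} (hg : wN r g ≠ ⊤) (k) :
    hat (pot g) k = potSymbol k * hat g k :=
  hat_mult isRealSymbol_pot ((symbolBound_pot r).summable hr hg) k

lemma hat_D {r : ℝ} (hr : 0 < r) (i) {g} (hg : wN r g ≠ ⊤) (k) :
    hat (D i g) k = dSymbol i k * hat g k :=
  hat_mult (isRealSymbol_d i) ((symbolBound_d i hr).summable le_rfl hg) k

lemma wN_D_le {r s : ℝ} (hr : 0 ≤ r) (hs : r < s) (i) {g} (hg : wN s g ≠ ⊤) :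
    wN r (D i g) ≤ ENNReal.ofReal (2 * Real.pi / (s - r)) * wN s g :=
  (symbolBound_d i hs).wN_le (isRealSymbol_d i) hr hg

lemma D_pot_eq {r : ℝ} (hr : 0 < r) (i) {g} (hg : wN r g ≠ ⊤) :
    D i (pot g) = mult (fun k => dSymbol i k * potSymbol k) g := by
  unfold D mult
  congr 1; ext k
  rw [hat_pot hr.le hg, mul_assoc]

lemma wN_D_pot_le {r : ℝ} (hr : 0 < r) (i) {g} (hg : wN r g ≠ ⊤) :
    wN r (D i (pot g)) ≤ wN r g := by
  rw [D_pot_eq hr i hg]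
  simpa using (symbolBound_d_pot i r).wN_le (isRealSymbol_d_pot i) hr.le hg

/-! ### `B_δ` in terms of the weighted norms -/

lemma bTerm_eq {δ : ℝ} (hδ : 0 < δ) (g : C(T3, ℝ)) (k) :
    bTerm δ g k = (‖hat g k‖ₑ * wt (Real.log δ) k).toReal := by
  rw [ENNReal.toReal_mul, toReal_enorm, wt, ENNReal.toReal_ofReal (Real.exp_nonneg _), bTerm, hat,
    Real.rpow_def_of_pos hδ]

lemma bTerm_nonneg {δ : ℝ} (hδ : 0 < δ) (g : C(T3, ℝ)) (k) : 0 ≤ bTerm δ g k := by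
  rw [bTerm_eq hδ]; exact ENNReal.toReal_nonneg

lemma ofReal_bTerm {δ : ℝ} (hδ : 0 < δ) (g : C(T3, ℝ)) (k) :
    ENNReal.ofReal (bTerm δ g k) = ‖hat g k‖ₑ * wt (Real.log δ) k := by
  rw [bTerm_eq hδ, ENNReal.ofReal_toReal]
  exact ENNReal.mul_ne_top enorm_ne_top ENNReal.ofReal_ne_top

lemma memB_of_wN {δ : ℝ} (hδ : 0 < δ) {g : C(T3, ℝ)} (h : wN (Real.log δ) g ≠ ⊤) : MemB δ g := by
  have := ENNReal.summable_toReal h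
  exact this.congr fun k => (bTerm_eq hδ g k).symm

lemma bNorm_eq {δ : ℝ} (hδ : 0 < δ) (g : C(T3, ℝ)) : bNorm δ g = (wN (Real.log δ) g).toReal := by
  have h : ∀ k, ‖hat g k‖ₑ * wt (Real.log δ) k ≠ ⊤ := fun k =>
    ENNReal.mul_ne_top enorm_ne_top ENNReal.ofReal_ne_top
  rw [wN, ENNReal.tsum_toReal_eq h]
  exact tsum_congr fun k => bTerm_eq hδ g k

lemma wN_eq_ofReal {δ : ℝ} (hδ : 0 < δ) {g : C(T3, ℝ)} (h : MemB δ g) :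
    wN (Real.log δ) g = ENNReal.ofReal (bNorm δ g) := by
  rw [bNorm, ENNReal.ofReal_tsum_of_nonneg (bTerm_nonneg hδ g) h]
  exact tsum_congr fun k => (ofReal_bTerm hδ g k).symm

/-! ### The covering map of the torus -/

lemma isOpenQuotientMap_torusProj : IsOpenQuotientMap torusProj :=
  IsOpenQuotientMap.piMap fun _ => QuotientAddGroup.isOpenQuotientMap_mk

lemma continuous_torusProj : Continuous torusProj := isOpenQuotientMap_torusProj.continuous

lemma torusProj_add (v w : Fin 3 → ℝ) : torusProj (v + w) = torusProj v + torusProj w := by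
  ext i; simp [torusProj]

lemma torusProj_single (i : Fin 3) (s : ℝ) :
    torusProj (Pi.single i s) = Pi.single i (s : UnitAddCircle) := by
  ext j
  by_cases h : j = i
  · subst h; simp [torusProj]
  · simp [torusProj, h]

lemma exists_torusProj_eq (x : T3) : ∃ v ∈ Icc (0 : Fin 3 → ℝ) 1, torusProj v = x := by
  have h : ∀ i, ∃ a ∈ Ico (0 : ℝ) (0 + 1), (a : UnitAddCircle) = x i := fun i => by
    have := (AddCircle.equivIco 1 0 (x i)).2
    exact ⟨_, this, (AddCircle.equivIco 1 0).symm_apply_apply (x i)⟩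
  choose v hv hvx using h
  exact ⟨v, ⟨fun i => (hv i).1, fun i => by simpa using (hv i).2.le⟩, funext hvx⟩

/-- The derivative of a function on the torus along a coordinate line. -/
lemma hasDerivAt_coord {E : Type*} [NormedAddCommGroup E] [NormedSpace ℝ E] {g : T3 → E}
    {v : Fin 3 → ℝ} {L : (Fin 3 → ℝ) →L[ℝ] E}
    (h : HasFDerivAt (fun w => g (torusProj w)) L v) (i : Fin 3) :
    HasDerivAt (fun s : ℝ => g (torusProj v + Pi.single i (s : UnitAddCircle)))
      (L (Pi.single i 1)) 0 := by
  have h1 : HasDerivAt (fun s : ℝ => v + s • (Pi.single i (1 : ℝ) : Fin 3 → ℝ)) (Pi.single i 1) 0 := by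
    simpa using ((hasDerivAt_id (0 : ℝ)).smul_const (Pi.single i (1 : ℝ) : Fin 3 → ℝ)).const_add v
  have h2 : HasFDerivAt (fun w => g (torusProj w)) L (v + (0 : ℝ) • (Pi.single i (1 : ℝ) : Fin 3 → ℝ)) := by
    simpa using h
  have h3 := h2.comp_hasDerivAt (0 : ℝ) h1
  refine h3.congr_of_eventuallyEq (Eventually.of_forall fun s => ?_)
  simp only [Function.comp, torusProj_add, ← torusProj_single]
  congr 3
  ext j
  by_cases h : j = i
  · subst h; simp
  · simp [h]

lemma torusPartial_eq {g : T3 → ℝ} {v : Fin 3 → ℝ} {L : (Fin 3 → ℝ) →L[ℝ] ℝ}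
    (h : HasFDerivAt (fun w => g (torusProj w)) L v) (i : Fin 3) :
    torusPartial i g (torusProj v) = L (Pi.single i 1) := (hasDerivAt_coord h i).deriv

/-! ### Differentiability of functions in `B_δ` -/

lemma mFourier_torusProj (k : Fin 3 → ℤ) (v : Fin 3 → ℝ) :
    mFourier k (torusProj v) = Complex.exp (∑ i, dSymbol i k * (v i : ℂ)) := by
  rw [Complex.exp_sum]
  simp only [mFourier, ContinuousMap.coe_mk, torusProj]
  refine Finset.prod_congr rfl fun i _ => ?_
  rw [fourier_coe_apply, dSymbol]
  congr 1
  simp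

lemma hasFDerivAt_mFourier (k : Fin 3 → ℤ) (v : Fin 3 → ℝ) :
    HasFDerivAt (fun v : Fin 3 → ℝ => mFourier k (torusProj v))
      (∑ i, (dSymbol i k * mFourier k (torusProj v)) •
        (Complex.ofRealCLM.comp (ContinuousLinearMap.proj (R := ℝ) (φ := fun _ : Fin 3 => ℝ) i))) v := by
  simp only [mFourier_torusProj]
  have h1 : ∀ i : Fin 3, HasFDerivAt (fun v : Fin 3 → ℝ => (v i : ℂ))
      (Complex.ofRealCLM.comp (ContinuousLinearMap.proj (R := ℝ) (φ := fun _ : Fin 3 => ℝ) i)) v :=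
    fun i => (Complex.ofRealCLM.comp
      (ContinuousLinearMap.proj (R := ℝ) (φ := fun _ : Fin 3 => ℝ) i)).hasFDerivAt
  have h2 := (HasFDerivAt.fun_sum (u := Finset.univ)
    fun i _ => (h1 i).const_mul (dSymbol i k)).cexp
  convert! h2 using 1
  rw [Finset.smul_sum]
  refine Finset.sum_congr rfl fun i _ => ?_
  rw [smul_smul, mul_comm]

lemma hasSum_toComplex_apply {g : C(T3, ℝ)} (hg : Summable (hat g)) (x : T3) :
    HasSum (fun k => hat g k * mFourier k x) (g x : ℂ) := by
  have := (ContinuousMap.evalCLM ℂ x).hasSum (hasSum_hat hg)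
  simpa using! this

/-- Termwise differentiation of the complex Fourier series: the differentiated terms are dominated,
uniformly in the point, by the summable coefficients of the `D i g`. -/
lemma hasFDerivAt_lift {r : ℝ} (hr : 0 < r) {g : C(T3, ℝ)} (hg : wN r g ≠ ⊤) (v : Fin 3 → ℝ) :
    HasFDerivAt (fun w => g (torusProj w))
      (∑ i, D i g (torusProj v) • ContinuousLinearMap.proj (R := ℝ) (φ := fun _ : Fin 3 => ℝ) i) v := by
  set P : Fin 3 → (Fin 3 → ℝ) →L[ℝ] ℂ := fun i =>
    Complex.ofRealCLM.comp (ContinuousLinearMap.proj (R := ℝ) (φ := fun _ : Fin 3 => ℝ) i)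
  have hP : ∀ i, ‖P i‖ ≤ 1 := fun i => by
    refine ContinuousLinearMap.opNorm_le_bound _ zero_le_one fun w => ?_
    simpa [P] using norm_le_pi_norm w i
  have hDs : ∀ i, Summable (hat (D i g)) := fun i =>
    (((symbolBound_d i hr).summable le_rfl hg).congr fun k => (hat_D hr i hg k).symm)
  have h1 : ∀ k w, HasFDerivAt (fun w => hat g k * mFourier k (torusProj w))
      (∑ i, (hat (D i g) k * mFourier k (torusProj w)) • P i) w := fun k w => by
    have := (hasFDerivAt_mFourier k w).const_mul (hat g k)
    convert! this using 1
    rw [Finset.smul_sum]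
    refine Finset.sum_congr rfl fun i _ => ?_
    rw [smul_smul, hat_D hr i hg]
    congr 1; ring
  have h2 : ∀ k w, ‖∑ i, (hat (D i g) k * mFourier k (torusProj w)) • P i‖ ≤ ∑ i, ‖hat (D i g) k‖ :=
    fun k w => by
    refine norm_sum_le_of_le _ fun i _ => ?_
    rw [norm_smul, norm_mul, norm_mFourier_apply, mul_one]
    exact mul_le_of_le_one_right (norm_nonneg _) (hP i)
  have h3 := hasFDerivAt_tsum (x₀ := v) (summable_sum fun i _ => (hDs i).norm) h1 h2
    (hasSum_toComplex_apply (summable_hat hr.le hg) (torusProj v)).summable v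
  have h4 : (∑' k, ∑ i, (hat (D i g) k * mFourier k (torusProj v)) • P i) =
      ∑ i, (D i g (torusProj v) : ℂ) • P i := by
    refine (hasSum_sum fun i _ => ?_).tsum_eq
    exact (hasSum_toComplex_apply (hDs i) (torusProj v)).smul_const (P i)
  have h5 : (fun w => ∑' k, hat g k * mFourier k (torusProj w)) = fun w => (g (torusProj w) : ℂ) :=
    funext fun w => (hasSum_toComplex_apply (summable_hat hr.le hg) (torusProj w)).tsum_eq
  rw [h4, h5] at h3
  have h6 := Complex.reCLM.hasFDerivAt.comp v h3
  convert! h6 using 1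
  ext w
  simp [P]

lemma hasDerivAt_coord_D {r : ℝ} (hr : 0 < r) {g : C(T3, ℝ)} (hg : wN r g ≠ ⊤) (i : Fin 3) (x : T3) :
    HasDerivAt (fun s : ℝ => g (x + Pi.single i (s : UnitAddCircle))) (D i g x) 0 := by
  obtain ⟨v, -, rfl⟩ := exists_torusProj_eq x
  convert! hasDerivAt_coord (g := g) (hasFDerivAt_lift hr hg v) i using 1
  simp [Pi.single_apply]

lemma torusPartial_eq_D {r : ℝ} (hr : 0 < r) {g : C(T3, ℝ)} (hg : wN r g ≠ ⊤) (i : Fin 3) :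
    torusPartial i g = D i g :=
  funext fun x => (hasDerivAt_coord_D hr hg i x).deriv

lemma wN_D_ne_top {r s : ℝ} (hr : 0 ≤ r) (hs : r < s) (i) {g} (hg : wN s g ≠ ⊤) :
    wN r (D i g) ≠ ⊤ :=
  ne_top_of_le_ne_top (ENNReal.mul_ne_top ENNReal.ofReal_ne_top hg) (wN_D_le hr hs i hg)

/-- Each differentiation spends half of the remaining radius, so any finite order is reached; hence
`r` varies in the induction. -/
lemma torusContDiff {n : ℕ} : ∀ {r : ℝ}, 0 < r → ∀ {g : C(T3, ℝ)}, wN r g ≠ ⊤ → TorusContDiff n g := by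
  induction n with
  | zero =>
    intro r _ g _
    exact contDiff_zero.2 (g.continuous.comp continuous_torusProj)
  | succ n ih =>
    intro r hr g hg
    have h := hasFDerivAt_lift hr hg
    rw [TorusContDiff, Nat.cast_succ, contDiff_succ_iff_fderiv]
    refine ⟨fun v => (h v).differentiableAt, by simp, ?_⟩
    rw [funext fun v => (h v).fderiv]
    refine ContDiff.sum fun i _ => ContDiff.smul (f := fun v => D i g (torusProj v)) ?_ contDiff_const
    exact ih (half_pos hr) (wN_D_ne_top (half_pos hr).le (half_lt_self hr) i hg)

/-- Mode by mode the symbols multiply to one, except at `k = 0`, where the left side vanishes and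
the right side subtracts the mean. -/
lemma torusLaplacian_pot {r : ℝ} (hr : 0 < r) {g : C(T3, ℝ)} (hg : wN r g ≠ ⊤) (x : T3) :
    -torusLaplacian (pot g) x = g x - ∫ y, g y ∂torusMeasure := by
  have hp : wN r (pot g) ≠ ⊤ := ne_top_of_le_ne_top hg (wN_pot_le hr.le hg)
  have hr2 := half_pos hr
  have hd : ∀ i, wN (r / 2) (D i (pot g)) ≠ ⊤ := fun i => wN_D_ne_top hr2.le (half_lt_self hr) i hp
  have h1 : torusLaplacian (pot g) x = (∑ i, D i (D i (pot g))) x := by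
    simp only [torusLaplacian, ContinuousMap.sum_apply]
    refine Finset.sum_congr rfl fun i _ => ?_
    rw [torusPartial_eq_D hr hp, torusPartial_eq_D hr2 (hd i)]
  have hc : ∀ c : ℝ, ∀ k, hat (ContinuousMap.const T3 c) k = if k = 0 then (c : ℂ) else 0 := fun c k => by
    have : hat (ContinuousMap.const T3 c) k = mFourierCoeff ((c : ℂ) • mFourier 0 : C(T3, ℂ)) k := by
      rw [hat]; congr 1; ext y; simp [mFourier_zero]
    rw [this, ← coeffCLM_apply, map_smul, coeffCLM_apply, mFourierCoeff_mFourier]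
    simp [eq_comm]
  have h2 : -(∑ i, D i (D i (pot g))) = g - ContinuousMap.const T3 (∫ y, g y ∂torusMeasure) := by
    have hgs := summable_hat hr.le hg
    have hcs : Summable (hat (ContinuousMap.const T3 (∫ y, g y ∂torusMeasure))) :=
      summable_of_ne_finset_zero (s := {0}) fun k hk => by
        rw [hc, if_neg (by simpa using hk)]
    refine eq_of_hat_eq ((hgs.sub hcs).congr fun k => (hat_sub _ _ k).symm) fun k => ?_
    rw [hat_neg_fun, hat_sum, hat_sub, hc]
    simp only [hat_D hr2 _ (hd _), hat_D hr _ hp, hat_pot hr.le hg]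
    by_cases hk : k = 0
    · subst hk; simp [dSymbol, hat_zero]
    · rw [if_neg hk, sub_zero]
      have h3 : (∑ i, ((k i : ℝ) : ℂ) ^ 2) = ((freqNorm k ^ 2 : ℝ) : ℂ) := by
        rw [freqNorm, Real.sq_sqrt (Finset.sum_nonneg fun i _ => sq_nonneg _)]
        push_cast; rfl
      have h4 : ((freqNorm k : ℝ) : ℂ) ≠ 0 := by
        have := one_le_freqNorm hk
        exact_mod_cast (by positivity : freqNorm k ≠ 0)
      have h5 : ∀ i, dSymbol i k * (dSymbol i k * (potSymbol k * hat g k)) =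
          (((k i : ℝ) : ℂ) ^ 2) * (-(4 * Real.pi ^ 2) * potSymbol k * hat g k) := fun i => by
        simp only [dSymbol, Complex.ofReal_intCast]
        linear_combination (4 * Real.pi ^ 2 * (k i) ^ 2 * potSymbol k * hat g k) * Complex.I_sq
      rw [Finset.sum_congr rfl fun i _ => h5 i, ← Finset.sum_mul, h3, potSymbol]
      have hpi : (Real.pi : ℂ) ≠ 0 := by exact_mod_cast Real.pi_ne_zero
      push_cast
      field_simp
  rw [h1, ← ContinuousMap.neg_apply, h2]
  rfl

/-! ### Families of functions and their averages -/

lemma tendsto_diff_quotient {E : Type*} [NormedAddCommGroup E] [NormedSpace ℝ E] {f : ℝ → E} {f' : E}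
    {t : ℝ} (h : HasDerivAt f f' t) :
    Tendsto (fun n : ℕ => ((n : ℝ) + 1) • (f (t + ((n : ℝ) + 1)⁻¹) - f t)) atTop (𝓝 f') := by
  have h1 : Tendsto (fun n : ℕ => ((n : ℝ) + 1)⁻¹) atTop (𝓝[≠] 0) := by
    refine tendsto_nhdsWithin_iff.2 ⟨?_, Eventually.of_forall fun n => ?_⟩
    · simpa using tendsto_one_div_add_atTop_nhds_zero_nat (𝕜 := ℝ)
    · exact inv_ne_zero (by positivity)
  have h2 := (hasDerivAt_iff_tendsto_slope_zero.1 h).comp h1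
  simpa [Function.comp_def] using h2

/-- A derivative is the limit of a sequence of difference quotients. This carries measurability in
`θ` over to spatial derivatives. -/
lemma measurable_of_hasDerivAt {α : Type*} [MeasurableSpace α] {F : ℝ → α → ℝ} {F' : α → ℝ} {t : ℝ}
    (hF : ∀ s, Measurable (F s)) (h : ∀ a, HasDerivAt (fun s => F s a) (F' a) t) : Measurable F' :=
  measurable_of_tendsto_metrizable (f := fun (n : ℕ) a => ((n : ℝ) + 1) • (F (t + ((n : ℝ) + 1)⁻¹) a - F t a))
    (fun n => ((hF _).sub (hF _)).const_smul ((n : ℝ) + 1))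
    (tendsto_pi_nhds.2 fun a => tendsto_diff_quotient (h a))

variable {M : Type*} [MeasurableSpace M]

lemma measurable_D {g : M → C(T3, ℝ)} {r : ℝ} (hr : 0 < r) (hm : ∀ x, Measurable fun θ => g θ x)
    (hg : ∀ θ, wN r (g θ) ≠ ⊤) (i : Fin 3) (x : T3) : Measurable fun θ => D i (g θ) x :=
  measurable_of_hasDerivAt (t := 0) (F := fun s θ => g θ (x + Pi.single i (s : UnitAddCircle)))
    (fun _ => hm _) fun θ => hasDerivAt_coord_D hr (hg θ) i x

lemma measurable_uncurry_family {g : M → C(T3, ℝ)} (hm : ∀ x, Measurable fun θ => g θ x) :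
    Measurable fun p : M × T3 => g p.1 p.2 := by
  have := measurable_uncurry_of_continuous_of_measurable (u := fun (x : T3) (θ : M) => g θ x)
    (fun θ => (g θ).continuous) hm
  exact this.comp measurable_swap

/-- The average `∫ g_θ μ(dθ)` of a family of functions. -/
def avg (μ : Measure M) (g : M → C(T3, ℝ)) : C(T3, ℝ) :=
  open Classical in
  if h : Continuous fun x => ∫ θ, g θ x ∂μ then ⟨_, h⟩ else 0

lemma abs_apply_le {r C : ℝ} (hr : 0 ≤ r) (hC : 0 ≤ C) {g : C(T3, ℝ)}
    (h : wN r g ≤ ENNReal.ofReal C) (x : T3) : |g x| ≤ C := by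
  have h1 := (enorm_le_wN hr g).trans h
  rw [← ofReal_norm, ENNReal.ofReal_le_ofReal_iff hC] at h1
  exact (g.norm_coe_le_norm x).trans h1

variable (μ : Measure M)

section avg

variable {μ} [IsProbabilityMeasure μ]
variable {r C : ℝ} {g : M → C(T3, ℝ)}

lemma integrable_family (hr : 0 ≤ r) (hC : 0 ≤ C) (hm : ∀ x, Measurable fun θ => g θ x)
    (hg : ∀ θ, wN r (g θ) ≤ ENNReal.ofReal C) (x : T3) : Integrable (fun θ => g θ x) μ :=
  (integrable_const C).mono' (hm x).aestronglyMeasurable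
    (ae_of_all _ fun θ => abs_apply_le hr hC (hg θ) x)

lemma avg_apply (hr : 0 ≤ r) (hC : 0 ≤ C) (hm : ∀ x, Measurable fun θ => g θ x)
    (hg : ∀ θ, wN r (g θ) ≤ ENNReal.ofReal C) (x : T3) : avg μ g x = ∫ θ, g θ x ∂μ := by
  have h : Continuous fun x => ∫ θ, g θ x ∂μ :=
    continuous_of_dominated (fun x => (hm x).aestronglyMeasurable)
      (fun x => ae_of_all _ fun θ => abs_apply_le hr hC (hg θ) x) (integrable_const C)
      (ae_of_all _ fun θ => (g θ).continuous)
  rw [avg, dif_pos h]; rfl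

lemma integrable_uncurry_family (hr : 0 ≤ r) (hC : 0 ≤ C) (hm : ∀ x, Measurable fun θ => g θ x)
    (hg : ∀ θ, wN r (g θ) ≤ ENNReal.ofReal C) :
    Integrable (fun p : M × T3 => g p.1 p.2) (μ.prod torusMeasure) :=
  (integrable_const C).mono' (measurable_uncurry_family hm).aestronglyMeasurable
    (ae_of_all _ fun p => abs_apply_le hr hC (hg p.1) p.2)

lemma hat_avg (hr : 0 ≤ r) (hC : 0 ≤ C) (hm : ∀ x, Measurable fun θ => g θ x)
    (hg : ∀ θ, wN r (g θ) ≤ ENNReal.ofReal C) (k) : hat (avg μ g) k = ∫ θ, hat (g θ) k ∂μ := by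
  simp only [hat_eq_integral, avg_apply hr hC hm hg]
  rw [integral_integral_swap]
  · congr 1; ext x
    rw [integral_const_mul, integral_complex_ofReal]
  · have := (integrable_uncurry_family (μ := μ) hr hC hm hg).ofReal (𝕜 := ℂ)
    refine Integrable.mono' (this.norm) ?_ (ae_of_all _ fun p => ?_)
    · have h1 : Measurable fun p : M × T3 => mFourier (-k) p.2 :=
        (mFourier (-k)).continuous.measurable.comp measurable_snd
      exact h1.aestronglyMeasurable.mul this.aestronglyMeasurable
    · simp [Function.uncurry, norm_mFourier_apply]

lemma measurable_hat (hm : ∀ x, Measurable fun θ => g θ x) (k) : Measurable fun θ => hat (g θ) k := by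
  simp only [hat_eq_integral]
  have h1 : Measurable fun p : M × T3 => mFourier (-k) p.2 * (g p.1 p.2 : ℂ) :=
    ((mFourier (-k)).continuous.measurable.comp measurable_snd).mul
      (Complex.measurable_ofReal.comp (measurable_uncurry_family hm))
  exact h1.stronglyMeasurable.integral_prod_right.measurable

/-- Minkowski's inequality: coefficients commute with the average, and Tonelli exchanges the sum
over modes with the integral over `θ`. -/
lemma wN_avg_le (hr : 0 ≤ r) (hC : 0 ≤ C) (hm : ∀ x, Measurable fun θ => g θ x)
    (hg : ∀ θ, wN r (g θ) ≤ ENNReal.ofReal C) : wN r (avg μ g) ≤ ENNReal.ofReal C := by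
  calc wN r (avg μ g) ≤ ∑' k, ∫⁻ θ, ‖hat (g θ) k‖ₑ * wt r k ∂μ := by
        refine ENNReal.tsum_le_tsum fun k => ?_
        rw [hat_avg hr hC hm hg, lintegral_mul_const _ (measurable_hat hm k).enorm]
        gcongr
        exact enorm_integral_le_lintegral_enorm _
    _ = ∫⁻ θ, wN r (g θ) ∂μ :=
        (lintegral_tsum fun k => ((measurable_hat hm k).enorm.mul_const _).aemeasurable).symm
    _ ≤ ∫⁻ _, ENNReal.ofReal C ∂μ := lintegral_mono hg
    _ = ENNReal.ofReal C := by simp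

end avg

/-! ### The coefficients of the power series in time -/

/-- One coefficient of the power series: densities and momenta of all the fluids. -/
structure Coeff (M : Type*) where
  den : M → C(T3, ℝ)
  mom : M → Fin 3 → C(T3, ℝ)

/-- The coefficient of order `n + 1` in terms of the previous ones. -/
def nextCoeff (n : ℕ) (v : ℕ → Coeff M) : Coeff M where
  den θ := -(((n : ℝ) + 1)⁻¹ • ∑ p ∈ Finset.HasAntidiagonal.antidiagonal n, ∑ i,
    D i ((v p.1).mom θ i * (v p.2).den θ))
  mom θ j := -(((n : ℝ) + 1)⁻¹ • ((∑ p ∈ Finset.HasAntidiagonal.antidiagonal n, ∑ i,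
    (v p.1).mom θ i * D i ((v p.2).mom θ j)) + D j (pot (avg μ (v n).den))))

/-- The coefficients of the power series in time of the solution. -/
def coeff (v0 : Coeff M) : ℕ → Coeff M
  | 0 => v0
  -- The guard makes the recursion well-founded. Only indices up to `n` are read by `nextCoeff`, so
  -- the default `v0` plays no role (`coeff_succ`).
  | n + 1 => nextCoeff μ n fun m => if _h : m ≤ n then coeff v0 m else v0
  termination_by n => n
  decreasing_by omega

lemma coeff_zero (v0 : Coeff M) : coeff μ v0 0 = v0 := by rw [coeff]

lemma coeff_succ (v0 : Coeff M) (n : ℕ) : coeff μ v0 (n + 1) = nextCoeff μ n (coeff μ v0) := by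
  have h : ∀ p ∈ Finset.HasAntidiagonal.antidiagonal n, p.1 ≤ n ∧ p.2 ≤ n := fun p hp => by
    rw [Finset.HasAntidiagonal.mem_antidiagonal] at hp; omega
  rw [coeff, nextCoeff, nextCoeff]
  congr 1
  · ext1 θ
    congr 2
    refine Finset.sum_congr rfl fun p hp => ?_
    simp only [(h p hp).1, (h p hp).2, dite_true]
  · ext1 θ; ext1 j
    simp only [le_refl, dite_true]
    congr 3
    refine Finset.sum_congr rfl fun p hp => ?_
    simp only [(h p hp).1, (h p hp).2, dite_true]

lemma wN_D_mul_le {r s A B : ℝ} (hr : 0 ≤ r) (hs : r < s) (hA : 0 ≤ A) {f g : C(T3, ℝ)}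
    (hf : wN s f ≤ ENNReal.ofReal A) (hg : wN s g ≤ ENNReal.ofReal B) (i : Fin 3) :
    wN r (D i (f * g)) ≤ ENNReal.ofReal (2 * Real.pi / (s - r) * (A * B)) := by
  have h1 : wN s (f * g) ≤ ENNReal.ofReal (A * B) := by
    rw [ENNReal.ofReal_mul hA]
    exact (wN_mul_le (hr.trans hs.le) f g).trans (mul_le_mul' hf hg)
  rw [ENNReal.ofReal_mul (div_nonneg Real.two_pi_pos.le (sub_pos.2 hs).le)]
  exact (wN_D_le hr hs i (ne_top_of_le_ne_top ENNReal.ofReal_ne_top h1)).trans (by gcongr)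

lemma wN_mul_D_le {r s A B : ℝ} (hr : 0 ≤ r) (hs : r < s) (hA : 0 ≤ A) {f g : C(T3, ℝ)}
    (hf : wN s f ≤ ENNReal.ofReal A) (hg : wN s g ≤ ENNReal.ofReal B) (i : Fin 3) :
    wN r (f * D i g) ≤ ENNReal.ofReal (2 * Real.pi / (s - r) * (A * B)) := by
  have h2 := wN_D_le hr hs i (ne_top_of_le_ne_top ENNReal.ofReal_ne_top hg)
  have h0 : 0 ≤ 2 * Real.pi / (s - r) := div_nonneg Real.two_pi_pos.le (sub_pos.2 hs).le
  rw [show 2 * Real.pi / (s - r) * (A * B) = A * (2 * Real.pi / (s - r) * B) by ring,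
    ENNReal.ofReal_mul hA, ENNReal.ofReal_mul h0]
  refine (wN_mul_le hr f _).trans (mul_le_mul' ((wN_mono hs.le f).trans hf) (h2.trans ?_))
  gcongr

/-- The bounds of the coefficients. -/
def coeffBound (B R r₀ r : ℝ) (n : ℕ) : ℝ := B * R ^ n * catalan n * ((r₀ - r)⁻¹) ^ n

lemma coeffBound_nonneg {B R r₀ r : ℝ} (hB : 0 ≤ B) (hR : 0 ≤ R) (h : r < r₀) (n : ℕ) :
    0 ≤ coeffBound B R r₀ r n := by
  have := sub_pos.2 h
  unfold coeffBound; positivity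

lemma wN_sum_antidiagonal_le {r c : ℝ} {b : ℕ → ℝ} (n : ℕ) {F : ℕ × ℕ → Fin 3 → C(T3, ℝ)}
    (hc : 0 ≤ c) (hb : ∀ m, 0 ≤ b m)
    (h : ∀ p ∈ Finset.HasAntidiagonal.antidiagonal n, ∀ i, wN r (F p i) ≤ ENNReal.ofReal (c * (b p.1 * b p.2))) :
    wN r (∑ p ∈ Finset.HasAntidiagonal.antidiagonal n, ∑ i, F p i) ≤
      ENNReal.ofReal (3 * c * ∑ p ∈ Finset.HasAntidiagonal.antidiagonal n, b p.1 * b p.2) := by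
  rw [Finset.mul_sum, ENNReal.ofReal_sum_of_nonneg fun p _ => by have := hb p.1; have := hb p.2; positivity]
  refine (wN_sum_le _ _ _).trans (Finset.sum_le_sum fun p hp => (wN_sum_le _ _ _).trans ?_)
  refine (Finset.sum_le_sum fun i _ => h p hp i).trans (le_of_eq ?_)
  rw [Finset.sum_const, Finset.card_univ, Fintype.card_fin, nsmul_eq_mul, mul_assoc 3,
    ENNReal.ofReal_mul (p := 3) (by norm_num)]
  norm_num

/-- This is Segner's recursion; it is the reason for the Catalan factor in `coeffBound`, which
reproduces itself under Cauchy products. -/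
lemma sum_coeffBound (B R r₀ r : ℝ) (n : ℕ) :
    ∑ p ∈ Finset.HasAntidiagonal.antidiagonal n, coeffBound B R r₀ r p.1 * coeffBound B R r₀ r p.2 =
      B ^ 2 * R ^ n * catalan (n + 1) * ((r₀ - r)⁻¹) ^ n := by
  rw [catalan_succ']
  push_cast
  rw [Finset.mul_sum, Finset.sum_mul]
  refine Finset.sum_congr rfl fun p hp => ?_
  rw [← Finset.HasAntidiagonal.mem_antidiagonal.1 hp, coeffBound, coeffBound]
  ring

lemma one_add_inv_pow_le (n : ℕ) : (((n : ℝ) + 2) / (n + 1)) ^ n ≤ Real.exp 1 := by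
  have h1 : ((n : ℝ) + 2) / (n + 1) ≤ Real.exp (1 / (n + 1)) := by
    refine le_trans (le_of_eq ?_) (Real.add_one_le_exp _)
    field_simp; ring
  refine (pow_le_pow_left₀ (by positivity) h1 n).trans ?_
  rw [← Real.exp_nat_mul]
  refine Real.exp_le_exp.2 ?_
  rw [mul_one_div]
  exact div_le_one_of_le₀ (by linarith) (by positivity)

/-- Let `s = r + (r₀ - r)/(n + 2)`. The derivative costs `2π(n + 2)/(r₀ - r)`, and passing from `(r₀
- s)⁻ⁿ` to `(r₀ - r)⁻ⁿ` costs at most `e`. With three directions and `(n + 2)/(n + 1) ≤ 2`, the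
quadratic part contributes `3 · 2π · 2 · e · B = 12πeB` to `R`; the force contributes `r₀`. -/
lemma coeffBound_succ {B R r₀ r : ℝ} (hB : 0 ≤ B) (hr : 0 ≤ r) (hr₀ : r < r₀)
    (hR : 12 * Real.pi * Real.exp 1 * B + r₀ ≤ R) (n : ℕ) :
    ((n : ℝ) + 1)⁻¹ * (3 * (2 * Real.pi / (r + (r₀ - r) / (n + 2) - r)) *
      (B ^ 2 * R ^ n * catalan (n + 1) * ((r₀ - (r + (r₀ - r) / (n + 2)))⁻¹) ^ n)
      + coeffBound B R r₀ r n) ≤ coeffBound B R r₀ r (n + 1) := by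
  have hd : 0 < r₀ - r := sub_pos.2 hr₀
  have hRp : 0 ≤ R := le_trans (by have := Real.exp_pos 1; have := Real.pi_pos; have := hr.trans hr₀.le; positivity) hR
  -- The index pair `(n, 0)` alone contributes `catalan n` to the recursion.
  have hcat : (catalan n : ℝ) ≤ catalan (n + 1) := by
    rw [catalan_succ']
    have := Finset.single_le_sum (f := fun p : ℕ × ℕ => catalan p.1 * catalan p.2)
      (fun _ _ => Nat.zero_le _) (Finset.HasAntidiagonal.mem_antidiagonal.2 (show (n, 0).1 + (n, 0).2 = n from add_zero n))
    simp only [catalan_zero, mul_one] at this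
    exact_mod_cast this
  have h1 : (r₀ - (r + (r₀ - r) / (n + 2)))⁻¹ = (r₀ - r)⁻¹ * (((n : ℝ) + 2) / (n + 1)) := by
    have : r₀ - (r + (r₀ - r) / (n + 2)) = (r₀ - r) * ((n + 1) / (n + 2)) := by field_simp; ring
    rw [this, mul_inv, inv_div]
  have h2 : 2 * Real.pi / (r + (r₀ - r) / (n + 2) - r) = 2 * Real.pi * (n + 2) * (r₀ - r)⁻¹ := by
    rw [add_sub_cancel_left]; field_simp
  rw [h1, h2, mul_pow]
  set q := (r₀ - r)⁻¹ with hq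
  have hq0 : 0 < q := inv_pos.2 hd
  set E := (((n : ℝ) + 2) / (n + 1)) ^ n with hE
  have hE1 : E ≤ Real.exp 1 := one_add_inv_pow_le n
  have hE0 : 0 ≤ E := by positivity
  set c := (catalan (n + 1) : ℝ)
  have hc0 : 0 ≤ c := Nat.cast_nonneg _
  have h3 : ((n : ℝ) + 1)⁻¹ * (n + 2) ≤ 2 := by
    rw [inv_mul_le_iff₀ (by positivity)]; linarith
  have h4 : ((n : ℝ) + 1)⁻¹ ≤ 1 := inv_le_one_of_one_le₀ (by linarith [(Nat.cast_nonneg n : (0 : ℝ) ≤ n)])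
  -- Since `r ≥ 0`, the ratio `r₀/(r₀ - r)` is at least one. It supplies the extra power of `(r₀ -
  -- r)⁻¹` that the force term lacks.
  have hqr : 1 ≤ q * r₀ := by
    rw [hq, inv_mul_eq_div, le_div_iff₀ hd]; linarith
  have hpi := Real.pi_pos
  have h5 : ((n : ℝ) + 1)⁻¹ * (3 * (2 * Real.pi * (n + 2) * q) * (B ^ 2 * R ^ n * c * (q ^ n * E)))
      ≤ 12 * Real.pi * Real.exp 1 * B * (B * R ^ n * c * q ^ (n + 1)) := by
    have : ((n : ℝ) + 1)⁻¹ * (3 * (2 * Real.pi * (n + 2) * q) * (B ^ 2 * R ^ n * c * (q ^ n * E))) =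
      (((n : ℝ) + 1)⁻¹ * (n + 2)) * E * (6 * Real.pi * B * (B * R ^ n * c * q ^ (n + 1))) := by ring
    rw [this]
    calc _ ≤ 2 * Real.exp 1 * (6 * Real.pi * B * (B * R ^ n * c * q ^ (n + 1))) := by gcongr
      _ = _ := by ring
  have h6 : ((n : ℝ) + 1)⁻¹ * coeffBound B R r₀ r n ≤ r₀ * (B * R ^ n * c * q ^ (n + 1)) := by
    calc _ ≤ 1 * coeffBound B R r₀ r n := by
          gcongr; exact coeffBound_nonneg hB hRp hr₀ n
      _ ≤ 1 * (B * R ^ n * c * q ^ n) := by unfold coeffBound; gcongr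
      _ ≤ (q * r₀) * (B * R ^ n * c * q ^ n) := by gcongr
      _ = _ := by ring
  rw [mul_add]
  refine (add_le_add h5 h6).trans ?_
  rw [← add_mul]
  calc _ ≤ R * (B * R ^ n * c * q ^ (n + 1)) := by gcongr
    _ = _ := by rw [coeffBound]; ring

/-- Measurability and bounds are proved together: averaging uses measurability, and measurability of
derivatives uses finite norms. All radii `r < r₀` are needed at once, because the step at `r` uses
the bounds at a larger radius. -/
lemma coeff_bounds [IsProbabilityMeasure μ] {B R r₀ : ℝ} (hB : 0 ≤ B) (hr₀ : 0 < r₀)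
    (hR : 12 * Real.pi * Real.exp 1 * B + r₀ ≤ R) {v0 : Coeff M}
    (hm : ∀ x, Measurable fun θ => v0.den θ x) (hm' : ∀ j x, Measurable fun θ => v0.mom θ j x)
    (h0 : ∀ θ, wN r₀ (v0.den θ) ≤ ENNReal.ofReal B)
    (h0' : ∀ θ j, wN r₀ (v0.mom θ j) ≤ ENNReal.ofReal B) (n : ℕ) :
    (∀ x, Measurable fun θ => (coeff μ v0 n).den θ x) ∧
    (∀ j x, Measurable fun θ => (coeff μ v0 n).mom θ j x) ∧
    ∀ r, 0 < r → r < r₀ → ∀ θ,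
      wN r ((coeff μ v0 n).den θ) ≤ ENNReal.ofReal (coeffBound B R r₀ r n) ∧
      ∀ j, wN r ((coeff μ v0 n).mom θ j) ≤ ENNReal.ofReal (coeffBound B R r₀ r n) := by
  have hRp : 0 ≤ R := le_trans (by have := Real.exp_pos 1; have := Real.pi_pos; positivity) hR
  induction n using Nat.strong_induction_on with
  | _ n ih =>
  cases n with
  | zero =>
    rw [coeff_zero]
    refine ⟨hm, hm', fun r _ hr θ => ?_⟩
    simp only [coeffBound, pow_zero, catalan_zero, Nat.cast_one, mul_one]
    exact ⟨(wN_mono hr.le _).trans (h0 θ), fun j => (wN_mono hr.le _).trans (h0' θ j)⟩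
  | succ n =>
    have hp : ∀ p ∈ Finset.HasAntidiagonal.antidiagonal n, p.1 < n + 1 ∧ p.2 < n + 1 := fun p hp => by
      rw [Finset.HasAntidiagonal.mem_antidiagonal] at hp; omega
    -- Measurability needs only some radius at which the norms are finite; `r₀ / 2` is arbitrary.
    have hfin : ∀ m < n + 1, ∀ θ j, wN (r₀ / 2) ((coeff μ v0 m).mom θ j) ≠ ⊤ := fun m hm θ j =>
      ne_top_of_le_ne_top ENNReal.ofReal_ne_top
        (((ih m hm).2.2 (r₀ / 2) (half_pos hr₀) (half_lt_self hr₀) θ).2 j)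
    have hfin' : ∀ m < n + 1, ∀ θ, wN (r₀ / 2) ((coeff μ v0 m).den θ) ≠ ⊤ := fun m hm θ =>
      ne_top_of_le_ne_top ENNReal.ofReal_ne_top
        (((ih m hm).2.2 (r₀ / 2) (half_pos hr₀) (half_lt_self hr₀) θ).1)
    rw [coeff_succ]
    refine ⟨fun x => ?_, fun j x => ?_, fun r hr hrr => ?_⟩
    · simp only [nextCoeff, ContinuousMap.neg_apply, ContinuousMap.smul_apply, ContinuousMap.sum_apply,
        smul_eq_mul]
      refine Measurable.neg (Measurable.const_mul (Finset.measurable_sum _ fun p hp' =>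
        Finset.measurable_sum _ fun i _ => ?_) _)
      obtain ⟨h1, h2⟩ := hp p hp'
      refine measurable_D (half_pos hr₀) (fun y => ?_) (fun θ => ?_) i x
      · exact ((ih _ h1).2.1 i y).mul ((ih _ h2).1 y)
      · exact ne_top_of_le_ne_top (ENNReal.mul_ne_top (hfin _ h1 θ i) (hfin' _ h2 θ))
          (wN_mul_le (half_pos hr₀).le _ _)
    · simp only [nextCoeff, ContinuousMap.neg_apply, ContinuousMap.smul_apply, ContinuousMap.sum_apply,
        ContinuousMap.add_apply, ContinuousMap.mul_apply, smul_eq_mul]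
      -- The force is common to all fluids, hence constant in `θ`.
      refine Measurable.neg (Measurable.const_mul (Measurable.add_const
        (Finset.measurable_sum _ fun p hp' => Finset.measurable_sum _ fun i _ => ?_) _) _)
      obtain ⟨h1, h2⟩ := hp p hp'
      exact ((ih _ h1).2.1 i x).mul
        (measurable_D (half_pos hr₀) ((ih _ h2).2.1 j) (fun θ => hfin _ h2 θ j) i x)
    · set s := r + (r₀ - r) / (n + 2) with hs
      have hd : 0 < r₀ - r := sub_pos.2 hrr
      have hrs : r < s := lt_add_of_pos_right _ (by positivity)
      have hs0 : s < r₀ := by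
        have : (r₀ - r) / (n + 2) < r₀ - r := div_lt_self hd (by linarith [(Nat.cast_nonneg n : (0 : ℝ) ≤ n)])
        linarith
      have hc : 0 ≤ 2 * Real.pi / (s - r) := div_nonneg Real.two_pi_pos.le (sub_pos.2 hrs).le
      have hb := coeffBound_nonneg hB hRp hs0
      have hmain := coeffBound_succ hB hr.le hrr hR n
      rw [← hs, ← sum_coeffBound] at hmain
      have hsum0 : 0 ≤ 3 * (2 * Real.pi / (s - r)) * ∑ p ∈ Finset.HasAntidiagonal.antidiagonal n,
          coeffBound B R r₀ s p.1 * coeffBound B R r₀ s p.2 :=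
        mul_nonneg (by positivity) (Finset.sum_nonneg fun p _ => mul_nonneg (hb _) (hb _))
      have hn0 : (0 : ℝ) ≤ ((n : ℝ) + 1)⁻¹ := by positivity
      have hcb := coeffBound_nonneg hB hRp hrr n
      intro θ
      constructor
      · simp only [nextCoeff]
        rw [wN_neg, wN_smul, abs_of_nonneg hn0]
        refine le_trans ?_ (ENNReal.ofReal_le_ofReal hmain)
        rw [ENNReal.ofReal_mul hn0]
        gcongr
        refine le_trans ?_ (ENNReal.ofReal_le_ofReal (le_add_of_nonneg_right hcb))
        refine wN_sum_antidiagonal_le n hc hb fun p hp' i => ?_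
        obtain ⟨h1, h2⟩ := hp p hp'
        exact wN_D_mul_le hr.le hrs (hb _) (((ih _ h1).2.2 s (hr.trans hrs) hs0 θ).2 i)
          ((ih _ h2).2.2 s (hr.trans hrs) hs0 θ).1 i
      · intro j
        simp only [nextCoeff]
        rw [wN_neg, wN_smul, abs_of_nonneg hn0]
        refine le_trans ?_ (ENNReal.ofReal_le_ofReal hmain)
        rw [ENNReal.ofReal_mul hn0, ENNReal.ofReal_add hsum0 hcb]
        gcongr
        refine (wN_add_le _ _ _).trans (add_le_add ?_ ?_)
        · refine wN_sum_antidiagonal_le n hc hb fun p hp' i => ?_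
          obtain ⟨h1, h2⟩ := hp p hp'
          exact wN_mul_D_le hr.le hrs (hb _) (((ih _ h1).2.2 s (hr.trans hrs) hs0 θ).2 i)
            (((ih _ h2).2.2 s (hr.trans hrs) hs0 θ).2 j) i
        -- The force is estimated at the radius `r` itself, without loss.
        · have hn := ih n (Nat.lt_succ_self n)
          have ha := wN_avg_le (μ := μ) hr.le hcb hn.1 fun θ => (hn.2.2 r hr hrr θ).1
          exact (wN_D_pot_le hr j (ne_top_of_le_ne_top ENNReal.ofReal_ne_top ha)).trans ha

lemma catalan_le_four_pow (n : ℕ) : catalan n ≤ 4 ^ n := by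
  rw [catalan_eq_centralBinom_div]
  refine (Nat.div_le_self _ _).trans ?_
  rw [Nat.centralBinom_eq_two_mul_choose]
  refine (Nat.choose_le_two_pow _ _).trans (le_of_eq ?_)
  rw [pow_mul]; norm_num

lemma coeffBound_le {B R r₀ r : ℝ} (hB : 0 ≤ B) (hR : 0 ≤ R) (h : r < r₀) (n : ℕ) :
    coeffBound B R r₀ r n ≤ B * (4 * R * (r₀ - r)⁻¹) ^ n := by
  have := sub_pos.2 h
  have h4 : (catalan n : ℝ) ≤ 4 ^ n := by exact_mod_cast catalan_le_four_pow n
  calc coeffBound B R r₀ r n ≤ B * R ^ n * 4 ^ n * ((r₀ - r)⁻¹) ^ n := by unfold coeffBound; gcongr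
    _ = _ := by ring

/-! ### Power series in time with coefficients in `B_δ` -/

/-- The power series with coefficients `u`. -/
def ser (u : ℕ → C(T3, ℝ)) (t : ℝ) : C(T3, ℝ) := ∑' n, t ^ n • u n

/-- Geometric growth of the coefficients in the norm `wN r`. -/
def GeomBound (r B Q : ℝ) (u : ℕ → C(T3, ℝ)) : Prop := ∀ n, wN r (u n) ≤ ENNReal.ofReal (B * Q ^ n)

lemma tsum_ofReal_geometric {B : ℝ} (hB : 0 ≤ B) :
    ∑' n : ℕ, ENNReal.ofReal (B * (1 / 2) ^ n) = ENNReal.ofReal (B * 2) := by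
  rw [← ENNReal.ofReal_tsum_of_nonneg (fun n => by positivity) (summable_geometric_two.mul_left B),
    tsum_mul_left, tsum_geometric_two]

section series

variable {r B Q t : ℝ} {u : ℕ → C(T3, ℝ)}

lemma GeomBound.wN_term_le (h : GeomBound r B Q u) (hB : 0 ≤ B) (hQ : 0 ≤ Q) (ht : |t| * Q ≤ 1 / 2)
    (n : ℕ) : wN r (t ^ n • u n) ≤ ENNReal.ofReal (B * (1 / 2) ^ n) := by
  rw [wN_smul]
  refine (mul_le_mul_right (h n) _).trans ?_
  rw [← ENNReal.ofReal_mul (abs_nonneg _), abs_pow]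
  refine ENNReal.ofReal_le_ofReal ?_
  calc |t| ^ n * (B * Q ^ n) = B * (|t| * Q) ^ n := by ring
    _ ≤ _ := by gcongr

lemma GeomBound.tsum_le (h : GeomBound r B Q u) (hB : 0 ≤ B) (hQ : 0 ≤ Q) (ht : |t| * Q ≤ 1 / 2) :
    ∑' n, wN r (t ^ n • u n) ≤ ENNReal.ofReal (B * 2) :=
  (ENNReal.tsum_le_tsum fun n => h.wN_term_le hB hQ ht n).trans (tsum_ofReal_geometric hB).le

lemma summable_of_wN (hr : 0 ≤ r) {ι : Type*} {f : ι → C(T3, ℝ)} (h : ∑' n, wN r (f n) ≠ ⊤) :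
    Summable fun n => ‖f n‖ := by
  have h1 : ∑' n, ‖f n‖ₑ ≠ ⊤ :=
    ne_top_of_le_ne_top h (ENNReal.tsum_le_tsum fun n => enorm_le_wN hr (f n))
  simpa using ENNReal.summable_toReal h1

lemma GeomBound.tsum_ne_top (h : GeomBound r B Q u) (hB : 0 ≤ B) (hQ : 0 ≤ Q) (ht : |t| * Q ≤ 1 / 2) :
    ∑' n, wN r (t ^ n • u n) ≠ ⊤ := ne_top_of_le_ne_top ENNReal.ofReal_ne_top (h.tsum_le hB hQ ht)

lemma GeomBound.hasSum (h : GeomBound r B Q u) (hr : 0 ≤ r) (hB : 0 ≤ B) (hQ : 0 ≤ Q)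
    (ht : |t| * Q ≤ 1 / 2) : HasSum (fun n => t ^ n • u n) (ser u t) :=
  (Summable.of_norm (summable_of_wN hr (h.tsum_ne_top hB hQ ht))).hasSum

lemma GeomBound.wN_ser_le (h : GeomBound r B Q u) (hr : 0 ≤ r) (hB : 0 ≤ B) (hQ : 0 ≤ Q)
    (ht : |t| * Q ≤ 1 / 2) : wN r (ser u t) ≤ ENNReal.ofReal (B * 2) :=
  (wN_hasSum_le r (h.hasSum hr hB hQ ht)).trans (h.tsum_le hB hQ ht)

lemma ser_zero : ser u 0 = u 0 := by
  rw [ser, tsum_eq_single 0 fun n hn => by simp [hn]]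
  simp

lemma mult_smul (m) (c : ℝ) (g : C(T3, ℝ)) : mult m (c • g) = c • mult m g := by
  rw [mult, mult, synth, synth, ← map_smul, ← tsum_const_smul'']
  congr 2; ext1 k
  rw [hat_smul, ← smul_assoc]
  congr 1
  rw [Complex.real_smul]; ring

lemma GeomBound.hasSum_mult (h : GeomBound r B Q u) (hr : 0 ≤ r) (hB : 0 ≤ B) (hQ : 0 ≤ Q)
    (ht : |t| * Q ≤ 1 / 2) {m r' C} (hm : IsRealSymbol m) (hb : SymbolBound m r' r C) (hr' : 0 ≤ r') :
    HasSum (fun n => t ^ n • mult m (u n)) (mult m (ser u t)) := by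
  simpa only [mult_smul] using
    VlasovPoisson.hasSum_mult hb hm hr' (h.hasSum hr hB hQ ht) (h.tsum_ne_top hB hQ ht)

/-- The differentiated series is dominated by a multiple of `n 2⁻ⁿ`. Its sum `v` is left to the
hypothesis `hv`, so that it can be recognised as the right-hand side of the equation. -/
lemma GeomBound.hasDerivAt (h : GeomBound r B Q u) (hr : 0 ≤ r) (hB : 0 ≤ B) (hQ : 0 < Q)
    (ht : |t| * Q < 1 / 2) {v : C(T3, ℝ)}
    (hv : HasSum (fun n : ℕ => t ^ n • (((n : ℝ) + 1) • u (n + 1))) v) : HasDerivAt (ser u) v t := by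
  obtain ⟨τ, hτ⟩ : ∃ τ : ℝ, τ = (2 * Q)⁻¹ := ⟨_, rfl⟩
  have hτQ : τ * Q = 1 / 2 := by rw [hτ]; field_simp
  have hmem : ∀ y, y ∈ Metric.ball (0 : ℝ) τ ↔ |y| * Q < 1 / 2 := fun y => by
    rw [mem_ball_zero_iff, Real.norm_eq_abs, ← hτQ, mul_lt_mul_iff_left₀ hQ]
  have hsum : Summable fun n : ℕ => (B * Q * 2) * ((n : ℝ) ^ 1 * (1 / 2 : ℝ) ^ n) := by
    have h12 : ‖(1 / 2 : ℝ)‖ < 1 := by norm_num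
    exact (summable_pow_mul_geometric_of_norm_lt_one 1 h12).mul_left (B * Q * 2)
  have hnorm : ∀ n, ‖u n‖ ≤ B * Q ^ n := fun n => by
    have := (enorm_le_wN hr (u n)).trans (h n)
    rwa [← ofReal_norm, ENNReal.ofReal_le_ofReal_iff (by positivity)] at this
  have hbd : ∀ (n : ℕ) (y : ℝ), y ∈ Metric.ball (0 : ℝ) τ →
      ‖((n : ℝ) * y ^ (n - 1)) • u n‖ ≤ (B * Q * 2) * ((n : ℝ) ^ 1 * (1 / 2 : ℝ) ^ n) := fun n y hy => by
    rw [norm_smul]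
    cases n with
    | zero => simp
    | succ n =>
      have hy' := ((hmem y).1 hy).le
      rw [Nat.add_sub_cancel, norm_mul, norm_pow, Real.norm_eq_abs, Real.norm_eq_abs, pow_one,
        abs_of_nonneg (Nat.cast_nonneg _)]
      calc _ ≤ ((n + 1 : ℕ) : ℝ) * |y| ^ n * (B * Q ^ (n + 1)) :=
            mul_le_mul_of_nonneg_left (hnorm _) (by positivity)
        _ = ((n + 1 : ℕ) : ℝ) * (B * Q) * (|y| * Q) ^ n := by ring
        _ ≤ ((n + 1 : ℕ) : ℝ) * (B * Q) * (1 / 2) ^ n :=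
            mul_le_mul_of_nonneg_left (pow_le_pow_left₀ (by positivity) hy' n) (by positivity)
        _ = _ := by rw [pow_succ (1 / 2 : ℝ)]; ring
  have h0 : HasSum (fun n : ℕ => (((n : ℝ)) * t ^ (n - 1)) • u n) v := by
    -- The term of index zero has zero derivative; dropping it shifts the index to match `hv`.
    rw [← hasSum_nat_add_iff' 1]
    simp only [Finset.range_one, Finset.sum_singleton, Nat.cast_zero, zero_mul, zero_smul, sub_zero]
    refine hv.congr_fun fun n => ?_
    rw [smul_smul, Nat.add_sub_cancel]
    push_cast
    congr 1; ring
  rw [← h0.tsum_eq]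
  exact hasDerivAt_tsum_of_isPreconnected (𝕜 := ℝ) (g := fun n (s : ℝ) => s ^ n • u n)
    (g' := fun n s => ((n : ℝ) * s ^ (n - 1)) • u n) hsum Metric.isOpen_ball
    (convex_ball _ _).isPreconnected (fun n y _ => (hasDerivAt_pow n y).smul_const (u n)) hbd
    ((hmem t).2 ht) (h.hasSum hr hB hQ.le ht.le).summable ((hmem t).2 ht)

/-- The norm of the difference is at most `∑ |sⁿ - tⁿ| B Qⁿ`, a scalar series that tends to zero by
dominated convergence. -/
lemma GeomBound.tendsto_wN (h : GeomBound r B Q u) (hr : 0 ≤ r) (hB : 0 ≤ B) (hQ : 0 < Q)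
    (ht : |t| * Q < 1 / 2) : Tendsto (fun s => wN r (ser u s - ser u t)) (𝓝 t) (𝓝 0) := by
  have hev : ∀ᶠ s in 𝓝 t, |s| * Q < 1 / 2 :=
    (continuous_abs.mul continuous_const).continuousAt.eventually_lt continuousAt_const ht
  have h1 : Tendsto (fun s => ∑' n, |s ^ n - t ^ n| * (B * Q ^ n)) (𝓝 t)
      (𝓝 (∑' n, |t ^ n - t ^ n| * (B * Q ^ n))) := by
    refine tendsto_tsum_of_dominated_convergence (bound := fun n : ℕ => 2 * B * (1 / 2) ^ n)
      (summable_geometric_two.mul_left _) (fun n => ?_) (hev.mono fun s hs n => ?_)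
    · exact Continuous.tendsto (by fun_prop) t
    · rw [norm_mul, norm_mul, Real.norm_eq_abs, Real.norm_eq_abs, Real.norm_eq_abs, abs_abs,
        abs_of_nonneg hB, abs_of_nonneg (pow_nonneg hQ.le n)]
      calc |s ^ n - t ^ n| * (B * Q ^ n) ≤ (|s| ^ n + |t| ^ n) * (B * Q ^ n) := by
            gcongr
            simpa only [abs_pow] using abs_sub (s ^ n) (t ^ n)
        _ = B * (|s| * Q) ^ n + B * (|t| * Q) ^ n := by ring
        _ ≤ B * (1 / 2) ^ n + B * (1 / 2) ^ n := by gcongr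
        _ = _ := by ring
  simp only [sub_self, abs_zero, zero_mul, tsum_zero] at h1
  have h2 := ENNReal.tendsto_ofReal h1
  rw [ENNReal.ofReal_zero] at h2
  refine tendsto_of_tendsto_of_tendsto_of_le_of_le' tendsto_const_nhds h2
    (Eventually.of_forall fun _ => bot_le) (hev.mono fun s hs => ?_)
  have h3 := (h.hasSum hr hB hQ.le hs.le).sub (h.hasSum hr hB hQ.le ht.le)
  simp only [← sub_smul] at h3
  refine (wN_hasSum_le r h3).trans ?_
  have hsum : Summable fun n : ℕ => |s ^ n - t ^ n| * (B * Q ^ n) := by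
    refine Summable.of_nonneg_of_le (fun n => by positivity) (fun n => ?_)
      (summable_geometric_two.mul_left (2 * B))
    calc |s ^ n - t ^ n| * (B * Q ^ n) ≤ (|s| ^ n + |t| ^ n) * (B * Q ^ n) := by
          gcongr
          simpa only [abs_pow] using abs_sub (s ^ n) (t ^ n)
      _ = B * (|s| * Q) ^ n + B * (|t| * Q) ^ n := by ring
      _ ≤ B * (1 / 2) ^ n + B * (1 / 2) ^ n := by gcongr
      _ = _ := by ring
  rw [ENNReal.ofReal_tsum_of_nonneg (fun n => by positivity) hsum]
  refine ENNReal.tsum_le_tsum fun n => ?_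
  rw [wN_smul, ENNReal.ofReal_mul (abs_nonneg _)]
  gcongr
  exact h n

end series

/-! ### Cauchy products of series. -/

lemma hasSum_sum_antidiagonal {E : Type*} [NormedAddCommGroup E] {F : ℕ × ℕ → E} {s : E}
    (h : HasSum F s) : HasSum (fun n => ∑ p ∈ Finset.HasAntidiagonal.antidiagonal n, F p) s := by
  rw [← (Finset.HasAntidiagonal.sigmaAntidiagonalEquivProd (A := ℕ)).hasSum_iff] at h
  refine h.sigma fun n => ?_
  rw [← Finset.sum_coe_sort]
  exact hasSum_fintype _

lemma hasSum_prod_mul {r : ℝ} (hr : 0 ≤ r) {f g : ℕ → C(T3, ℝ)} {F G : C(T3, ℝ)} (hf : HasSum f F)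
    (hg : HasSum g G) (hf' : ∑' n, wN r (f n) ≠ ⊤) (hg' : ∑' n, wN r (g n) ≠ ⊤) :
    HasSum (fun p : ℕ × ℕ => f p.1 * g p.2) (F * G) :=
  hf.mul hg (summable_mul_of_summable_norm (summable_of_wN hr hf') (summable_of_wN hr hg'))

lemma tsum_wN_prod_mul {r : ℝ} (hr : 0 ≤ r) {f g : ℕ → C(T3, ℝ)}
    (hf' : ∑' n, wN r (f n) ≠ ⊤) (hg' : ∑' n, wN r (g n) ≠ ⊤) :
    ∑' p : ℕ × ℕ, wN r (f p.1 * g p.2) ≠ ⊤ := by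
  refine ne_top_of_le_ne_top (ENNReal.mul_ne_top hf' hg') ?_
  rw [ENNReal.tsum_prod', ← ENNReal.tsum_mul_right]
  refine ENNReal.tsum_le_tsum fun m => ?_
  rw [← ENNReal.tsum_mul_left]
  exact ENNReal.tsum_le_tsum fun n => wN_mul_le hr _ _

section products

variable {r B Q t : ℝ} {a b : ℕ → C(T3, ℝ)}

lemma hasSum_D_mul (ha : GeomBound r B Q a) (hb : GeomBound r B Q b) (hr : 0 < r) (hB : 0 ≤ B)
    (hQ : 0 ≤ Q) (ht : |t| * Q ≤ 1 / 2) (i : Fin 3) :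
    HasSum (fun n => ∑ p ∈ Finset.HasAntidiagonal.antidiagonal n, t ^ n • D i (a p.1 * b p.2))
      (D i (ser a t * ser b t)) := by
  have ha' := ha.tsum_ne_top hB hQ ht
  have hb' := hb.tsum_ne_top hB hQ ht
  have h1 : HasSum (fun p : ℕ × ℕ => (t ^ p.1 • a p.1) * (t ^ p.2 • b p.2)) (ser a t * ser b t) :=
    hasSum_prod_mul (f := fun n => t ^ n • a n) (g := fun n => t ^ n • b n) hr.le
      (ha.hasSum hr.le hB hQ ht) (hb.hasSum hr.le hB hQ ht) ha' hb'
  have h2 : HasSum (fun p : ℕ × ℕ => D i ((t ^ p.1 • a p.1) * (t ^ p.2 • b p.2)))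
      (D i (ser a t * ser b t)) :=
    hasSum_mult (symbolBound_d i hr) (isRealSymbol_d i) le_rfl h1
      (tsum_wN_prod_mul (f := fun n => t ^ n • a n) (g := fun n => t ^ n • b n) hr.le ha' hb')
  have h3 := hasSum_sum_antidiagonal h2
  refine h3.congr_fun fun n => Finset.sum_congr rfl fun p hp => ?_
  rw [smul_mul_smul_comm, ← pow_add, Finset.HasAntidiagonal.mem_antidiagonal.1 hp, D, D, mult_smul]

lemma hasSum_mul_D (ha : GeomBound r B Q a) (hb : GeomBound r B Q b) (hr : 0 < r) (hB : 0 ≤ B)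
    (hQ : 0 ≤ Q) (ht : |t| * Q ≤ 1 / 2) (i : Fin 3) :
    HasSum (fun n => ∑ p ∈ Finset.HasAntidiagonal.antidiagonal n, t ^ n • (a p.1 * D i (b p.2)))
      (ser a t * D i (ser b t)) := by
  have hr2 := half_pos hr
  -- The derivative falls on one factor before the product, so both factors are measured at the
  -- smaller radius `r / 2`.
  have hb' : ∑' n, wN (r / 2) (t ^ n • D i (b n)) ≠ ⊤ := by
    refine ne_top_of_le_ne_top (ENNReal.mul_ne_top ENNReal.ofReal_ne_top
      (hb.tsum_ne_top hB hQ ht) (a := ENNReal.ofReal (2 * Real.pi / (r - r / 2)))) ?_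
    rw [← ENNReal.tsum_mul_left]
    refine ENNReal.tsum_le_tsum fun n => ?_
    rw [D, ← mult_smul]
    exact wN_D_le hr2.le (half_lt_self hr) i
      (ENNReal.ne_top_of_tsum_ne_top (hb.tsum_ne_top hB hQ ht) n)
  have ha' : ∑' n, wN (r / 2) (t ^ n • a n) ≠ ⊤ :=
    ne_top_of_le_ne_top (ha.tsum_ne_top hB hQ ht)
      (ENNReal.tsum_le_tsum fun n => wN_mono (half_le_self hr.le) _)
  have hbs : HasSum (fun n => t ^ n • D i (b n)) (D i (ser b t)) :=
    hb.hasSum_mult hr.le hB hQ ht (isRealSymbol_d i) (symbolBound_d i hr) le_rfl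
  have h1 := hasSum_prod_mul (f := fun n => t ^ n • a n) (g := fun n => t ^ n • D i (b n)) hr2.le (ha.hasSum hr.le hB hQ ht) hbs ha' hb'
  refine (hasSum_sum_antidiagonal h1).congr_fun fun n => Finset.sum_congr rfl fun p hp => ?_
  rw [smul_mul_smul_comm, ← pow_add, Finset.HasAntidiagonal.mem_antidiagonal.1 hp]

end products

/-! ### The local solution -/

/-- Solutions of the multifluid system, on a symmetric time interval, with values in `B_δ`,
`δ = e^r`. -/
structure LocalSolution {M : Type*} [MeasurableSpace M] (μ : Measure M) (τ r C : ℝ)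
    (ρ : M → ℝ → C(T3, ℝ)) (ξ : M → ℝ → Fin 3 → C(T3, ℝ)) : Prop where
  r_pos : 0 < r
  C_nonneg : 0 ≤ C
  meas_den : ∀ t, |t| < τ → ∀ x, Measurable fun θ => ρ θ t x
  meas_mom : ∀ t, |t| < τ → ∀ j x, Measurable fun θ => ξ θ t j x
  bound_den : ∀ θ t, |t| < τ → wN r (ρ θ t) ≤ ENNReal.ofReal C
  bound_mom : ∀ θ t, |t| < τ → ∀ j, wN r (ξ θ t j) ≤ ENNReal.ofReal C
  tendsto_den : ∀ θ t, |t| < τ → Tendsto (fun s => wN r (ρ θ s - ρ θ t)) (𝓝 t) (𝓝 0)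
  tendsto_mom : ∀ θ t, |t| < τ → ∀ j, Tendsto (fun s => wN r (ξ θ s j - ξ θ t j)) (𝓝 t) (𝓝 0)
  deriv_den : ∀ θ t, |t| < τ → HasDerivAt (ρ θ) (-∑ i, D i (ξ θ t i * ρ θ t)) t
  deriv_mom : ∀ θ t, |t| < τ → ∀ j, HasDerivAt (fun s => ξ θ s j)
    (-(∑ i, ξ θ t i * D i (ξ θ t j)) - D j (pot (avg μ fun θ => ρ θ t))) t
  continuous_field : ∀ t, |t| < τ → ∀ j,
    ContinuousAt (fun s => D j (pot (avg μ fun θ => ρ θ s))) t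

variable {M : Type*} [MeasurableSpace M] (μ : Measure M)

/-- At each point `x` the terms are bounded by `B 2⁻ⁿ` uniformly in `θ`, so the sum and the integral
commute. The force is thus itself a power series in time. -/
lemma hasSum_avg [IsProbabilityMeasure μ] {r B Q t : ℝ} (hr : 0 ≤ r) (hB : 0 ≤ B) (hQ : 0 ≤ Q)
    (ht : |t| * Q ≤ 1 / 2) {u : M → ℕ → C(T3, ℝ)} (hu : ∀ θ, GeomBound r B Q (u θ))
    (hm : ∀ n x, Measurable fun θ => u θ n x) :
    avg μ (fun θ => ser (u θ) t) = ser (fun n => avg μ fun θ => u θ n) t := by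
  have hbn : ∀ n, 0 ≤ B * Q ^ n := fun n => by positivity
  have happ : ∀ θ x, HasSum (fun n => t ^ n * u θ n x) (ser (u θ) t x) := fun θ x => by
    simpa using! (ContinuousMap.evalCLM ℝ x).hasSum ((hu θ).hasSum hr hB hQ ht)
  have hms : ∀ x, Measurable fun θ => ser (u θ) t x := fun x => by
    refine measurable_of_tendsto_metrizable (f := fun N θ => ∑ n ∈ Finset.range N, t ^ n * u θ n x)
      (fun N => Finset.measurable_sum _ fun n _ => (hm n x).const_mul _)
      (tendsto_pi_nhds.2 fun θ => (happ θ x).tendsto_sum_nat)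
  have hg : GeomBound r B Q (fun n => avg μ fun θ => u θ n) := fun n =>
    wN_avg_le hr (hbn n) (hm n) fun θ => hu θ n
  ext x
  rw [avg_apply hr (by positivity) hms fun θ => (hu θ).wN_ser_le hr hB hQ ht]
  have h1 : HasSum (fun n => t ^ n * ∫ θ, u θ n x ∂μ) (ser (fun n => avg μ fun θ => u θ n) t x) := by
    have := (ContinuousMap.evalCLM ℝ x).hasSum (hg.hasSum hr hB hQ ht)
    refine this.congr_fun fun n => ?_
    simp [avg_apply hr (hbn n) (hm n) fun θ => hu θ n]
  rw [← h1.tsum_eq]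
  have hb : ∀ n θ, ‖t ^ n * u θ n x‖ ≤ B * (1 / 2) ^ n := fun n θ => by
    have := abs_apply_le hr (by positivity) ((hu θ).wN_term_le hB hQ ht n) x
    simpa using this
  have hint : ∀ n, Integrable (fun θ => t ^ n * u θ n x) μ := fun n =>
    (integrable_const _).mono' ((hm n x).const_mul _).aestronglyMeasurable (ae_of_all _ (hb n))
  have h2 := hasSum_integral_of_summable_integral_norm (F := fun n θ => t ^ n * u θ n x) (μ := μ) hint
    (Summable.of_nonneg_of_le (fun n => integral_nonneg fun _ => norm_nonneg _) (fun n => by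
      refine (integral_mono (hint n).norm (integrable_const _) (hb n)).trans ?_
      simp) (summable_geometric_two.mul_left B))
  simp only [integral_const_mul] at h2
  rw [h2.tsum_eq]
  exact integral_congr_ae (ae_of_all _ fun θ => (happ θ x).tsum_eq.symm)

lemma measurable_ser {r B Q t : ℝ} (hr : 0 ≤ r) (hB : 0 ≤ B) (hQ : 0 ≤ Q)
    (ht : |t| * Q ≤ 1 / 2) {u : M → ℕ → C(T3, ℝ)} (hu : ∀ θ, GeomBound r B Q (u θ))
    (hm : ∀ n x, Measurable fun θ => u θ n x) (x) : Measurable fun θ => ser (u θ) t x := by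
  have happ : ∀ θ x, HasSum (fun n => t ^ n * u θ n x) (ser (u θ) t x) := fun θ x => by
    simpa using! (ContinuousMap.evalCLM ℝ x).hasSum ((hu θ).hasSum hr hB hQ ht)
  exact measurable_of_tendsto_metrizable (f := fun N θ => ∑ n ∈ Finset.range N, t ^ n * u θ n x)
    (fun N => Finset.measurable_sum _ fun n _ => (hm n x).const_mul _)
    (tendsto_pi_nhds.2 fun θ => (happ θ x).tendsto_sum_nat)

section coeff

variable {r B Q : ℝ} {v0 : Coeff M}

lemma geomBound_avg [IsProbabilityMeasure μ] (hr : 0 < r) (hB : 0 ≤ B) (hQ : 0 < Q)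
    (hmd : ∀ n x, Measurable fun θ => (coeff μ v0 n).den θ x)
    (hd : ∀ θ, GeomBound r B Q fun n => (coeff μ v0 n).den θ) :
    GeomBound r B Q (fun n => avg μ (coeff μ v0 n).den) := fun n =>
  wN_avg_le hr.le (by positivity) (hmd n) fun θ => hd θ n

lemma hasSum_field [IsProbabilityMeasure μ] (hr : 0 < r) (hB : 0 ≤ B) (hQ : 0 < Q)
    (hmd : ∀ n x, Measurable fun θ => (coeff μ v0 n).den θ x)
    (hd : ∀ θ, GeomBound r B Q fun n => (coeff μ v0 n).den θ) {t : ℝ} (ht : |t| * Q ≤ 1 / 2) (j : Fin 3) :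
    HasSum (fun n => t ^ n • D j (pot (avg μ (coeff μ v0 n).den)))
      (D j (pot (avg μ fun θ => ser (fun n => (coeff μ v0 n).den θ) t))) := by
  have hga := geomBound_avg μ hr hB hQ hmd hd
  rw [hasSum_avg μ hr.le hB hQ.le ht hd hmd,
    D_pot_eq hr j (ne_top_of_le_ne_top ENNReal.ofReal_ne_top (hga.wN_ser_le hr.le hB hQ.le ht))]
  have := hga.hasSum_mult hr.le hB hQ.le ht (isRealSymbol_d_pot j) (symbolBound_d_pot j r) hr.le
  refine this.congr_fun fun n => ?_
  rw [← D_pot_eq hr j (ne_top_of_le_ne_top ENNReal.ofReal_ne_top (hga n))]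

lemma continuousAt_field [IsProbabilityMeasure μ] (hr : 0 < r) (hB : 0 ≤ B) (hQ : 0 < Q)
    (hmd : ∀ n x, Measurable fun θ => (coeff μ v0 n).den θ x)
    (hd : ∀ θ, GeomBound r B Q fun n => (coeff μ v0 n).den θ) {t : ℝ} (ht : |t| * Q < 1 / 2) (j : Fin 3) :
    ContinuousAt (fun s => D j (pot (avg μ fun θ => ser (fun n => (coeff μ v0 n).den θ) s))) t := by
  have hga := geomBound_avg μ hr hB hQ hmd hd
  have hG : GeomBound r B Q (fun n => D j (pot (avg μ (coeff μ v0 n).den))) := fun n =>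
    (wN_D_pot_le hr j (ne_top_of_le_ne_top ENNReal.ofReal_ne_top (hga n))).trans (hga n)
  have hev : ∀ᶠ s in 𝓝 t, |s| * Q < 1 / 2 :=
    (continuous_abs.mul continuous_const).continuousAt.eventually_lt continuousAt_const ht
  have h1 : ContinuousAt (ser (fun n => D j (pot (avg μ (coeff μ v0 n).den)))) t := by
    rw [ContinuousAt, tendsto_iff_edist_tendsto_0]
    refine tendsto_of_tendsto_of_tendsto_of_le_of_le tendsto_const_nhds
      (hG.tendsto_wN hr.le hB hQ ht) (fun _ => bot_le) fun s => ?_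
    simp only [edist_eq_enorm_sub]
    exact enorm_le_wN hr.le _
  refine h1.congr (hev.mono fun s hs => ?_)
  exact (hasSum_field μ hr hB hQ hmd hd hs.le j).tsum_eq

lemma hasDerivAt_den (hr : 0 < r) (hB : 0 ≤ B) (hQ : 0 < Q) {θ : M}
    (hd : GeomBound r B Q fun n => (coeff μ v0 n).den θ)
    (hm : ∀ j, GeomBound r B Q fun n => (coeff μ v0 n).mom θ j) {t : ℝ} (ht : |t| * Q < 1 / 2) :
    HasDerivAt (ser fun n => (coeff μ v0 n).den θ)
      (-∑ i, D i (ser (fun n => (coeff μ v0 n).mom θ i) t * ser (fun n => (coeff μ v0 n).den θ) t)) t := by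
  refine hd.hasDerivAt hr.le hB hQ ht ?_
  refine (hasSum_sum (s := Finset.univ) fun i _ =>
    hasSum_D_mul (hm i) hd hr hB hQ.le ht.le i).neg.congr_fun fun n => ?_
  rw [coeff_succ, nextCoeff]
  simp only [smul_neg]
  -- The factor `n + 1` of the differentiated series cancels the inverse in `nextCoeff`.
  rw [smul_inv_smul₀ (by positivity), Finset.sum_comm, Finset.smul_sum]
  simp only [Finset.smul_sum]

lemma hasDerivAt_mom [IsProbabilityMeasure μ] (hr : 0 < r) (hB : 0 ≤ B) (hQ : 0 < Q)
    (hmd : ∀ n x, Measurable fun θ => (coeff μ v0 n).den θ x)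
    (hd : ∀ θ, GeomBound r B Q fun n => (coeff μ v0 n).den θ) {θ : M}
    (hm : ∀ j, GeomBound r B Q fun n => (coeff μ v0 n).mom θ j) {t : ℝ} (ht : |t| * Q < 1 / 2) (j : Fin 3) :
    HasDerivAt (ser fun n => (coeff μ v0 n).mom θ j)
      (-(∑ i, ser (fun n => (coeff μ v0 n).mom θ i) t * D i (ser (fun n => (coeff μ v0 n).mom θ j) t)) -
        D j (pot (avg μ fun θ => ser (fun n => (coeff μ v0 n).den θ) t))) t := by
  refine (hm j).hasDerivAt hr.le hB hQ ht ?_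
  refine ((hasSum_sum (s := Finset.univ) fun i _ => hasSum_mul_D (hm i) (hm j) hr hB hQ.le ht.le i).neg.sub
    (hasSum_field μ hr hB hQ hmd hd ht.le j)).congr_fun fun n => ?_
  rw [coeff_succ, nextCoeff]
  simp only [smul_neg]
  rw [smul_inv_smul₀ (by positivity), smul_add, neg_add, ← sub_eq_add_neg]
  congr 2
  rw [Finset.sum_comm (s := Finset.univ), Finset.smul_sum]
  simp only [Finset.smul_sum]

lemma localSolution_coeff [IsProbabilityMeasure μ] (hr : 0 < r) (hB : 0 ≤ B) (hQ : 0 < Q)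
    (hmd : ∀ n x, Measurable fun θ => (coeff μ v0 n).den θ x)
    (hmm : ∀ n j x, Measurable fun θ => (coeff μ v0 n).mom θ j x)
    (hd : ∀ θ, GeomBound r B Q fun n => (coeff μ v0 n).den θ)
    (hm : ∀ θ j, GeomBound r B Q fun n => (coeff μ v0 n).mom θ j) :
    LocalSolution μ (2 * Q)⁻¹ r (B * 2) (fun θ => ser fun n => (coeff μ v0 n).den θ)
      (fun θ t j => ser (fun n => (coeff μ v0 n).mom θ j) t) := by
  have hτ : ∀ t, |t| < (2 * Q)⁻¹ → |t| * Q < 1 / 2 := fun t ht => by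
    have := mul_lt_mul_of_pos_right ht hQ
    rwa [mul_inv, mul_assoc, inv_mul_cancel₀ hQ.ne', mul_one, ← one_div] at this
  exact
  { r_pos := hr
    C_nonneg := by positivity
    meas_den := fun t ht => measurable_ser hr.le hB hQ.le (hτ t ht).le hd hmd
    meas_mom := fun t ht j => measurable_ser hr.le hB hQ.le (hτ t ht).le (hm · j) (hmm · j)
    bound_den := fun θ t ht => (hd θ).wN_ser_le hr.le hB hQ.le (hτ t ht).le
    bound_mom := fun θ t ht j => (hm θ j).wN_ser_le hr.le hB hQ.le (hτ t ht).le
    tendsto_den := fun θ t ht => (hd θ).tendsto_wN hr.le hB hQ (hτ t ht)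
    tendsto_mom := fun θ t ht j => (hm θ j).tendsto_wN hr.le hB hQ (hτ t ht)
    deriv_den := fun θ t ht => hasDerivAt_den μ hr hB hQ (hd θ) (hm θ) (hτ t ht)
    deriv_mom := fun θ t ht j => hasDerivAt_mom μ hr hB hQ hmd hd (hm θ) (hτ t ht) j
    continuous_field := fun t ht j => continuousAt_field μ hr hB hQ hmd hd (hτ t ht) j }

end coeff

theorem exists_localSolution [IsProbabilityMeasure μ] {r₁ r₀ C₀ : ℝ} (hr₁ : 0 < r₁) (hr : r₁ < r₀)
    (hC : 0 < C₀) {ρ0 : M → C(T3, ℝ)} {ξ0 : M → Fin 3 → C(T3, ℝ)}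
    (hρ_meas : ∀ x, Measurable fun θ => ρ0 θ x) (hξ_meas : ∀ j x, Measurable fun θ => ξ0 θ j x)
    (hρ : ∀ θ, wN r₀ (ρ0 θ) ≤ ENNReal.ofReal C₀)
    (hξ : ∀ θ j, wN r₀ (ξ0 θ j) ≤ ENNReal.ofReal C₀) :
    ∃ τ > 0, ∃ C, ∃ (ρ : M → ℝ → C(T3, ℝ)) (ξ : M → ℝ → Fin 3 → C(T3, ℝ)),
      LocalSolution μ τ r₁ C ρ ξ ∧ (∀ θ, ρ θ 0 = ρ0 θ) ∧ ∀ θ, ξ θ 0 = ξ0 θ := by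
  have hr₀ := hr₁.trans hr
  -- The smallest value allowed by `coeffBound_succ`; `Q` below is the geometric ratio of
  -- `coeffBound_le`.
  set R : ℝ := 12 * Real.pi * Real.exp 1 * C₀ + r₀ with hR
  have hRp : 0 < R := by have := Real.pi_pos; have := Real.exp_pos 1; positivity
  set Q := 4 * R * (r₀ - r₁)⁻¹
  have hQ : 0 < Q := by have := sub_pos.2 hr; positivity
  set v0 : Coeff M := ⟨ρ0, ξ0⟩
  have hb := coeff_bounds μ hC.le hr₀ hR.symm.le (v0 := v0) hρ_meas hξ_meas hρ hξ
  refine ⟨(2 * Q)⁻¹, by positivity, C₀ * 2, _, _, localSolution_coeff μ hr₁ hC.le hQ (v0 := v0)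
    (fun n => (hb n).1) (fun n => (hb n).2.1)
    (fun θ n => ((hb n).2.2 r₁ hr₁ hr θ).1.trans
      (ENNReal.ofReal_le_ofReal (coeffBound_le hC.le hRp.le hr n)))
    (fun θ j n => (((hb n).2.2 r₁ hr₁ hr θ).2 j).trans
      (ENNReal.ofReal_le_ofReal (coeffBound_le hC.le hRp.le hr n))), fun θ => ?_, fun θ => ?_⟩
  · rw [ser_zero, coeff_zero]
  · ext1 j; rw [ser_zero, coeff_zero]

/-! ### The local solution is a classical solution -/

lemma D_mul_apply {r : ℝ} (hr : 0 < r) {f g : C(T3, ℝ)} (hf : wN r f ≠ ⊤) (hg : wN r g ≠ ⊤)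
    (i : Fin 3) (x : T3) : D i (f * g) x = D i f x * g x + f x * D i g x := by
  have h1 := (hasDerivAt_coord_D hr hf i x).mul (hasDerivAt_coord_D hr hg i x)
  have h2 := hasDerivAt_coord_D hr
    (ne_top_of_le_ne_top (ENNReal.mul_ne_top hf hg) (wN_mul_le hr.le f g)) i x
  simpa using h2.unique h1

/-! ### Propagation of nonnegativity. -/

/-- Only earlier times are used, since a minimum over `[0,T]` may sit at the endpoint `T`. -/
lemma exists_lt_of_deriv_pos {f : ℝ → ℝ} {f' a t : ℝ} (h : HasDerivAt f f' t) (hf : 0 < f') (ha : a < t) :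
    ∃ s ∈ Ioo a t, f s < f t := by
  have h1 : ∀ᶠ s in 𝓝[<] t, 0 < slope f t s := ((hasDerivAt_iff_tendsto_slope.1 h).mono_left
    (nhdsWithin_mono t fun s hs => ne_of_lt hs)).eventually_const_lt hf
  obtain ⟨s, hs, hs'⟩ := (h1.and (Ioo_mem_nhdsLT ha)).exists
  refine ⟨s, hs', ?_⟩
  rw [slope_def_field, div_pos_iff] at hs
  rcases hs with hs | hs
  · linarith [hs'.2]
  · linarith

/-- The minimum principle for transport equations on the torus. -/
lemma nonneg_of_transport {T L : ℝ} {ρ : ℝ → C(T3, ℝ)} {b : ℝ → Fin 3 → T3 → ℝ} {c : ℝ → T3 → ℝ}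
    {r : ℝ} (hr : 0 < r) (hw : ∀ t ∈ Icc 0 T, wN r (ρ t) ≠ ⊤) (hc : ∀ t ∈ Icc 0 T, ∀ x, -L < c t x)
    (hρ : ContinuousOn ρ (Icc 0 T)) (h0 : ∀ x, 0 ≤ ρ 0 x)
    (hd : ∀ t ∈ Icc 0 T, ∀ x, HasDerivAt (fun s => ρ s x)
      (-(∑ i, b t i x * D i (ρ t) x) - c t x * ρ t x) t) :
    ∀ t ∈ Icc 0 T, ∀ x, 0 ≤ ρ t x := by
  intro t ht x
  -- The exponential factor replaces the zero-order coefficient `c` by `L + c > 0`.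
  set w : ℝ × T3 → ℝ := fun p => Real.exp (-(L * p.1)) * ρ p.1 p.2 with hw'
  have hcont : ContinuousOn w (Icc 0 T ×ˢ univ) := by
    refine ContinuousOn.mul (by fun_prop) ?_
    have h1 : ContinuousOn (fun p : ℝ × T3 => (ρ p.1, p.2)) (Icc 0 T ×ˢ univ) :=
      (hρ.comp continuousOn_fst fun p hp => hp.1).prodMk continuousOn_snd
    exact ContinuousEval.continuous_eval.comp_continuousOn h1
  obtain ⟨⟨s, y⟩, ⟨(hs : s ∈ Icc 0 T), -⟩, hmin⟩ := (isCompact_Icc.prod isCompact_univ).exists_isMinOn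
    ⟨(t, x), ht, mem_univ x⟩ hcont
  have hmin' : ∀ s' ∈ Icc 0 T, ∀ y', w (s, y) ≤ w (s', y') := fun s' hs' y' =>
    hmin (a := (s', y')) ⟨hs', mem_univ _⟩
  by_contra hneg
  push Not at hneg
  have hwneg : w (s, y) < 0 := (hmin' t ht x).trans_lt
    (mul_neg_of_pos_of_neg (Real.exp_pos _) hneg)
  have hρneg : ρ s y < 0 := by
    by_contra h
    exact absurd hwneg (not_lt.2 (mul_nonneg (Real.exp_pos _).le (not_lt.1 h)))
  have hs0 : 0 < s := by
    rcases hs.1.eq_or_lt with h | h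
    · rw [← h] at hρneg
      exact absurd hρneg (not_lt.2 (h0 y))
    · exact h
  -- At a spatial minimum the gradient vanishes and the transport term drops out.
  have hD : ∀ i, D i (ρ s) y = 0 := fun i => by
    refine IsLocalMin.hasDerivAt_eq_zero (Eventually.of_forall fun a => ?_)
      (hasDerivAt_coord_D hr (hw s hs) i y)
    have := hmin' s hs (y + Pi.single i (a : UnitAddCircle))
    simpa [hw'] using le_of_mul_le_mul_left this (Real.exp_pos _)
  have h1 := hd s hs y
  simp only [hD, mul_zero, Finset.sum_const_zero, neg_zero, zero_sub] at h1
  have h2 : HasDerivAt (fun a : ℝ => Real.exp (-(L * a))) (Real.exp (-(L * s)) * (-L)) s := by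
    have := ((hasDerivAt_id s).const_mul L).neg.exp
    simpa using this
  have h3 : HasDerivAt (fun a => w (a, y)) (Real.exp (-(L * s)) * -((L + c s y) * ρ s y)) s := by
    refine (h2.mul h1).congr_deriv ?_
    ring
  -- At a negative minimum `w` increases in time, so it was smaller just before: a contradiction.
  have h4 : 0 < Real.exp (-(L * s)) * -((L + c s y) * ρ s y) := by
    refine mul_pos (Real.exp_pos _) (neg_pos.2 (mul_neg_of_pos_of_neg ?_ hρneg))
    linarith [hc s hs y]
  obtain ⟨a, ha, hlt⟩ := exists_lt_of_deriv_pos h3 h4 hs0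
  exact absurd hlt (not_lt.2 (hmin' a ⟨ha.1.le, ha.2.le.trans hs.2⟩ y))

namespace LocalSolution

variable {M : Type*} [MeasurableSpace M] {μ : Measure M} {τ r C : ℝ}
  {ρ : M → ℝ → C(T3, ℝ)} {ξ : M → ℝ → Fin 3 → C(T3, ℝ)}

section

variable (h : LocalSolution μ τ r C ρ ξ)
include h

lemma den_ne_top (θ) {t : ℝ} (ht : |t| < τ) : wN r (ρ θ t) ≠ ⊤ :=
  ne_top_of_le_ne_top ENNReal.ofReal_ne_top (h.bound_den θ t ht)

lemma mom_ne_top (θ) {t : ℝ} (ht : |t| < τ) (j) : wN r (ξ θ t j) ≠ ⊤ :=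
  ne_top_of_le_ne_top ENNReal.ofReal_ne_top (h.bound_mom θ t ht j)

lemma mul_ne_top (θ) {t : ℝ} (ht : |t| < τ) (i) : wN r (ξ θ t i * ρ θ t) ≠ ⊤ :=
  ne_top_of_le_ne_top (ENNReal.mul_ne_top (h.mom_ne_top θ ht i) (h.den_ne_top θ ht))
    (wN_mul_le h.r_pos.le _ _)

lemma deriv_den_apply (θ) {t : ℝ} (ht : |t| < τ) (x : T3) :
    HasDerivAt (fun s => ρ θ s x) (-∑ i, D i (ξ θ t i * ρ θ t) x) t := by
  have := (ContinuousMap.evalCLM ℝ x).hasFDerivAt.comp_hasDerivAt t (h.deriv_den θ t ht)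
  refine this.congr_deriv ?_
  simp

lemma deriv_mom_apply (θ) {t : ℝ} (ht : |t| < τ) (j : Fin 3) (x : T3) :
    HasDerivAt (fun s => ξ θ s j x)
      (-(∑ i, ξ θ t i x * D i (ξ θ t j) x) - D j (pot (avg μ fun θ => ρ θ t)) x) t := by
  have := (ContinuousMap.evalCLM ℝ x).hasFDerivAt.comp_hasDerivAt t (h.deriv_mom θ t ht j)
  refine this.congr_deriv ?_
  simp

/-- The mass is the zero Fourier mode, and the symbol of a derivative vanishes there. -/
lemma integral_den (θ) {t : ℝ} (ht : |t| < τ) :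
    ∫ x, ρ θ t x ∂torusMeasure = ∫ x, ρ θ 0 x ∂torusMeasure := by
  have hτ : 0 < τ := (abs_nonneg t).trans_lt ht
  have hd : ∀ s ∈ Metric.ball (0 : ℝ) τ, HasDerivAt (fun s => hatCLM 0 (ρ θ s)) 0 s := fun s hs => by
    have hs' : |s| < τ := by simpa using hs
    have := (hatCLM 0).hasFDerivAt.comp_hasDerivAt s (h.deriv_den θ s hs')
    refine this.congr_deriv ?_
    rw [map_neg, map_sum, neg_eq_zero]
    refine Finset.sum_eq_zero fun i _ => ?_
    rw [hatCLM_apply, hat_D h.r_pos i (h.mul_ne_top θ hs' i)]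
    simp [dSymbol]
  have h1 := Metric.isOpen_ball.is_const_of_deriv_eq_zero (convex_ball (0 : ℝ) τ).isPreconnected
    (fun s hs => (hd s hs).differentiableAt.differentiableWithinAt) (fun s hs => (hd s hs).deriv)
    (x := t) (y := 0) (by simpa using ht) (by simpa using hτ)
  simp only [hatCLM_apply, hat_zero] at h1
  exact_mod_cast h1

lemma nonneg {T : ℝ} (hT : T < τ) {θ : M} (h0 : ∀ x, 0 ≤ ρ θ 0 x) :
    ∀ t ∈ Icc 0 T, ∀ x, 0 ≤ ρ θ t x := by
  have ht : ∀ t ∈ Icc 0 T, |t| < τ := fun t ht => by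
    rw [abs_of_nonneg ht.1]; exact ht.2.trans_lt hT
  have hr2 := half_pos h.r_pos
  set K : ℝ := 2 * Real.pi / (r - r / 2) * C
  have hK : 0 ≤ K := mul_nonneg (div_nonneg Real.two_pi_pos.le (by linarith)) h.C_nonneg
  -- The zero-order coefficient is the divergence of `ξ θ t`, a sum of three terms bounded by `K`.
  refine nonneg_of_transport (L := 3 * K + 1) (b := fun t i => ξ θ t i)
    (c := fun t x => ∑ i, D i (ξ θ t i) x) h.r_pos (fun t ht' => h.den_ne_top θ (ht t ht'))
    (fun t ht' x => ?_) (fun t ht' => (h.deriv_den θ t (ht t ht')).continuousAt.continuousWithinAt) h0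
    fun t ht' x => ?_
  · have h1 : ∀ i, |D i (ξ θ t i) x| ≤ K := fun i => by
      refine abs_apply_le hr2.le hK ?_ x
      refine (wN_D_le hr2.le (half_lt_self h.r_pos) i (h.mom_ne_top θ (ht t ht') i)).trans ?_
      rw [ENNReal.ofReal_mul (div_nonneg Real.two_pi_pos.le (by linarith))]
      gcongr
      exact h.bound_mom θ t (ht t ht') i
    have h2 : ∑ i : Fin 3, -K ≤ ∑ i, D i (ξ θ t i) x :=
      Finset.sum_le_sum fun i _ => (abs_le.1 (h1 i)).1
    rw [Finset.sum_const, Finset.card_univ, Fintype.card_fin, nsmul_eq_mul] at h2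
    push_cast at h2
    linarith
  · refine (h.deriv_den_apply θ (ht t ht') x).congr_deriv ?_
    simp only [D_mul_apply h.r_pos (h.mom_ne_top θ (ht t ht') _) (h.den_ne_top θ (ht t ht')),
      Finset.sum_add_distrib, Finset.sum_mul]
    ring

variable [IsProbabilityMeasure μ]

lemma avg_ne_top {t : ℝ} (ht : |t| < τ) : wN r (avg μ fun θ => ρ θ t) ≠ ⊤ :=
  ne_top_of_le_ne_top ENNReal.ofReal_ne_top
    (wN_avg_le h.r_pos.le h.C_nonneg (h.meas_den t ht) fun θ => h.bound_den θ t ht)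

lemma pot_ne_top {t : ℝ} (ht : |t| < τ) : wN r (pot (avg μ fun θ => ρ θ t)) ≠ ⊤ :=
  ne_top_of_le_ne_top (h.avg_ne_top ht) (wN_pot_le h.r_pos.le (h.avg_ne_top ht))

lemma avg_den_apply {t : ℝ} (ht : |t| < τ) (x : T3) :
    avg μ (fun θ => ρ θ t) x = ∫ θ, ρ θ t x ∂μ :=
  avg_apply h.r_pos.le h.C_nonneg (h.meas_den t ht) (fun θ => h.bound_den θ t ht) x

lemma integral_avg {t : ℝ} (ht : |t| < τ) (hmass : ∫ θ, ∫ x, ρ θ 0 x ∂torusMeasure ∂μ = 1) :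
    ∫ x, avg μ (fun θ => ρ θ t) x ∂torusMeasure = 1 := by
  simp only [h.avg_den_apply ht]
  refine Eq.trans ?_ hmass
  rw [← integral_integral_swap
    (integrable_uncurry_family h.r_pos.le h.C_nonneg (h.meas_den t ht) fun θ => h.bound_den θ t ht)]
  exact integral_congr_ae (ae_of_all _ fun θ => h.integral_den θ ht)

theorem isMultifluidSolution {T : ℝ} (hT : T < τ) (hmass : ∫ θ, ∫ x, ρ θ 0 x ∂torusMeasure ∂μ = 1) :
    IsMultifluidSolution μ T (fun θ => ρ θ 0) (fun θ => ξ θ 0) ρ ξ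
      fun t => pot (avg μ fun θ => ρ θ t) := by
  have ht : ∀ t ∈ Icc 0 T, |t| < τ := fun t ht => by
    rw [abs_of_nonneg ht.1]; exact ht.2.trans_lt hT
  exact
  { measurable_density := fun t ht' => h.meas_den t (ht t ht')
    measurable_momentum := fun t ht' => h.meas_mom t (ht t ht')
    integrable_density := fun t ht' => integrable_family h.r_pos.le h.C_nonneg
      (h.meas_den t (ht t ht')) fun θ => h.bound_den θ t (ht t ht')
    contDiff_density := fun θ t ht' => by
      exact_mod_cast torusContDiff (n := 1) h.r_pos (h.den_ne_top θ (ht t ht'))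
    contDiff_momentum := fun θ t ht' j => by
      exact_mod_cast torusContDiff (n := 1) h.r_pos (h.mom_ne_top θ (ht t ht') j)
    contDiff_potential := fun t ht' => by
      exact_mod_cast torusContDiff (n := 2) h.r_pos (h.pot_ne_top (ht t ht'))
    continuity := fun θ t ht' x => by
      refine ((h.deriv_den_apply θ (ht t ht') x).congr_deriv ?_).hasDerivWithinAt
      congr 1
      refine Finset.sum_congr rfl fun i _ => ?_
      rw [← torusPartial_eq_D h.r_pos (h.mul_ne_top θ (ht t ht') i)]
      rfl
    momentum := fun θ t ht' j x => by
      refine ((h.deriv_mom_apply θ (ht t ht') j x).congr_deriv ?_).hasDerivWithinAt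
      simp only [torusPartial_eq_D h.r_pos (h.mom_ne_top θ (ht t ht') j),
        torusPartial_eq_D h.r_pos (h.pot_ne_top (ht t ht'))]
    poisson := fun t ht' x => by
      rw [torusLaplacian_pot h.r_pos (h.avg_ne_top (ht t ht')), h.integral_avg (ht t ht') hmass,
        h.avg_den_apply (ht t ht')]
    initial_density := fun _ => rfl
    initial_momentum := fun _ => rfl }

end

end LocalSolution

/-! ### Functions on phase space and their lifts -/

/-- The lift to `ℝ × ℝ³ × ℝ³` of a function of time, position and momentum. -/
def phaseLift (Ψ : ℝ → T3 → R3 → ℝ) (p : ℝ × (Fin 3 → ℝ) × R3) : ℝ := Ψ p.1 (torusProj p.2.1) p.2.2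

/-- The transport operator `∂ₜ + ξ·∇ₓ + E·∇_ξ`. -/
def transportOp (E : T3 → R3) (Ψ : ℝ → T3 → R3 → ℝ) (t : ℝ) (x : T3) (v : R3) : ℝ :=
  deriv (fun s => Ψ s x v) t + ∑ i, v i * torusPartial i (fun y => Ψ t y v) x
    + fderiv ℝ (Ψ t x) v (E x)

/-- One directional derivative of the lift replaces the three partial ones, which makes the chain
rule and the bounds linear algebra. -/
lemma transportOp_eq {E : T3 → R3} {Ψ : ℝ → T3 → R3 → ℝ} (hΨ : ContDiff ℝ 1 (phaseLift Ψ))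
    (t : ℝ) (w : Fin 3 → ℝ) (v : R3) : transportOp E Ψ t (torusProj w) v =
      fderiv ℝ (phaseLift Ψ) (t, w, v) (1, fun i => v i, E (torusProj w)) := by
  have hL := ((hΨ.differentiable one_ne_zero) (t, w, v)).hasFDerivAt
  set L := fderiv ℝ (phaseLift Ψ) (t, w, v)
  have h1 : HasDerivAt (fun s => Ψ s (torusProj w) v) (L (1, 0, 0)) t := by
    have h0 : HasDerivAt (fun s => (s, w, v)) ((1 : ℝ), (0 : Fin 3 → ℝ), (0 : R3)) t :=
      (hasDerivAt_id t).prodMk (hasDerivAt_const t (w, v))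
    exact HasFDerivAt.comp_hasDerivAt (l := phaseLift Ψ) t hL h0
  have h2 : HasFDerivAt (fun y => Ψ t (torusProj y) v)
      (L.comp ((ContinuousLinearMap.inr ℝ ℝ ((Fin 3 → ℝ) × R3)).comp
        (ContinuousLinearMap.inl ℝ (Fin 3 → ℝ) R3))) w :=
    HasFDerivAt.comp (g := phaseLift Ψ) (f := fun y => (t, y, v)) w hL
      (HasFDerivAt.comp (g := fun z => (t, z)) (f := fun y => (y, v)) w
        (hasFDerivAt_prodMk_right t (w, v)) (hasFDerivAt_prodMk_left w v))
  have h3 : HasFDerivAt (Ψ t (torusProj w))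
      (L.comp ((ContinuousLinearMap.inr ℝ ℝ ((Fin 3 → ℝ) × R3)).comp
        (ContinuousLinearMap.inr ℝ (Fin 3 → ℝ) R3))) v :=
    HasFDerivAt.comp (g := phaseLift Ψ) (f := fun u => (t, w, u)) v hL
      (HasFDerivAt.comp (g := fun z => (t, z)) (f := fun u => (w, u)) v
        (hasFDerivAt_prodMk_right t (w, v)) (hasFDerivAt_prodMk_right w v))
  rw [transportOp, h1.deriv, h3.fderiv]
  simp only [torusPartial_eq (g := fun y => Ψ t y v) h2]
  have h4 : ((1 : ℝ), (fun i => v i : Fin 3 → ℝ), E (torusProj w)) =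
      (1, 0, 0) + ∑ i, v i • ((0 : ℝ), (Pi.single i (1 : ℝ) : Fin 3 → ℝ), (0 : R3)) +
        (0, 0, E (torusProj w)) := by
    ext j
    · simp [Prod.fst_sum]
    · simp [Prod.snd_sum, Prod.fst_sum, Finset.sum_apply, Pi.single_apply]
    · simp [Prod.snd_sum]
  rw [h4, map_add, map_add, map_sum]
  simp only [map_smul, smul_eq_mul, ContinuousLinearMap.comp_apply, ContinuousLinearMap.inr_apply,
    ContinuousLinearMap.inl_apply]

lemma continuous_of_phaseLift {F : ℝ → T3 → R3 → ℝ} (h : Continuous (phaseLift F)) :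
    Continuous fun p : ℝ × T3 × R3 => F p.1 p.2.1 p.2.2 := by
  have hq : IsOpenQuotientMap (Prod.map (id : ℝ → ℝ) (Prod.map torusProj (id : R3 → R3))) :=
    IsOpenQuotientMap.id.prodMap (isOpenQuotientMap_torusProj.prodMap IsOpenQuotientMap.id)
  exact hq.isQuotientMap.continuous_iff.2 h

lemma continuous_transportOp {E : T3 → R3} (hE : Continuous E) {Ψ : ℝ → T3 → R3 → ℝ}
    (hΨ : ContDiff ℝ 1 (phaseLift Ψ)) :
    Continuous fun p : ℝ × T3 × R3 => transportOp E Ψ p.1 p.2.1 p.2.2 := by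
  refine continuous_of_phaseLift ?_
  have h1 : phaseLift (transportOp E Ψ) = fun p =>
      fderiv ℝ (phaseLift Ψ) p (1, fun i => p.2.2 i, E (torusProj p.2.1)) :=
    funext fun p => transportOp_eq hΨ p.1 p.2.1 p.2.2
  rw [h1]
  have h2 := hΨ.continuous_fderiv one_ne_zero
  have h3 := hE.comp continuous_torusProj
  refine h2.clm_apply (continuous_const.prodMk (Continuous.prodMk ?_ ?_))
  · fun_prop
  · exact h3.comp (continuous_fst.comp continuous_snd)

lemma exists_phaseLift_bound {Ψ : ℝ → T3 → R3 → ℝ} (hΨ : ContDiff ℝ 1 (phaseLift Ψ)) (t₁ R : ℝ) :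
    ∃ K, 0 ≤ K ∧ ∀ t w v, |t| ≤ t₁ → w ∈ Icc (0 : Fin 3 → ℝ) 1 → ‖v‖ ≤ R →
      |Ψ t (torusProj w) v| ≤ K ∧ ‖fderiv ℝ (phaseLift Ψ) (t, w, v)‖ ≤ K := by
  -- Every point of the torus has a representative in the unit cube, so bounds on this compact set
  -- are enough.
  have hK : IsCompact (Icc (-t₁) t₁ ×ˢ Icc (0 : Fin 3 → ℝ) 1 ×ˢ Metric.closedBall (0 : R3) R) :=
    isCompact_Icc.prod (isCompact_Icc.prod (isCompact_closedBall _ _))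
  obtain ⟨K₁, h₁⟩ := hK.exists_bound_of_continuousOn hΨ.continuous.continuousOn
  obtain ⟨K₂, h₂⟩ := hK.exists_bound_of_continuousOn (hΨ.continuous_fderiv one_ne_zero).continuousOn
  refine ⟨max 0 (max K₁ K₂), le_max_left _ _, fun t w v ht hw hv => ?_⟩
  have hm : (t, w, v) ∈ Icc (-t₁) t₁ ×ˢ Icc (0 : Fin 3 → ℝ) 1 ×ˢ Metric.closedBall (0 : R3) R :=
    ⟨abs_le.1 ht, hw, by simpa using hv⟩
  exact ⟨(h₁ _ hm).trans ((le_max_left _ _).trans (le_max_right _ _)),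
    (h₂ _ hm).trans ((le_max_right _ _).trans (le_max_right _ _))⟩

lemma hasDerivAt_toLp {f : Fin 3 → ℝ → ℝ} {f' : Fin 3 → ℝ} {t : ℝ} (h : ∀ j, HasDerivAt (f j) (f' j) t) :
    HasDerivAt (fun s => (WithLp.toLp 2 fun j => f j s : R3)) (WithLp.toLp 2 f') t := by
  have h1 : HasDerivAt (fun s j => f j s) f' t := hasDerivAt_pi.2 h
  exact (PiLp.continuousLinearEquiv 2 ℝ (fun _ : Fin 3 => ℝ)).symm.hasFDerivAt.comp_hasDerivAt t h1

lemma norm_toLp_le {C : ℝ} (hC : 0 ≤ C) {a : Fin 3 → ℝ} (h : ∀ j, |a j| ≤ C) :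
    ‖(WithLp.toLp 2 a : R3)‖ ≤ 3 * C := by
  rw [EuclideanSpace.norm_eq]
  refine Real.sqrt_le_iff.2 ⟨by positivity, ?_⟩
  have h1 : ∀ j, ‖a j‖ ^ 2 ≤ C ^ 2 := fun j => by
    rw [Real.norm_eq_abs]; exact pow_le_pow_left₀ (abs_nonneg _) (h j) 2
  refine (Finset.sum_le_sum fun j _ => h1 j).trans ?_
  simp only [Finset.sum_const, Finset.card_univ, Fintype.card_fin, nsmul_eq_mul]
  push_cast
  nlinarith [sq_nonneg C]

/-! ### Integration by parts on the torus -/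

instance : Measure.IsAddHaarMeasure torusMeasure := by
  unfold torusMeasure; infer_instance

section parts

variable {M : Type*} [MeasurableSpace M] {μ : Measure M} [IsProbabilityMeasure μ]

/-- Translation in `x` preserves the measure, so the integral of the translates is constant in `s`;
differentiating under the integral sign gives zero. -/
lemma integral_coord_deriv_eq_zero {G G' : M × T3 → ℝ} {K : ℝ} (hG : Measurable G)
    (hGb : ∀ p, |G p| ≤ K) (hG' : ∀ p, |G' p| ≤ K) (i : Fin 3)
    (hd : ∀ p : M × T3, HasDerivAt (fun s : ℝ => G (p.1, p.2 + Pi.single i (s : UnitAddCircle))) (G' p) 0) :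
    Integrable G' (μ.prod torusMeasure) ∧ ∫ p, G' p ∂(μ.prod torusMeasure) = 0 := by
  set sh : ℝ → M × T3 → M × T3 := fun s p => (p.1, p.2 + Pi.single i (s : UnitAddCircle))
  have hshm : ∀ s, Measurable (sh s) := fun s =>
    measurable_fst.prodMk (measurable_snd.add_const _)
  have hmp : ∀ s, MeasurePreserving (sh s) (μ.prod torusMeasure) (μ.prod torusMeasure) := fun s =>
    (MeasurePreserving.id μ).prod (measurePreserving_add_right torusMeasure _)
  have hsh : ∀ s a p, sh (s + a) p = sh a (sh s p) := fun s a p => by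
    simp only [sh]
    rw [add_assoc, ← Pi.single_add, AddCircle.coe_add]
  have hd' : ∀ p s, HasDerivAt (fun a => G (sh a p)) (G' (sh s p)) s := fun p s => by
    have h1 : HasDerivAt (fun a => G (sh a (sh s p))) (G' (sh s p)) (s - s) := by
      rw [sub_self]; exact hd (sh s p)
    have h2 := HasDerivAt.comp_sub_const s s h1
    refine h2.congr_of_eventuallyEq (Eventually.of_forall fun a => ?_)
    simp only [← hsh, add_sub_cancel]
  have hGm : Measurable G' := by
    refine measurable_of_hasDerivAt (t := 0) (F := fun s p => G (sh s p)) (fun s => hG.comp (hshm s)) ?_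
    exact hd
  have key := hasDerivAt_integral_of_dominated_loc_of_deriv_le (μ := μ.prod torusMeasure)
    (F := fun s p => G (sh s p)) (F' := fun s p => G' (sh s p)) (x₀ := (0 : ℝ)) (s := univ)
    (bound := fun _ => K) univ_mem
    (Eventually.of_forall fun s => (hG.comp (hshm s)).aestronglyMeasurable)
    ((integrable_const K).mono' (hG.comp (hshm 0)).aestronglyMeasurable (ae_of_all _ fun p => hGb _))
    (hGm.comp (hshm 0)).aestronglyMeasurable (ae_of_all _ fun p s _ => hG' _) (integrable_const K)
    (ae_of_all _ fun p s _ => hd' p s)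
  have h0 : sh 0 = id := by ext p : 1; simp [sh]
  refine ⟨(integrable_const K).mono' hGm.aestronglyMeasurable (ae_of_all _ fun p => hG' p), ?_⟩
  have hc : (fun s => ∫ p, G (sh s p) ∂(μ.prod torusMeasure)) = fun _ => ∫ p, G p ∂(μ.prod torusMeasure) := by
    ext s
    have h1 := (hmp s).map_eq
    have h2 := integral_map (μ := μ.prod torusMeasure) (hshm s).aemeasurable
      (f := G) hG.aestronglyMeasurable
    rw [h1] at h2
    exact h2.symm
  have h3 := key.2
  rw [hc] at h3
  have := h3.unique (hasDerivAt_const _ _)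
  simpa [h0] using this

end parts

/-! ### The transport identity -/

/-- The momentum of the fluid `θ` as a vector. -/
def momVec {M : Type*} (ξ : M → ℝ → Fin 3 → C(T3, ℝ)) (t : ℝ) (p : M × T3) : R3 :=
  WithLp.toLp 2 fun j => ξ p.1 t j p.2

/-- The force field `-∇φ` produced by the densities `ρ`. -/
def fieldVec {M : Type*} [MeasurableSpace M] (μ : Measure M) (ρ : M → ℝ → C(T3, ℝ)) (t : ℝ) (x : T3) : R3 :=
  WithLp.toLp 2 fun j => -D j (pot (avg μ fun θ => ρ θ t)) x

lemma continuous_fieldVec {M : Type*} [MeasurableSpace M] (μ : Measure M) (ρ : M → ℝ → C(T3, ℝ)) (t : ℝ) :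
    Continuous (fieldVec μ ρ t) := by
  unfold fieldVec; fun_prop

namespace LocalSolution

variable {M : Type*} [MeasurableSpace M] {μ : Measure M} {τ r C : ℝ}
  {ρ : M → ℝ → C(T3, ℝ)} {ξ : M → ℝ → Fin 3 → C(T3, ℝ)}

section

variable (h : LocalSolution μ τ r C ρ ξ)
include h

lemma abs_den_le (θ) {t : ℝ} (ht : |t| < τ) (x) : |ρ θ t x| ≤ C :=
  abs_apply_le h.r_pos.le h.C_nonneg (h.bound_den θ t ht) x

lemma abs_mom_le (θ) {t : ℝ} (ht : |t| < τ) (j x) : |ξ θ t j x| ≤ C :=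
  abs_apply_le h.r_pos.le h.C_nonneg (h.bound_mom θ t ht j) x

lemma norm_momVec_le {t : ℝ} (ht : |t| < τ) (p : M × T3) : ‖momVec ξ t p‖ ≤ 3 * C :=
  norm_toLp_le h.C_nonneg fun j => h.abs_mom_le p.1 ht j p.2

lemma measurable_den {t : ℝ} (ht : |t| < τ) : Measurable fun p : M × T3 => ρ p.1 t p.2 :=
  measurable_uncurry_family (h.meas_den t ht)

lemma measurable_momVec {t : ℝ} (ht : |t| < τ) : Measurable (momVec ξ t) := by
  refine (WithLp.measurable_toLp 2 _).comp (measurable_pi_lambda _ fun j => ?_)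
  exact measurable_uncurry_family (g := fun θ => ξ θ t j) (h.meas_mom t ht j)

/-- Bound for `∂ᵢ ξⱼ` and `∂ᵢ (ξᵢ ρ)`. -/
def derivBound (r C : ℝ) : ℝ := 2 * Real.pi / (r - r / 2) * (C + C * C)

omit h in
lemma derivBound_nonneg (hr : 0 < r) (hC : 0 ≤ C) : 0 ≤ derivBound r C :=
  mul_nonneg (div_nonneg Real.two_pi_pos.le (by linarith)) (by positivity)

omit h in
lemma abs_D_le (hr : 0 < r) (hC : 0 ≤ C) {g : C(T3, ℝ)} (hg : wN r g ≤ ENNReal.ofReal (C + C * C)) (i x) :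
    |D i g x| ≤ derivBound r C := by
  have hr2 := half_pos hr
  refine abs_apply_le hr2.le (derivBound_nonneg hr hC) ?_ x
  refine (wN_D_le hr2.le (half_lt_self hr) i (ne_top_of_le_ne_top ENNReal.ofReal_ne_top hg)).trans ?_
  rw [derivBound, ENNReal.ofReal_mul (div_nonneg Real.two_pi_pos.le (by linarith))]
  gcongr

lemma abs_D_mom_le (θ) {t : ℝ} (ht : |t| < τ) (i j x) : |D i (ξ θ t j) x| ≤ derivBound r C :=
  abs_D_le h.r_pos h.C_nonneg ((h.bound_mom θ t ht j).trans (ENNReal.ofReal_le_ofReal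
    (le_add_of_nonneg_right (mul_nonneg h.C_nonneg h.C_nonneg)))) i x

lemma abs_D_mul_le (θ) {t : ℝ} (ht : |t| < τ) (i x) : |D i (ξ θ t i * ρ θ t) x| ≤ derivBound r C := by
  refine abs_D_le h.r_pos h.C_nonneg ?_ i x
  refine (wN_mul_le h.r_pos.le _ _).trans ((mul_le_mul' (h.bound_mom θ t ht i) (h.bound_den θ t ht)).trans ?_)
  rw [← ENNReal.ofReal_mul h.C_nonneg]
  exact ENNReal.ofReal_le_ofReal (le_add_of_nonneg_left h.C_nonneg)

lemma abs_field_le [IsProbabilityMeasure μ] {t : ℝ} (ht : |t| < τ) (j x) :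
    |D j (pot (avg μ fun θ => ρ θ t)) x| ≤ C :=
  abs_apply_le h.r_pos.le h.C_nonneg ((wN_D_pot_le h.r_pos j (h.avg_ne_top ht)).trans
    (wN_avg_le h.r_pos.le h.C_nonneg (h.meas_den t ht) fun θ => h.bound_den θ t ht)) x

/-- The time derivative of the momentum. -/
lemma hasDerivAt_momVec {t : ℝ} (ht : |t| < τ) (p : M × T3) :
    HasDerivAt (fun s => momVec ξ s p) (fieldVec μ ρ t p.2 - WithLp.toLp 2 fun j =>
      ∑ i, ξ p.1 t i p.2 * D i (ξ p.1 t j) p.2) t := by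
  refine (hasDerivAt_toLp fun j => h.deriv_mom_apply p.1 ht j p.2).congr_deriv ?_
  ext j
  simp [fieldVec]; ring

lemma hasDerivAt_phase {Ψ : ℝ → T3 → R3 → ℝ} (hΨ : ContDiff ℝ 1 (phaseLift Ψ)) {t : ℝ} (ht : |t| < τ)
    (θ : M) (w : Fin 3 → ℝ) :
    HasDerivAt (fun s => Ψ s (torusProj w) (momVec ξ s (θ, torusProj w)))
      (fderiv ℝ (phaseLift Ψ) (t, w, momVec ξ t (θ, torusProj w))
        (1, 0, fieldVec μ ρ t (torusProj w) - WithLp.toLp 2 fun j =>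
          ∑ i, ξ θ t i (torusProj w) * D i (ξ θ t j) (torusProj w))) t :=
  HasFDerivAt.comp_hasDerivAt (l := phaseLift Ψ) (f := fun s => (s, w, momVec ξ s (θ, torusProj w))) t
    ((hΨ.differentiable one_ne_zero) (t, w, momVec ξ t (θ, torusProj w))).hasFDerivAt
    ((hasDerivAt_id t).prodMk ((hasDerivAt_const t w).prodMk (h.hasDerivAt_momVec ht (θ, torusProj w))))

lemma hasDerivAt_phase_coord {Ψ : ℝ → T3 → R3 → ℝ} (hΨ : ContDiff ℝ 1 (phaseLift Ψ)) {t : ℝ} (ht : |t| < τ)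
    (θ : M) (w : Fin 3 → ℝ) (i : Fin 3) :
    HasDerivAt (fun s : ℝ => Ψ t (torusProj w + Pi.single i (s : UnitAddCircle))
        (momVec ξ t (θ, torusProj w + Pi.single i (s : UnitAddCircle))))
      (fderiv ℝ (phaseLift Ψ) (t, w, momVec ξ t (θ, torusProj w))
        (0, Pi.single i 1, WithLp.toLp 2 fun j => D i (ξ θ t j) (torusProj w))) 0 := by
  have h1 : HasDerivAt (fun s : ℝ => w + Pi.single i s) (Pi.single i (1 : ℝ)) 0 := by
    have h2 : HasDerivAt (fun s : ℝ => (Pi.single i s : Fin 3 → ℝ)) (Pi.single i (1 : ℝ)) 0 :=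
      (ContinuousLinearMap.single ℝ (fun _ : Fin 3 => ℝ) i).hasFDerivAt.comp_hasDerivAt 0 (hasDerivAt_id 0)
    exact h2.const_add w
  have h3 : HasDerivAt (fun s : ℝ => momVec ξ t (θ, torusProj w + Pi.single i (s : UnitAddCircle)))
      (WithLp.toLp 2 fun j => D i (ξ θ t j) (torusProj w)) 0 :=
    hasDerivAt_toLp fun j => hasDerivAt_coord_D h.r_pos (h.mom_ne_top θ ht j) i (torusProj w)
  have h4 := (((hasDerivAt_const (0 : ℝ) t)).prodMk (h1.prodMk h3))
  have hL : HasFDerivAt (phaseLift Ψ) (fderiv ℝ (phaseLift Ψ) (t, w, momVec ξ t (θ, torusProj w)))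
      (t, w + Pi.single i 0, momVec ξ t (θ, torusProj w + Pi.single i ((0 : ℝ) : UnitAddCircle))) := by
    simpa using ((hΨ.differentiable one_ne_zero) (t, w, momVec ξ t (θ, torusProj w))).hasFDerivAt
  have h5 := hL.comp_hasDerivAt (0 : ℝ) h4
  refine h5.congr_of_eventuallyEq (Eventually.of_forall fun s => ?_)
  simp only [Function.comp, phaseLift, torusProj_add, torusProj_single]

end

end LocalSolution

namespace LocalSolution

variable {M : Type*} [MeasurableSpace M] {μ : Measure M} {τ r C : ℝ}
  {ρ : M → ℝ → C(T3, ℝ)} {ξ : M → ℝ → Fin 3 → C(T3, ℝ)}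

/-- The derivative of `x ↦ Ψ(t, x, ξ_θ(t,x))` in the direction `i`. -/
def phaseCoordDeriv (ξ : M → ℝ → Fin 3 → C(T3, ℝ)) (Ψ : ℝ → T3 → R3 → ℝ) (i : Fin 3) (t : ℝ)
    (p : M × T3) : ℝ :=
  deriv (fun s : ℝ => Ψ t (p.2 + Pi.single i (s : UnitAddCircle))
    (momVec ξ t (p.1, p.2 + Pi.single i (s : UnitAddCircle)))) 0

/-- The derivative of the flux `x ↦ (ξ_θ)ᵢ ρ_θ Ψ(t, x, ξ_θ(t,x))` in the direction `i`. -/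
def fluxDeriv (ρ : M → ℝ → C(T3, ℝ)) (ξ : M → ℝ → Fin 3 → C(T3, ℝ)) (Ψ : ℝ → T3 → R3 → ℝ)
    (i : Fin 3) (t : ℝ) (p : M × T3) : ℝ :=
  D i (ξ p.1 t i * ρ p.1 t) p.2 * Ψ t p.2 (momVec ξ t p)
    + (ξ p.1 t i * ρ p.1 t) p.2 * phaseCoordDeriv ξ Ψ i t p

lemma measurable_phase {Ψ : ℝ → T3 → R3 → ℝ}
    (hΨ : Continuous fun p : ℝ × T3 × R3 => Ψ p.1 p.2.1 p.2.2) {t : ℝ} {V : M × T3 → R3}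
    (hV : Measurable V) : Measurable fun p : M × T3 => Ψ t p.2 (V p) :=
  hΨ.measurable.comp (measurable_const.prodMk (measurable_snd.prodMk hV))

section

variable (h : LocalSolution μ τ r C ρ ξ)
include h

lemma hasDerivAt_phaseCoord {Ψ : ℝ → T3 → R3 → ℝ} (hΨ : ContDiff ℝ 1 (phaseLift Ψ)) {t : ℝ}
    (ht : |t| < τ) (i : Fin 3) (p : M × T3) :
    HasDerivAt (fun s : ℝ => Ψ t (p.2 + Pi.single i (s : UnitAddCircle))
      (momVec ξ t (p.1, p.2 + Pi.single i (s : UnitAddCircle)))) (phaseCoordDeriv ξ Ψ i t p) 0 := by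
  obtain ⟨θ, x⟩ := p
  obtain ⟨w, -, rfl⟩ := exists_torusProj_eq x
  exact (h.hasDerivAt_phase_coord hΨ ht θ w i).differentiableAt.hasDerivAt

lemma hasDerivAt_flux {Ψ : ℝ → T3 → R3 → ℝ} (hΨ : ContDiff ℝ 1 (phaseLift Ψ)) {t : ℝ}
    (ht : |t| < τ) (i : Fin 3) (p : M × T3) :
    HasDerivAt (fun s : ℝ => (ξ p.1 t i * ρ p.1 t) (p.2 + Pi.single i (s : UnitAddCircle)) *
      Ψ t (p.2 + Pi.single i (s : UnitAddCircle))
        (momVec ξ t (p.1, p.2 + Pi.single i (s : UnitAddCircle)))) (fluxDeriv ρ ξ Ψ i t p) 0 := by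
  refine ((hasDerivAt_coord_D h.r_pos (h.mul_ne_top p.1 ht i) i p.2).mul
    (h.hasDerivAt_phaseCoord hΨ ht i p)).congr_deriv ?_
  simp only [AddCircle.coe_zero, Pi.single_zero, add_zero]
  rfl

/-- The pointwise conservation law behind `transport_identity`. -/
lemma hasDerivAt_den_phase {Ψ : ℝ → T3 → R3 → ℝ} (hΨ : ContDiff ℝ 1 (phaseLift Ψ)) {t : ℝ}
    (ht : |t| < τ) (p : M × T3) :
    HasDerivAt (fun s => ρ p.1 s p.2 * Ψ s p.2 (momVec ξ s p))
      (ρ p.1 t p.2 * transportOp (fieldVec μ ρ t) Ψ t p.2 (momVec ξ t p) - ∑ i, fluxDeriv ρ ξ Ψ i t p) t := by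
  obtain ⟨θ, x⟩ := p
  obtain ⟨w, -, rfl⟩ := exists_torusProj_eq x
  have hB : ∀ i, phaseCoordDeriv ξ Ψ i t (θ, torusProj w) = _ := fun i =>
    (h.hasDerivAt_phase_coord hΨ ht θ w i).deriv
  refine ((h.deriv_den_apply θ ht (torusProj w)).mul (h.hasDerivAt_phase hΨ ht θ w)).congr_deriv ?_
  simp only [fluxDeriv, hB, transportOp_eq hΨ]
  set L := fderiv ℝ (phaseLift Ψ) (t, w, momVec ξ t (θ, torusProj w))
  -- The direction `(1, ξ, E)` is the time direction along the fluid plus `ξᵢ` times the spatial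
  -- ones; the convective terms `ξ·∇ξ` cancel.
  have h4 : ((1 : ℝ), (fun i => momVec ξ t (θ, torusProj w) i : Fin 3 → ℝ), fieldVec μ ρ t (torusProj w)) =
      (1, 0, fieldVec μ ρ t (torusProj w) - WithLp.toLp 2 fun j =>
          ∑ i, ξ θ t i (torusProj w) * D i (ξ θ t j) (torusProj w)) +
      ∑ i, ξ θ t i (torusProj w) • ((0 : ℝ), (Pi.single i (1 : ℝ) : Fin 3 → ℝ),
        (WithLp.toLp 2 fun j => D i (ξ θ t j) (torusProj w) : R3)) := by
    ext j
    · simp [Prod.fst_sum]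
    · simp [Prod.snd_sum, Prod.fst_sum, Finset.sum_apply, Pi.single_apply, momVec]
    · simp [Prod.snd_sum]
  rw [h4, map_add, map_sum]
  simp only [map_smul, smul_eq_mul, ContinuousMap.mul_apply, Finset.sum_add_distrib, mul_add,
    Finset.mul_sum, neg_mul, Finset.sum_mul]
  have h5 : ∀ i, ρ θ t (torusProj w) * (ξ θ t i (torusProj w) * L (0, Pi.single i 1,
      WithLp.toLp 2 fun j => D i (ξ θ t j) (torusProj w))) =
      ξ θ t i (torusProj w) * ρ θ t (torusProj w) * L (0, Pi.single i 1,
      WithLp.toLp 2 fun j => D i (ξ θ t j) (torusProj w)) := fun i => by ring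
  simp only [h5]
  ring

/-- The evolution of the integrals `∫∫ ρ_θ Ψ(t, x, ξ_θ) dx μ(dθ)`. -/
theorem transport_identity [IsProbabilityMeasure μ] {Ψ : ℝ → T3 → R3 → ℝ}
    (hΨ : ContDiff ℝ 1 (phaseLift Ψ)) {t₁ : ℝ} (ht₁ : t₁ ≤ τ) :
    ∃ K, ∀ t, |t| < t₁ →
      HasDerivAt (fun s => ∫ p, ρ p.1 s p.2 * Ψ s p.2 (momVec ξ s p) ∂(μ.prod torusMeasure))
        (∫ p, ρ p.1 t p.2 * transportOp (fieldVec μ ρ t) Ψ t p.2 (momVec ξ t p) ∂(μ.prod torusMeasure)) t ∧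
      |∫ p, ρ p.1 t p.2 * transportOp (fieldVec μ ρ t) Ψ t p.2 (momVec ξ t p) ∂(μ.prod torusMeasure)| ≤ K := by
  -- Momenta stay in the ball of radius `3C`, so `Ψ` needs no compact support in `v`; this admits
  -- `vⱼ χ(x)`.
  obtain ⟨K₀, hK₀, hK⟩ := exists_phaseLift_bound hΨ t₁ (3 * C)
  have hC := h.C_nonneg
  set B := derivBound r C
  have hB : 0 ≤ B := derivBound_nonneg h.r_pos hC
  have hΨc : Continuous fun p : ℝ × T3 × R3 => Ψ p.1 p.2.1 p.2.2 := continuous_of_phaseLift hΨ.continuous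
  have hlt : ∀ {t}, |t| < t₁ → |t| < τ := fun ht => ht.trans_le ht₁
  have hb1 : ∀ t, |t| < t₁ → ∀ p : M × T3, |Ψ t p.2 (momVec ξ t p)| ≤ K₀ := fun t ht ⟨θ, x⟩ => by
    obtain ⟨w, hw, rfl⟩ := exists_torusProj_eq x
    exact (hK t w _ ht.le hw (h.norm_momVec_le (hlt ht) _)).1
  have hb2 : ∀ t, |t| < t₁ → ∀ p : M × T3,
      |transportOp (fieldVec μ ρ t) Ψ t p.2 (momVec ξ t p)| ≤ K₀ * (1 + 3 * C) := fun t ht ⟨θ, x⟩ => by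
    obtain ⟨w, hw, rfl⟩ := exists_torusProj_eq x
    rw [transportOp_eq hΨ]
    have h1 := (hK t w _ ht.le hw (h.norm_momVec_le (hlt ht) (θ, torusProj w))).2
    refine (ContinuousLinearMap.le_opNorm _ _).trans (mul_le_mul h1 ?_ (norm_nonneg _) hK₀)
    refine norm_prod_le_iff.2 ⟨by simpa using hC, norm_prod_le_iff.2 ⟨?_, ?_⟩⟩
    · refine (pi_norm_le_iff_of_nonneg (by positivity)).2 fun i => ?_
      exact (h.abs_mom_le θ (hlt ht) i (torusProj w)).trans (by linarith)
    · refine (norm_toLp_le hC fun j => ?_).trans (by linarith)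
      rw [abs_neg]
      exact h.abs_field_le (hlt ht) j _
  have hb3 : ∀ t, |t| < t₁ → ∀ (i : Fin 3) (p : M × T3), |phaseCoordDeriv ξ Ψ i t p| ≤ K₀ * (1 + 3 * B) :=
    fun t ht i ⟨θ, x⟩ => by
    obtain ⟨w, hw, rfl⟩ := exists_torusProj_eq x
    rw [phaseCoordDeriv, (h.hasDerivAt_phase_coord hΨ (hlt ht) θ w i).deriv]
    have h1 := (hK t w _ ht.le hw (h.norm_momVec_le (hlt ht) (θ, torusProj w))).2
    refine (ContinuousLinearMap.le_opNorm _ _).trans (mul_le_mul h1 ?_ (norm_nonneg _) hK₀)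
    refine norm_prod_le_iff.2 ⟨by rw [norm_zero]; positivity, norm_prod_le_iff.2 ⟨?_, ?_⟩⟩
    · refine (pi_norm_le_iff_of_nonneg (by positivity)).2 fun k => ?_
      by_cases hk : k = i
      · subst hk; simpa using hB
      · simp only [Pi.single_eq_of_ne hk, norm_zero]; positivity
    · refine (norm_toLp_le hB fun j => h.abs_D_mom_le θ (hlt ht) i j _).trans (by linarith)
  have hρξ : ∀ t, |t| < t₁ → ∀ i (p : M × T3), |(ξ p.1 t i * ρ p.1 t) p.2| ≤ C * C := fun t ht i p => by
    rw [ContinuousMap.mul_apply, abs_mul]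
    exact mul_le_mul (h.abs_mom_le _ (hlt ht) _ _) (h.abs_den_le _ (hlt ht) _) (abs_nonneg _) hC
  set Kf := B * K₀ + C * C * (K₀ * (1 + 3 * B))
  have hb4 : ∀ t, |t| < t₁ → ∀ i (p : M × T3), |fluxDeriv ρ ξ Ψ i t p| ≤ Kf := fun t ht i p => by
    refine (abs_add_le _ _).trans (add_le_add ?_ ?_)
    · rw [abs_mul]
      exact mul_le_mul (h.abs_D_mul_le _ (hlt ht) _ _) (hb1 t ht p) (abs_nonneg _) hB
    · rw [abs_mul]
      exact mul_le_mul (hρξ t ht i p) (hb3 t ht i p) (abs_nonneg _) (by positivity)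
  set Kt := C * (K₀ * (1 + 3 * C))
  have hb5 : ∀ t, |t| < t₁ → ∀ p : M × T3,
      |ρ p.1 t p.2 * transportOp (fieldVec μ ρ t) Ψ t p.2 (momVec ξ t p)| ≤ Kt := fun t ht p => by
    rw [abs_mul]
    exact mul_le_mul (h.abs_den_le _ (hlt ht) _) (hb2 t ht p) (abs_nonneg _) hC
  have hmΨ : ∀ t, |t| < t₁ → Measurable fun p : M × T3 => Ψ t p.2 (momVec ξ t p) := fun t ht =>
    measurable_phase hΨc (h.measurable_momVec (hlt ht))
  -- The fluxes are exact derivatives in `x`, hence have zero integral.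
  have hflux : ∀ t, |t| < t₁ → ∀ i, Integrable (fluxDeriv ρ ξ Ψ i t) (μ.prod torusMeasure) ∧
      ∫ p, fluxDeriv ρ ξ Ψ i t p ∂(μ.prod torusMeasure) = 0 := fun t ht i => by
    refine integral_coord_deriv_eq_zero (K := max (C * C * K₀) Kf)
      (G := fun p => (ξ p.1 t i * ρ p.1 t) p.2 * Ψ t p.2 (momVec ξ t p)) ?_ (fun p => ?_)
      (fun p => (hb4 t ht i p).trans (le_max_right _ _)) i (fun p => h.hasDerivAt_flux hΨ (hlt ht) i p)
    · exact ((measurable_uncurry_family (g := fun θ => ξ θ t i) (h.meas_mom t (hlt ht) i)).mul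
        (h.measurable_den (hlt ht))).mul (hmΨ t ht)
    · refine le_trans ?_ (le_max_left _ _)
      rw [abs_mul]
      exact mul_le_mul (hρξ t ht i p) (hb1 t ht p) (abs_nonneg _) (by positivity)
  have hmT : ∀ t, |t| < t₁ → Integrable (fun p : M × T3 =>
      ρ p.1 t p.2 * transportOp (fieldVec μ ρ t) Ψ t p.2 (momVec ξ t p)) (μ.prod torusMeasure) := fun t ht => by
    refine (integrable_const Kt).mono' ?_ (ae_of_all _ (hb5 t ht))
    exact ((h.measurable_den (hlt ht)).mul (measurable_phase
      (continuous_transportOp (continuous_fieldVec μ ρ t) hΨ) (h.measurable_momVec (hlt ht)))).aestronglyMeasurable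
  refine ⟨Kt, fun t ht => ⟨?_, ?_⟩⟩
  · have hball : ∀ s, s ∈ Metric.ball (0 : ℝ) t₁ ↔ |s| < t₁ := fun s => by simp
    have hnhds : Metric.ball (0 : ℝ) t₁ ∈ 𝓝 t := Metric.isOpen_ball.mem_nhds ((hball t).2 ht)
    have hFm : ∀ s, |s| < t₁ → AEStronglyMeasurable
        (fun p : M × T3 => ρ p.1 s p.2 * Ψ s p.2 (momVec ξ s p)) (μ.prod torusMeasure) := fun s hs =>
      ((h.measurable_den (hlt hs)).mul (hmΨ s hs)).aestronglyMeasurable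
    have hint := (hmT t ht).sub (integrable_finsetSum Finset.univ fun i _ => (hflux t ht i).1)
    have key := hasDerivAt_integral_of_dominated_loc_of_deriv_le (μ := μ.prod torusMeasure)
      (F := fun s p => ρ p.1 s p.2 * Ψ s p.2 (momVec ξ s p))
      (F' := fun s p => ρ p.1 s p.2 * transportOp (fieldVec μ ρ s) Ψ s p.2 (momVec ξ s p)
        - ∑ i, fluxDeriv ρ ξ Ψ i s p)
      (bound := fun _ => Kt + 3 * Kf) hnhds (mem_of_superset hnhds fun s hs => hFm s ((hball s).1 hs))
      ((integrable_const (C * K₀)).mono' (hFm t ht) (ae_of_all _ fun p => by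
        rw [Real.norm_eq_abs, abs_mul]
        exact mul_le_mul (h.abs_den_le _ (hlt ht) _) (hb1 t ht p) (abs_nonneg _) hC))
      hint.aestronglyMeasurable
      (ae_of_all _ fun p s hs => by
        have hs' := (hball s).1 hs
        refine (abs_sub _ _).trans (add_le_add (hb5 s hs' p) ?_)
        refine (Finset.abs_sum_le_sum_abs _ _).trans ((Finset.sum_le_sum fun i _ => hb4 s hs' i p).trans ?_)
        simp)
      (integrable_const _)
      (ae_of_all _ fun p s hs => h.hasDerivAt_den_phase hΨ (hlt ((hball s).1 hs)) p)
    refine key.2.congr_deriv ?_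
    rw [integral_sub (hmT t ht) (integrable_finsetSum Finset.univ fun i _ => (hflux t ht i).1),
      integral_finsetSum _ fun i _ => (hflux t ht i).1]
    simp [(hflux t ht _).2]
  · rw [← Real.norm_eq_abs]
    refine (norm_integral_le_of_norm_le_const (C := Kt) (ae_of_all _ fun p => ?_)).trans (by simp)
    exact hb5 t ht p

end

end LocalSolution

/-! ### Smooth test functions on the torus -/

section smooth

lemma continuous_of_lift {g : T3 → ℝ} (h : Continuous fun w => g (torusProj w)) : Continuous g :=
  isOpenQuotientMap_torusProj.isQuotientMap.continuous_iff.2 h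

variable {χ : T3 → ℝ}

lemma TorusContDiff.continuous {n : WithTop ℕ∞} (h : TorusContDiff n χ) : Continuous χ :=
  continuous_of_lift (ContDiff.continuous h)

lemma TorusContDiff.hasDerivAt_partial (h : TorusContDiff ∞ χ) (i : Fin 3) (x : T3) :
    HasDerivAt (fun s : ℝ => χ (x + Pi.single i (s : UnitAddCircle))) (torusPartial i χ x) 0 := by
  obtain ⟨w, -, rfl⟩ := exists_torusProj_eq x
  have h1 := ((ContDiff.differentiable h (by simp)) w).hasFDerivAt
  rw [torusPartial_eq h1]
  exact hasDerivAt_coord h1 i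

lemma TorusContDiff.partial (h : TorusContDiff ∞ χ) (i : Fin 3) : TorusContDiff ∞ (torusPartial i χ) := by
  have h1 : (fun w => torusPartial i χ (torusProj w)) =
      fun w => fderiv ℝ (fun v => χ (torusProj v)) w (Pi.single i 1) := funext fun w =>
    torusPartial_eq ((ContDiff.differentiable h (by simp)) w).hasFDerivAt i
  rw [TorusContDiff, h1]
  exact (ContDiff.fderiv_right (m := ∞) h (by simp)).clm_apply contDiff_const

lemma integral_torus_coord_deriv {G G' : T3 → ℝ} (hG : Continuous G) (hG' : Continuous G') (i : Fin 3)
    (hd : ∀ x, HasDerivAt (fun s : ℝ => G (x + Pi.single i (s : UnitAddCircle))) (G' x) 0) :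
    ∫ x, G' x ∂torusMeasure = 0 := by
  obtain ⟨K₁, h₁⟩ := isCompact_univ.exists_bound_of_continuousOn hG.continuousOn
  obtain ⟨K₂, h₂⟩ := isCompact_univ.exists_bound_of_continuousOn hG'.continuousOn
  -- The parameter space is reduced to a point.
  have h := (integral_coord_deriv_eq_zero (μ := Measure.dirac ()) (K := max K₁ K₂)
    (G := fun p => G p.2) (G' := fun p => G' p.2) (hG.measurable.comp measurable_snd)
    (fun p => (h₁ p.2 (mem_univ _)).trans (le_max_left _ _))
    (fun p => (h₂ p.2 (mem_univ _)).trans (le_max_right _ _)) i fun p => hd p.2).2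
  rw [integral_fun_snd] at h
  simpa using h

/-- Green's formula: `g ∂ᵢ²χ - χ ∂ᵢ²g` is the derivative of `g ∂ᵢχ - χ ∂ᵢg`. -/
lemma integral_mul_laplacian {r : ℝ} (hr : 0 < r) {g : C(T3, ℝ)} (hg : wN r g ≠ ⊤)
    (hχ : TorusContDiff ∞ χ) :
    ∫ x, g x * torusLaplacian χ x ∂torusMeasure = ∫ x, torusLaplacian g x * χ x ∂torusMeasure := by
  have hr2 := half_pos hr
  have hd : ∀ i, wN (r / 2) (D i g) ≠ ⊤ := fun i => wN_D_ne_top hr2.le (half_lt_self hr) i hg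
  have hc := hχ.continuous
  have hc2 : ∀ i, Continuous (torusPartial i (torusPartial i χ)) := fun i => ((hχ.partial i).partial i).continuous
  have h1 : ∀ i, ∫ x, (g x * torusPartial i (torusPartial i χ) x - D i (D i g) x * χ x) ∂torusMeasure = 0 :=
    fun i => by
    have hc1 := (hχ.partial i).continuous
    have := hc2 i
    refine integral_torus_coord_deriv (G := fun x => g x * torusPartial i χ x - D i g x * χ x)
      (by fun_prop) (by fun_prop) i fun x => ?_
    refine (((hasDerivAt_coord_D hr hg i x).mul ((hχ.partial i).hasDerivAt_partial i x)).sub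
      ((hasDerivAt_coord_D hr2 (hd i) i x).mul (hχ.hasDerivAt_partial i x))).congr_deriv ?_
    simp only [AddCircle.coe_zero, Pi.single_zero, add_zero]
    ring
  simp only [torusLaplacian, torusPartial_eq_D hr hg, torusPartial_eq_D hr2 (hd _), Finset.mul_sum,
    Finset.sum_mul]
  have hi1 : ∀ i, Integrable (fun x => g x * torusPartial i (torusPartial i χ) x) torusMeasure := fun i =>
    integrable_torus (g.continuous.mul (hc2 i))
  have hi2 : ∀ i, Integrable (fun x => D i (D i g) x * χ x) torusMeasure := fun i =>
    integrable_torus (by fun_prop)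
  rw [integral_finsetSum _ fun i _ => hi1 i, integral_finsetSum _ fun i _ => hi2 i]
  refine Finset.sum_congr rfl fun i _ => ?_
  rw [← sub_eq_zero, ← integral_sub (hi1 i) (hi2 i)]
  exact h1 i

lemma contDiff_momentum_mul (hχ : TorusContDiff ∞ χ) (j : Fin 3) :
    ContDiff ℝ 1 (phaseLift fun _ x v => v j * χ x) := by
  have h1 : ContDiff ℝ 1 fun w => χ (torusProj w) := ContDiff.of_le hχ (by simp)
  have h2 : ContDiff ℝ 1 fun p : ℝ × (Fin 3 → ℝ) × R3 => p.2.2 j :=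
    (EuclideanSpace.proj j : R3 →L[ℝ] ℝ).contDiff.comp
      (contDiff_snd.comp contDiff_snd)
  exact h2.mul (h1.comp (contDiff_fst.comp contDiff_snd))

lemma transportOp_momentum_mul (E : T3 → R3) (j : Fin 3) (t : ℝ) (x : T3) (v : R3) :
    transportOp E (fun _ x v => v j * χ x) t x v =
      (∑ i, v i * v j * torusPartial i χ x) + E x j * χ x := by
  have h1 : HasFDerivAt (fun v : R3 => v j * χ x)
      (χ x • (EuclideanSpace.proj j : R3 →L[ℝ] ℝ)) v :=
    (EuclideanSpace.proj j : R3 →L[ℝ] ℝ).hasFDerivAt.mul_const (χ x)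
  rw [transportOp, h1.fderiv, deriv_const, zero_add]
  congr 1
  · refine Finset.sum_congr rfl fun i _ => ?_
    rw [torusPartial, deriv_const_mul_field, ← torusPartial, mul_assoc]
  · simp [mul_comm]

end smooth

/-! ### The kinetic measure -/

namespace LocalSolution

variable {M : Type*} [MeasurableSpace M] {μ : Measure M} {τ r C : ℝ}
  {ρ : M → ℝ → C(T3, ℝ)} {ξ : M → ℝ → Fin 3 → C(T3, ℝ)}

/-- The phase space measure of the multifluid solution at time `t`. -/
def kinetic (μ : Measure M) (ρ : M → ℝ → C(T3, ℝ)) (ξ : M → ℝ → Fin 3 → C(T3, ℝ)) (t : ℝ) :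
    Measure (T3 × R3) := multifluidMeasure μ (fun θ => ρ θ t) fun θ => ξ θ t

variable [IsProbabilityMeasure μ] (h : LocalSolution μ τ r C ρ ξ)
include h

section fixedTime

variable {t : ℝ} (ht : |t| < τ)
include ht

lemma measurable_phaseMap : Measurable fun p : M × T3 => (p.2, momVec ξ t p) :=
  measurable_snd.prodMk (h.measurable_momVec ht)

lemma ae_kinetic_norm_le : ∀ᵐ z ∂(kinetic μ ρ ξ t), ‖z.2‖ ≤ 3 * C := by
  have hm : MeasurableSet {z : T3 × R3 | ‖z.2‖ ≤ 3 * C} :=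
    (isClosed_le (by fun_prop) continuous_const).measurableSet
  exact (ae_map_iff (h.measurable_phaseMap ht).aemeasurable hm).2
    (ae_of_all _ fun p => h.norm_momVec_le ht p)

lemma integrable_den : Integrable (fun p : M × T3 => ρ p.1 t p.2) (μ.prod torusMeasure) :=
  integrable_uncurry_family h.r_pos.le h.C_nonneg (h.meas_den t ht) fun θ => h.bound_den θ t ht

variable (hpos : ∀ θ x, 0 ≤ ρ θ t x)
include hpos

/-- Nonnegativity matters here: it ensures that `ENNReal.ofReal` does not truncate the density. -/
lemma integral_kinetic {g : T3 × R3 → ℝ} (hg : Continuous g) :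
    ∫ z, g z ∂(kinetic μ ρ ξ t) = ∫ p, ρ p.1 t p.2 * g (p.2, momVec ξ t p) ∂(μ.prod torusMeasure) := by
  have hm := h.measurable_phaseMap ht
  have h1 := integral_map (μ := (μ.prod torusMeasure).withDensity fun p => ENNReal.ofReal (ρ p.1 t p.2))
    hm.aemeasurable (f := g) hg.measurable.aestronglyMeasurable
  refine h1.trans ?_
  rw [integral_withDensity_eq_integral_toReal_smul (h.measurable_den ht).ennreal_ofReal
    (ae_of_all _ fun p => ENNReal.ofReal_lt_top)]
  refine integral_congr_ae (ae_of_all _ fun p => ?_)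
  simp only [ENNReal.toReal_ofReal (hpos p.1 p.2), smul_eq_mul]

variable (hmass : ∫ θ, ∫ x, ρ θ 0 x ∂torusMeasure ∂μ = 1)
include hmass

lemma isProbabilityMeasure_kinetic : IsProbabilityMeasure (kinetic μ ρ ξ t) := by
  refine ⟨?_⟩
  have h1 : kinetic μ ρ ξ t univ =
      ((μ.prod torusMeasure).withDensity fun p => ENNReal.ofReal (ρ p.1 t p.2)) univ :=
    Measure.map_apply (h.measurable_phaseMap ht) MeasurableSet.univ
  rw [h1, withDensity_apply _ MeasurableSet.univ, Measure.restrict_univ,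
    ← ofReal_integral_eq_lintegral_ofReal (h.integrable_den ht) (ae_of_all _ fun p => hpos p.1 p.2),
    integral_prod _ (h.integrable_den ht)]
  have h2 : ∫ θ, ∫ x, ρ θ t x ∂torusMeasure ∂μ = 1 := by
    refine Eq.trans ?_ hmass
    exact integral_congr_ae (ae_of_all _ fun θ => h.integral_den θ ht)
  rw [h2, ENNReal.ofReal_one]

lemma isP2_kinetic : IsP2 (kinetic μ ρ ξ t) := by
  have hp := h.isProbabilityMeasure_kinetic ht hpos hmass
  refine ⟨hp, (integrable_const ((3 * C) ^ 2)).mono' ?_ ?_⟩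
  · exact (by fun_prop : Continuous fun z : T3 × R3 => ‖z.2‖ ^ 2).aestronglyMeasurable
  · filter_upwards [h.ae_kinetic_norm_le ht] with z hz
    rw [norm_pow, norm_norm]
    exact pow_le_pow_left₀ (norm_nonneg _) hz 2

lemma lintegral_kinetic_le : ∫⁻ z, ‖z.2‖ₑ ^ 4 ∂(kinetic μ ρ ξ t) ≤ ((3 * C).toNNReal ^ 4 : ℝ≥0) := by
  have hp := h.isProbabilityMeasure_kinetic ht hpos hmass
  have h1 : ∫⁻ z, ‖z.2‖ₑ ^ 4 ∂(kinetic μ ρ ξ t) ≤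
      ∫⁻ _, (((3 * C).toNNReal ^ 4 : ℝ≥0) : ℝ≥0∞) ∂(kinetic μ ρ ξ t) := by
    refine lintegral_mono_ae ?_
    filter_upwards [h.ae_kinetic_norm_le ht] with z hz
    rw [ENNReal.coe_pow]
    gcongr
    rw [← ofReal_norm]
    exact ENNReal.ofReal_le_ofReal hz
  simpa using h1

-- By Tonelli, forgetting the momentum leaves the averaged density, whose sup bound then controls
-- the macroscopic density.
omit hmass in
lemma map_fst_kinetic : (kinetic μ ρ ξ t).map Prod.fst =
    torusMeasure.withDensity fun x => ENNReal.ofReal (avg μ (fun θ => ρ θ t) x) := by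
  have hm := h.measurable_phaseMap ht
  have hd : Measurable fun p : M × T3 => ENNReal.ofReal (ρ p.1 t p.2) :=
    (h.measurable_den ht).ennreal_ofReal
  have h1 : (kinetic μ ρ ξ t).map Prod.fst =
      ((μ.prod torusMeasure).withDensity fun p => ENNReal.ofReal (ρ p.1 t p.2)).map Prod.snd :=
    Measure.map_map measurable_fst hm
  rw [h1]
  ext s hs
  rw [Measure.map_apply measurable_snd hs, withDensity_apply _ (measurable_snd hs), withDensity_apply _ hs,
    ← lintegral_indicator (measurable_snd hs), ← lintegral_indicator hs,
    lintegral_prod_symm _ (hd.indicator (measurable_snd hs)).aemeasurable]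
  refine lintegral_congr fun x => ?_
  by_cases hx : x ∈ s
  · rw [indicator_of_mem hx, h.avg_den_apply ht, ofReal_integral_eq_lintegral_ofReal
      (integrable_family h.r_pos.le h.C_nonneg (h.meas_den t ht) (fun θ => h.bound_den θ t ht) x)
      (ae_of_all _ fun θ => hpos θ x)]
    exact lintegral_congr fun θ => indicator_of_mem (by exact hx) _
  · rw [indicator_of_notMem hx]
    refine (lintegral_congr fun θ => indicator_of_notMem (by exact hx) _).trans lintegral_zero

omit hmass in
lemma exists_density : ∃ q : T3 → ℝ, Measurable q ∧ (∀ x, 0 ≤ q x) ∧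
    (kinetic μ ρ ξ t).map Prod.fst = torusMeasure.withDensity (fun x => ENNReal.ofReal (q x)) ∧
    eLpNorm q 1 torusMeasure ≤ (C.toNNReal : ℝ≥0∞) ∧ eLpNorm q ⊤ torusMeasure ≤ (C.toNNReal : ℝ≥0∞) := by
  have hb : ∀ x, ‖avg μ (fun θ => ρ θ t) x‖ ≤ C := fun x =>
    abs_apply_le h.r_pos.le h.C_nonneg
      (wN_avg_le h.r_pos.le h.C_nonneg (h.meas_den t ht) fun θ => h.bound_den θ t ht) x
  refine ⟨avg μ fun θ => ρ θ t, (ContinuousMap.continuous _).measurable, fun x => ?_,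
    h.map_fst_kinetic ht hpos, ?_, ?_⟩
  · rw [h.avg_den_apply ht]
    exact integral_nonneg fun θ => hpos θ x
  · simpa [ENNReal.ofReal] using eLpNorm_le_of_ae_bound (p := 1) (μ := torusMeasure) (ae_of_all _ hb)
  · simpa [ENNReal.ofReal] using eLpNorm_le_of_ae_bound (p := ⊤) (μ := torusMeasure) (ae_of_all _ hb)

lemma kinetic_poisson (χ : C(T3, ℝ)) (hχ : TorusContDiff ∞ χ) :
    -∫ x, pot (avg μ fun θ => ρ θ t) x * torusLaplacian χ x ∂torusMeasure =
      (∫ z, χ z.1 ∂(kinetic μ ρ ξ t)) - ∫ x, χ x ∂torusMeasure := by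
  rw [integral_mul_laplacian h.r_pos (h.pot_ne_top ht) hχ, ← integral_neg,
    h.integral_kinetic ht hpos (g := fun z => χ z.1) (by fun_prop)]
  have h1 : ∀ x, -(torusLaplacian (pot (avg μ fun θ => ρ θ t)) x * χ x) =
      avg μ (fun θ => ρ θ t) x * χ x - χ x := fun x => by
    have := torusLaplacian_pot h.r_pos (h.avg_ne_top ht) x
    rw [h.integral_avg ht hmass] at this
    rw [← neg_mul, this]; ring
  simp only [h1]
  rw [integral_sub (integrable_torus (by fun_prop)) (integrable_torus χ.continuous)]
  congr 1
  obtain ⟨K, hK⟩ := isCompact_univ.exists_bound_of_continuousOn χ.continuous.continuousOn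
  have hi : Integrable (fun p : M × T3 => ρ p.1 t p.2 * χ p.2) (μ.prod torusMeasure) := by
    refine (h.integrable_den ht).mul_bdd (c := K)
      (χ.continuous.measurable.comp measurable_snd).aestronglyMeasurable (ae_of_all _ fun p => hK _ (mem_univ _))
  rw [integral_prod_symm _ hi]
  refine integral_congr_ae (ae_of_all _ fun x => ?_)
  simp only [h.avg_den_apply ht, integral_mul_const]

end fixedTime

end LocalSolution

/-! ### The kinetic measure is a suitable weak solution -/

namespace LocalSolution

variable {M : Type*} [MeasurableSpace M] {μ : Measure M} {τ r C : ℝ}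
  {ρ : M → ℝ → C(T3, ℝ)} {ξ : M → ℝ → Fin 3 → C(T3, ℝ)}

lemma continuousInB {T δ : ℝ} (hδ : 0 < δ) {u : ℝ → C(T3, ℝ)} (hT : T < τ)
    (hu : ∀ t, |t| < τ → wN (Real.log δ) (u t) ≠ ⊤)
    (hc : ∀ t, |t| < τ → Tendsto (fun s => wN (Real.log δ) (u s - u t)) (𝓝 t) (𝓝 0)) :
    ContinuousInB T δ u := by
  have ht : ∀ t ∈ Icc 0 T, |t| < τ := fun t ht => by
    rw [abs_of_nonneg ht.1]; exact ht.2.trans_lt hT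
  refine ⟨fun t ht' => memB_of_wN hδ (hu t (ht t ht')), fun t ht' => ?_⟩
  simp only [bNorm_eq hδ]
  have h1 := (ENNReal.tendsto_toReal ENNReal.zero_ne_top).comp (hc t (ht t ht'))
  simpa [Function.comp_def] using h1.mono_left nhdsWithin_le_nhds

variable [IsProbabilityMeasure μ] (h : LocalSolution μ τ r C ρ ξ)
include h

/-- The force field as a continuous curve of continuous vector fields. -/
lemma exists_force {T : ℝ} (hT₀ : 0 < T) (hT : T < τ) : ∃ E : ℝ → C(T3, R3), Continuous E ∧
    ∀ t ∈ Icc 0 T, ∀ x, E t x = fieldVec μ ρ t x := by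
  -- Clamping time to `[0,T]` makes the force continuous on the whole line, hence integrable on
  -- bounded intervals.
  set cl : ℝ → ℝ := fun t => max 0 (min t T)
  have hcl : ∀ t, |cl t| < τ := fun t => by
    rw [abs_of_nonneg (le_max_left _ _)]
    exact (max_le hT₀.le (min_le_right _ _)).trans_lt hT
  have hcont : Continuous fun p : ℝ × T3 => fieldVec μ ρ (cl p.1) p.2 := by
    unfold fieldVec
    refine (PiLp.continuous_toLp 2 _).comp (continuous_pi fun j => Continuous.neg ?_)
    have h1 : Continuous fun t => D j (pot (avg μ fun θ => ρ θ (cl t))) :=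
      continuous_iff_continuousAt.2 fun t =>
        ContinuousAt.comp (g := fun s => D j (pot (avg μ fun θ => ρ θ s))) (h.continuous_field (cl t) (hcl t) j)
          (by fun_prop)
    exact ContinuousEval.continuous_eval.comp ((h1.comp continuous_fst).prodMk continuous_snd)
  refine ⟨fun t => ⟨fieldVec μ ρ (cl t), continuous_fieldVec μ ρ (cl t)⟩,
    ContinuousMap.continuous_of_continuous_uncurry _ hcont, fun t ht x => ?_⟩
  have : cl t = t := by simp only [cl, min_eq_left ht.2, max_eq_right ht.1]
  simp [this]

lemma continuous_momVec_time {t : ℝ} (ht : |t| < τ) (p : M × T3) : ContinuousAt (fun s => momVec ξ s p) t :=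
  (h.hasDerivAt_momVec ht p).continuousAt

section

variable {T : ℝ} (hT : T < τ) (hpos : ∀ θ x, 0 ≤ ρ θ 0 x)
include hT hpos

lemma continuousOn_kinetic (g : BoundedContinuousFunction (T3 × R3) ℝ) :
    ContinuousOn (fun t => ∫ z, g z ∂(kinetic μ ρ ξ t)) (Ico 0 T) := by
  have ht : ∀ t ∈ Ico 0 T, |t| < τ := fun t ht => by
    rw [abs_of_nonneg ht.1]; exact ht.2.trans hT
  have h1 : ∀ t ∈ Ico 0 T, ∫ z, g z ∂(kinetic μ ρ ξ t) =
      ∫ p, ρ p.1 t p.2 * g (p.2, momVec ξ t p) ∂(μ.prod torusMeasure) := fun t ht' =>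
    h.integral_kinetic (ht t ht') (fun θ => h.nonneg hT (hpos θ) t (Ico_subset_Icc_self ht')) g.continuous
  refine ContinuousOn.congr (fun t ht' => ?_) h1
  refine continuousWithinAt_of_dominated (bound := fun _ => C * ‖g‖) ?_ ?_ (integrable_const _)
    (ae_of_all _ fun p => ?_)
  · filter_upwards [self_mem_nhdsWithin] with s hs
    exact ((h.measurable_den (ht s hs)).mul
      (g.continuous.measurable.comp (h.measurable_phaseMap (ht s hs)))).aestronglyMeasurable
  · filter_upwards [self_mem_nhdsWithin] with s hs
    refine ae_of_all _ fun p => ?_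
    rw [norm_mul]
    exact mul_le_mul (h.abs_den_le _ (ht s hs) _) (g.norm_coe_le_norm _) (norm_nonneg _) h.C_nonneg
  · refine ContinuousAt.continuousWithinAt (ContinuousAt.mul ?_ ?_)
    · exact (h.deriv_den_apply p.1 (ht t ht') p.2).continuousAt
    · exact g.continuous.continuousAt.comp
        (continuousAt_const.prodMk (h.continuous_momVec_time (ht t ht') p))

lemma kinetic_current (j : Fin 3) (χ : C(T3, ℝ)) (hχ : TorusContDiff ∞ χ) {t : ℝ} (ht : t ∈ Ico 0 T) :
    HasDerivWithinAt (fun s => ∫ z, z.2 j * χ z.1 ∂(kinetic μ ρ ξ s))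
      (∫ z, ((∑ i, z.2 i * z.2 j * torusPartial i χ z.1)
        - torusPartial j (pot (avg μ fun θ => ρ θ t)) z.1 * χ z.1) ∂(kinetic μ ρ ξ t)) (Ico 0 T) t := by
  have hτ : ∀ t ∈ Ico 0 T, |t| < τ := fun t ht => by
    rw [abs_of_nonneg ht.1]; exact ht.2.trans hT
  have hn : ∀ t ∈ Ico 0 T, ∀ θ x, 0 ≤ ρ θ t x := fun t ht' θ =>
    h.nonneg hT (hpos θ) t (Ico_subset_Icc_self ht')
  -- The current is the integral of `Ψ = vⱼ χ(x)` against the kinetic measure.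
  obtain ⟨K, hK⟩ := h.transport_identity (contDiff_momentum_mul hχ j) le_rfl
  have hd := (hK t (hτ t ht)).1
  have h1 : ∀ s ∈ Ico 0 T, ∫ z, z.2 j * χ z.1 ∂(kinetic μ ρ ξ s) =
      ∫ p, ρ p.1 s p.2 * (momVec ξ s p j * χ p.2) ∂(μ.prod torusMeasure) := fun s hs =>
    h.integral_kinetic (hτ s hs) (hn s hs) (g := fun z => z.2 j * χ z.1) (by fun_prop)
  have hc : ∀ i, Continuous (torusPartial i χ) := fun i => (hχ.partial i).continuous
  have h2 := h.integral_kinetic (hτ t ht) (hn t ht) (g := fun z => (∑ i, z.2 i * z.2 j * torusPartial i χ z.1)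
        - torusPartial j (pot (avg μ fun θ => ρ θ t)) z.1 * χ z.1) (by
    rw [torusPartial_eq_D h.r_pos (h.pot_ne_top (hτ t ht))]; fun_prop)
  refine (hd.hasDerivWithinAt.congr h1 (h1 t ht)).congr_deriv ?_
  rw [h2]
  simp only [transportOp_momentum_mul, torusPartial_eq_D h.r_pos (h.pot_ne_top (hτ t ht)), fieldVec,
    neg_mul, sub_eq_add_neg]

lemma kinetic_vlasov (hT₀ : 0 < T) {E : ℝ → C(T3, R3)} (hE : ∀ t ∈ Icc 0 T, ∀ x, E t x = fieldVec μ ρ t x)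
    {ψ : ℝ → T3 → R3 → ℝ} (hψ : IsTestFunction T ψ) :
    ∫ t in Ico 0 T, ∫ z : T3 × R3, transportOp (E t) ψ t z.1 z.2 ∂(kinetic μ ρ ξ t) =
      -∫ z, ψ 0 z.1 z.2 ∂(kinetic μ ρ ξ 0) := by
  obtain ⟨hs, T', hT', R, hvan⟩ := hψ
  have hτ : ∀ t ∈ Icc 0 T, |t| < τ := fun t ht => by
    rw [abs_of_nonneg ht.1]; exact ht.2.trans_lt hT
  have hΨ : ContDiff ℝ 1 (phaseLift ψ) := ContDiff.of_le hs (by simp)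
  have hψc : Continuous fun p : ℝ × T3 × R3 => ψ p.1 p.2.1 p.2.2 := continuous_of_phaseLift hΨ.continuous
  obtain ⟨K, hK⟩ := h.transport_identity hΨ le_rfl
  set G : ℝ → ℝ := fun s => ∫ p, ρ p.1 s p.2 * ψ s p.2 (momVec ξ s p) ∂(μ.prod torusMeasure) with hG
  have hGd : ∀ t, |t| < τ → HasDerivAt G (deriv G t) t := fun t ht => (hK t ht).1.differentiableAt.hasDerivAt
  have h1 : ∀ t ∈ Ico 0 T, ∫ z : T3 × R3, transportOp (E t) ψ t z.1 z.2 ∂(kinetic μ ρ ξ t) = deriv G t :=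
    fun t ht => by
    have ht' := Ico_subset_Icc_self ht
    have hc := (continuous_transportOp (E t).continuous hΨ).comp (Continuous.prodMk_right t)
    rw [h.integral_kinetic (hτ t ht') (fun θ => h.nonneg hT (hpos θ) t ht')
      (g := fun z => transportOp (E t) ψ t z.1 z.2) hc, (hK t (hτ t ht')).1.deriv]
    have hEt : ⇑(E t) = fieldVec μ ρ t := funext (hE t ht')
    rw [hEt]
  -- A derivative is measurable, and the bound `K` makes it integrable; its continuity is not needed
  -- for the fundamental theorem of calculus.
  have hint : IntervalIntegrable (deriv G) volume 0 T := by
    rw [intervalIntegrable_iff_integrableOn_Ioc_of_le hT₀.le]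
    refine (integrableOn_const (C := K) (by simp)).mono' (measurable_deriv G).aestronglyMeasurable ?_
    filter_upwards [ae_restrict_mem measurableSet_Ioc] with t ht
    have := hK t (hτ t (Ioc_subset_Icc_self ht))
    rw [this.1.deriv]
    exact this.2
  rw [setIntegral_congr_fun measurableSet_Ico h1, integral_Ico_eq_integral_Ioc,
    ← intervalIntegral.integral_of_le hT₀.le, intervalIntegral.integral_eq_sub_of_hasDerivAt
      (fun t ht => hGd t (hτ t (by rwa [uIcc_of_le hT₀.le] at ht))) hint]
  -- The test function vanishes from `T' < T` onwards, so only the initial term remains.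
  have hGT : G T = 0 := by
    simp only [hG, hvan T hT₀.le _ _ (Or.inl hT'.le), mul_zero, integral_zero]
  have h0 : (0 : ℝ) ∈ Icc 0 T := ⟨le_rfl, hT₀.le⟩
  rw [hGT, zero_sub, h.integral_kinetic (hτ 0 h0) hpos (g := fun z => ψ 0 z.1 z.2)
    (hψc.comp (Continuous.prodMk_right 0))]

theorem isSuitableSolution (hT₀ : 0 < T) (hmass : ∫ θ, ∫ x, ρ θ 0 x ∂torusMeasure ∂μ = 1) :
    IsSuitableSolution T (kinetic μ ρ ξ 0) (kinetic μ ρ ξ) fun t => pot (avg μ fun θ => ρ θ t) := by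
  have hτ : ∀ t ∈ Ico 0 T, |t| < τ := fun t ht => by
    rw [abs_of_nonneg ht.1]; exact ht.2.trans hT
  have hn : ∀ t ∈ Ico 0 T, ∀ θ x, 0 ≤ ρ θ t x := fun t ht' θ =>
    h.nonneg hT (hpos θ) t (Ico_subset_Icc_self ht')
  have h0 : (0 : ℝ) ∈ Ico 0 T := ⟨le_rfl, hT₀⟩
  refine ⟨?_, ⟨C.toNNReal, ?_⟩, ⟨(3 * C).toNNReal ^ 4, ?_⟩⟩
  · exact
    { initial_mem := h.isP2_kinetic (hτ 0 h0) hpos hmass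
      mem := fun t ht => h.isP2_kinetic (hτ t ht) (hn t ht) hmass
      initial := rfl
      continuous := h.continuousOn_kinetic hT hpos
      contDiff_potential := fun t ht => by
        exact_mod_cast torusContDiff (n := 1) h.r_pos (h.pot_ne_top (hτ t ht))
      vlasov := by
        obtain ⟨E, hEc, hE⟩ := h.exists_force hT₀ hT
        refine ⟨E, fun t ht x j => ?_, hEc.integrableOn_Icc.mono_set Ico_subset_Icc_self,
          fun ψ hψ => h.kinetic_vlasov hT hpos hT₀ hE hψ⟩
        rw [hE t (Ico_subset_Icc_self ht), torusPartial_eq_D h.r_pos (h.pot_ne_top (hτ t ht))]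
        rfl
      poisson := fun t ht χ hχ => h.kinetic_poisson (hτ t ht) (hn t ht) hmass χ hχ
      current := fun t ht j χ hχ => h.kinetic_current hT hpos j χ hχ ht }
  · filter_upwards [ae_restrict_mem measurableSet_Ico] with t ht
    exact h.exists_density (hτ t ht) (hn t ht)
  · filter_upwards [ae_restrict_mem measurableSet_Ico] with t ht
    exact h.lintegral_kinetic_le (hτ t ht) (hn t ht) hmass

end

end LocalSolution

end

end VlasovPoisson

/-! ### The main theorem. -/

theorem mainTheorem3 {M : Type*} [MeasurableSpace M] (μ : Measure M) [IsProbabilityMeasure μ]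
    (δ₀ δ₁ C₀ : ℝ) (hδ₁ : 1 < δ₁) (hδ : δ₁ < δ₀) (hC₀ : 0 < C₀)
    (ρ0 : M → C(VlasovPoisson.T3, ℝ)) (ξ0 : M → Fin 3 → C(VlasovPoisson.T3, ℝ))
    (hρ_meas : ∀ x, Measurable fun θ => ρ0 θ x)
    (hξ_meas : ∀ j x, Measurable fun θ => ξ0 θ j x)
    (hρ : ∀ θ, VlasovPoisson.MemB δ₀ (ρ0 θ) ∧ VlasovPoisson.bNorm δ₀ (ρ0 θ) ≤ C₀)
    (hξ : ∀ θ j, VlasovPoisson.MemB δ₀ (ξ0 θ j) ∧ VlasovPoisson.bNorm δ₀ (ξ0 θ j) ≤ C₀)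
    (hmass : ∫ θ, ∫ x, ρ0 θ x ∂VlasovPoisson.torusMeasure ∂μ = 1) :
    ∃ T₀ > 0, ∃ (ρ : M → ℝ → C(VlasovPoisson.T3, ℝ))
      (ξ : M → ℝ → Fin 3 → C(VlasovPoisson.T3, ℝ)) (φ : ℝ → C(VlasovPoisson.T3, ℝ)),
      (∀ θ, VlasovPoisson.ContinuousInB T₀ δ₁ (ρ θ)) ∧
      (∀ θ j, VlasovPoisson.ContinuousInB T₀ δ₁ fun t => ξ θ t j) ∧
      (∃ C : ℝ, ∀ θ, ∀ t ∈ Icc 0 T₀, VlasovPoisson.bNorm δ₁ (ρ θ t) ≤ C ∧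
        ∀ j, VlasovPoisson.bNorm δ₁ (ξ θ t j) ≤ C) ∧
      VlasovPoisson.IsMultifluidSolution μ T₀ ρ0 ξ0 ρ ξ φ ∧
      ((∀ θ x, 0 ≤ ρ0 θ x) →
        (∀ θ, ∀ t ∈ Icc 0 T₀, ∀ x, 0 ≤ ρ θ t x) ∧
        VlasovPoisson.IsSuitableSolution T₀ (VlasovPoisson.multifluidMeasure μ ρ0 ξ0)
          (fun t => VlasovPoisson.multifluidMeasure μ (fun θ => ρ θ t) (fun θ => ξ θ t)) φ) := by

  have hδ₁0 : 0 < δ₁ := zero_lt_one.trans hδ₁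
  have hδ₀0 : 0 < δ₀ := hδ₁0.trans hδ
  -- The radii are `log δ`, for which `e^(r|k|)` is the weight `δ^|k|`.
  obtain ⟨τ, hτ, C, ρ, ξ, h, hρ0, hξ0⟩ := VlasovPoisson.exists_localSolution μ (Real.log_pos hδ₁)
    (Real.log_lt_log hδ₁0 hδ) hC₀ hρ_meas hξ_meas
    (fun θ => by
      rw [VlasovPoisson.wN_eq_ofReal hδ₀0 (hρ θ).1]; exact ENNReal.ofReal_le_ofReal (hρ θ).2)
    (fun θ j => by
      rw [VlasovPoisson.wN_eq_ofReal hδ₀0 (hξ θ j).1]; exact ENNReal.ofReal_le_ofReal (hξ θ j).2)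
  obtain rfl : (fun θ => ρ θ 0) = ρ0 := funext hρ0
  obtain rfl : (fun θ => ξ θ 0) = ξ0 := funext hξ0
  -- Halving the time puts the closed interval inside the open interval of the local solution.
  have hT : τ / 2 < τ := half_lt_self hτ
  have ht : ∀ t ∈ Icc 0 (τ / 2), |t| < τ := fun t ht => by
    rw [abs_of_nonneg ht.1]; exact ht.2.trans_lt hT
  have hb : ∀ {g : C(VlasovPoisson.T3, ℝ)}, VlasovPoisson.wN (Real.log δ₁) g ≤ ENNReal.ofReal C →
      VlasovPoisson.bNorm δ₁ g ≤ C := fun hg => by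
    rw [VlasovPoisson.bNorm_eq hδ₁0]
    exact (ENNReal.toReal_mono ENNReal.ofReal_ne_top hg).trans (ENNReal.toReal_ofReal h.C_nonneg).le
  refine ⟨τ / 2, half_pos hτ, ρ, ξ, fun t => VlasovPoisson.pot (VlasovPoisson.avg μ fun θ => ρ θ t),
    fun θ => VlasovPoisson.LocalSolution.continuousInB hδ₁0 hT (fun t => h.den_ne_top θ) (h.tendsto_den θ),
    fun θ j => VlasovPoisson.LocalSolution.continuousInB hδ₁0 hT (fun t ht => h.mom_ne_top θ ht j)
      fun t ht => h.tendsto_mom θ t ht j,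
    ⟨C, fun θ t ht' => ⟨hb (h.bound_den θ t (ht t ht')), fun j => hb (h.bound_mom θ t (ht t ht') j)⟩⟩,
    h.isMultifluidSolution hT hmass, fun hpos => ⟨fun θ => h.nonneg hT (hpos θ),
      h.isSuitableSolution hT hpos (half_pos hτ) hmass⟩⟩
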